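/- Let $G(\xi)=\frac1{4\pi}e^{-|\xi|^2/4}$, $v^G(\xi)=\frac{1}{2\pi}\frac{\xi^\perp}{|\xi|^2}\bigl(1-e^{-|\xi|^2/4}\bigr)$ and $K(\xi)=\frac1{2\pi}\frac{\xi^\perp}{|\xi|^2}$ for $\xi\in\mathbb R^2$, where $\xi^\perp=(-\xi_2,\xi_1)$. Let $X=L^2(\infty)$ be the complex Hilbert space of (classes of) measurable functions $w:\mathbb R^2\to\mathbb C$ with $\int_{\mathbb R^2} G^{-1}|w|^2\,d\xi<\infty$, with scalar product $\langle w_1,w_2\rangle=\int_{\mathbb R^2} G^{-1}\,\overline{w_1}\,w_2\,d\xi$. Consider in $X$ the operators $$Lw=\Delta w+\tfrac{\xi}{2}\cdot\nabla w+w,\qquad \Lambda w=v^G\cdot\nabla w+(K*w)\cdot\nabla G,$$ understood in the sense of distributions, with their maximal domains $D(L)=\{w\in X: Lw\in X\}$ and $D(\Lambda)=\{w\in X:\Lambda w\in X\}$. For $\alpha\in\mathbb R$, the operator $L-\alpha\Lambda$ has domain $D(L)\cap D(\Lambda)$, and $L_\perp-\alpha\Lambda_\perp$ denotes its restriction to the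 Hilbert space $\ker(\Lambda)^\perp\subset X$, that is, the operator in $\ker(\Lambda)^\perp$ with domain $\{w\in D(L)\cap D(\Lambda)\cap\ker(\Lambda)^\perp : (L-\alpha\Lambda)w\in\ker(\Lambda)^\perp\}$. Define $$\Sigma(\alpha)=\inf\bigl\{\operatorname{Re}(z) : z\in\operatorname{spec}(-L_\perp+\alpha\Lambda_\perp)\bigr\},\qquad \Psi(\alpha)=\Bigl(\sup_{\lambda\in\mathbb R}\bigl\|(L_\perp-\alpha\Lambda_\perp-i\lambda)^{-1}\bigr\|\Bigr)^{-1},$$ where $\|(L_\perp-\alpha\Lambda_\perp-i\lambda)^{-1}\|=\infty$ if $i\lambda$ belongs to the spectrum of $L_\perp-\alpha\Lambda_\perp$, and where $\inf\emptyset=+\infty$, $\infty^{-1}=0$, $0^{-1}=\infty$. Then, for every $\alpha\in\mathbb R$, $$\Sigma(\alpha)\ \ge\ \Psi(\alpha)\ \ge\ 1 .$$ -/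

import Mathlib

open MeasureTheory Filter InnerProductSpace
open scoped ENNReal ContDiff

noncomputable section

namespace LambOseen

/-- The plane `ℝ²` with its Euclidean norm. -/
abbrev Plane : Type := EuclideanSpace ℝ (Fin 2)

/-- The rotated vector `ξ^⊥ = (-ξ₂, ξ₁)`. -/
def perp (x : Plane) : Plane := !₂[-x 1, x 0]

/-- The Gaussian vorticity profile `G(ξ) = (4π)⁻¹ exp(-|ξ|²/4)`. -/
def G (x : Plane) : ℝ := (4 * Real.pi)⁻¹ * Real.exp (-‖x‖ ^ 2 / 4)

/-- The velocity profile `v^G(ξ) = (2π)⁻¹ (1 - exp(-|ξ|²/4)) ξ^⊥ / |ξ|²`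
(with the continuous value `0` at the origin). -/
def vG (x : Plane) : Plane :=
  ((2 * Real.pi)⁻¹ * (1 - Real.exp (-‖x‖ ^ 2 / 4)) / ‖x‖ ^ 2) • perp x

/-- The Biot-Savart kernel `K(ξ) = (2π)⁻¹ ξ^⊥ / |ξ|²`. -/
def K (x : Plane) : Plane := ((2 * Real.pi)⁻¹ / ‖x‖ ^ 2) • perp x

/-- The measure `G(ξ)⁻¹ dξ` on the plane. -/
def weight : Measure Plane := volume.withDensity fun x => ENNReal.ofReal (G x)⁻¹

/-- The complexified Hilbert space `X = L²(∞)`, with the scalar product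
`⟨w₁, w₂⟩ = ∫ G⁻¹ conj(w₁) w₂ dξ`. -/
abbrev X : Type := Lp ℂ 2 weight

/-- The `i`-th component of the velocity field `K * w`. -/
def velocity (w : Plane → ℂ) (i : Fin 2) (x : Plane) : ℂ := ∫ y, K (x - y) i • w y

/-- The nonlocal term `(K * w) · ∇G`. -/
def stretch (w : Plane → ℂ) (x : Plane) : ℂ := ∑ i, gradient G x i • velocity w i x

/-- `f = Δw + (ξ/2)·∇w + w` in the sense of distributions; the formal adjoint of
`Δ + (ξ/2)·∇ + 1` on `ℝ²` is `Δ - (ξ/2)·∇`. -/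
def IsL (w f : Plane → ℂ) : Prop :=
  ∀ φ : Plane → ℝ, ContDiff ℝ ∞ φ → HasCompactSupport φ →
    ∫ x, φ x • f x = ∫ x, (Laplacian.laplacian φ x - (1 / 2) * fderiv ℝ φ x x) • w x

/-- `f = v^G·∇w + (K * w)·∇G` in the sense of distributions; since `v^G` is divergence free,
the formal adjoint of `v^G·∇` is `-v^G·∇`. -/
def IsΛ (w f : Plane → ℂ) : Prop :=
  ∀ φ : Plane → ℝ, ContDiff ℝ ∞ φ → HasCompactSupport φ →
    ∫ x, φ x • f x = -(∫ x, fderiv ℝ φ x (vG x) • w x) + ∫ x, φ x • stretch w x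

/-! ### Elementary facts: the two distributional relations are graphs of linear operators -/

lemma G_pos (x : Plane) : 0 < G x := by unfold G; positivity

lemma continuous_G : Continuous G := by unfold G; fun_prop

lemma measurable_dens : Measurable fun x : Plane => ENNReal.ofReal (G x)⁻¹ :=
  (continuous_G.measurable.inv).ennreal_ofReal

lemma volume_ac : (volume : Measure Plane) ≪ weight :=
  withDensity_absolutelyContinuous' measurable_dens.aemeasurable
    (Eventually.of_forall fun x => by
      simpa using G_pos x)

lemma weight_ac : weight ≪ (volume : Measure Plane) := withDensity_absolutelyContinuous _ _

lemma integrable_weight_iff (f : Plane → ℂ) :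
    Integrable f weight ↔ Integrable (fun x => (G x)⁻¹ • f x) volume := by
  unfold weight
  rw [integrable_withDensity_iff_integrable_smul' measurable_dens (by simp)]
  refine integrable_congr (Eventually.of_forall fun x => ?_)
  simp only
  rw [ENNReal.toReal_ofReal (inv_nonneg.2 (G_pos x).le)]

lemma integrable_G : Integrable (fun x => (G x : ℂ)) volume := by
  have h := GaussianFourier.integrable_cexp_neg_mul_sq_norm_add_of_euclideanSpace
    (ι := Fin 2) (b := (1 / 4 : ℂ)) (by norm_num) 0 0
  have h2 := h.const_mul (((4 * Real.pi)⁻¹ : ℝ) : ℂ)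
  refine h2.congr (Eventually.of_forall fun x => ?_)
  simp only [G]
  push_cast
  congr 2
  ring

lemma memLp_G : MemLp (fun x => (G x : ℂ)) 2 weight := by
  have hm : AEStronglyMeasurable (fun x => (G x : ℂ)) weight :=
    (Complex.continuous_ofReal.comp continuous_G).aestronglyMeasurable
  rw [memLp_two_iff_integrable_sq_norm hm]
  have : Integrable (fun x => ((G x : ℂ)) ^ 2) weight := by
    rw [integrable_weight_iff]
    refine integrable_G.congr (Eventually.of_forall fun x => ?_)
    have := (G_pos x).ne'
    simp only [Complex.real_smul]
    push_cast
    have h2 : (G x : ℂ) ≠ 0 := by exact_mod_cast this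
    field_simp
  simpa using this.norm

lemma integrable_coe (w : X) : Integrable (w : Plane → ℂ) volume := by
  have h : Integrable (fun x => (G x : ℂ) * w x) weight :=
    memLp_one_iff_integrable.1 ((Lp.memLp w).mul memLp_G)
  rw [integrable_weight_iff] at h
  refine h.congr (Eventually.of_forall fun x => ?_)
  have h2 : (G x : ℂ) ≠ 0 := by exact_mod_cast (G_pos x).ne'
  simp only [Complex.real_smul]
  push_cast
  field_simp

lemma add_ae (v w : X) : ((v + w : X) : Plane → ℂ) =ᵐ[volume] fun x => v x + w x :=
  volume_ac.ae_eq (Lp.coeFn_add v w)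

lemma smul_ae (c : ℂ) (w : X) : ((c • w : X) : Plane → ℂ) =ᵐ[volume] fun x => c * w x :=
  volume_ac.ae_eq (Lp.coeFn_smul c w)

lemma zero_ae : ((0 : X) : Plane → ℂ) =ᵐ[volume] fun _ => 0 :=
  volume_ac.ae_eq (Lp.coeFn_zero ℂ 2 weight)

lemma norm_perp (x : Plane) : ‖perp x‖ = ‖x‖ := by
  simp [perp, EuclideanSpace.norm_eq, Fin.sum_univ_two, add_comm]

lemma continuous_perp : Continuous perp := by
  unfold perp
  fun_prop

lemma measurable_K : Measurable K := by
  unfold K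
  exact (by fun_prop : Measurable fun x : Plane => (2 * Real.pi)⁻¹ / ‖x‖ ^ 2).smul
    continuous_perp.measurable

lemma measurable_vG : Measurable vG := by
  unfold vG
  exact (by fun_prop : Measurable fun x : Plane =>
    (2 * Real.pi)⁻¹ * (1 - Real.exp (-‖x‖ ^ 2 / 4)) / ‖x‖ ^ 2).smul
    continuous_perp.measurable

lemma norm_K_le (x : Plane) : ‖K x‖ ≤ ‖x‖⁻¹ := by
  have hpi : (2 * Real.pi)⁻¹ ≤ 1 := inv_le_one_of_one_le₀ (by linarith [Real.pi_gt_three])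
  rcases eq_or_ne ‖x‖ 0 with h | h
  · simp [K, h]
  have h0 : 0 < ‖x‖ := lt_of_le_of_ne (norm_nonneg _) h.symm
  rw [K, norm_smul, norm_perp, Real.norm_of_nonneg (by positivity)]
  calc (2 * Real.pi)⁻¹ / ‖x‖ ^ 2 * ‖x‖ ≤ 1 / ‖x‖ ^ 2 * ‖x‖ := by gcongr
    _ = ‖x‖⁻¹ := by field_simp

lemma norm_vG_le (x : Plane) : ‖vG x‖ ≤ ‖x‖ := by
  have hpi : (2 * Real.pi)⁻¹ ≤ 1 := inv_le_one_of_one_le₀ (by linarith [Real.pi_gt_three])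
  rcases eq_or_ne ‖x‖ 0 with h | h
  · simp [vG, h]
  have h0 : 0 < ‖x‖ := lt_of_le_of_ne (norm_nonneg _) h.symm
  have h1 : Real.exp (-‖x‖ ^ 2 / 4) ≤ 1 := Real.exp_le_one_iff.2 (by nlinarith)
  have h2 : 1 - Real.exp (-‖x‖ ^ 2 / 4) ≤ ‖x‖ ^ 2 := by
    nlinarith [Real.add_one_le_exp (-‖x‖ ^ 2 / 4)]
  have h3 : 0 ≤ 1 - Real.exp (-‖x‖ ^ 2 / 4) := by linarith
  rw [vG, norm_smul, norm_perp, Real.norm_of_nonneg (by positivity)]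
  calc (2 * Real.pi)⁻¹ * (1 - Real.exp (-‖x‖ ^ 2 / 4)) / ‖x‖ ^ 2 * ‖x‖
      ≤ 1 * ‖x‖ ^ 2 / ‖x‖ ^ 2 * ‖x‖ := by gcongr
    _ = ‖x‖ := by field_simp

/-- The part of a kernel component near the origin. -/
def nearK (i : Fin 2) : Plane → ℂ := (Metric.ball 0 1).indicator fun x => (K x i : ℂ)

/-- The part of a kernel component away from the origin. -/
def farK (i : Fin 2) : Plane → ℂ := (Metric.ball 0 1)ᶜ.indicator fun x => (K x i : ℂ)

lemma measurable_Ki (i : Fin 2) : Measurable fun x => (K x i : ℂ) :=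
  Complex.measurable_ofReal.comp
    ((by fun_prop : Measurable fun v : Plane => v i).comp measurable_K)

lemma norm_Ki_le (i : Fin 2) (x : Plane) : ‖(K x i : ℂ)‖ ≤ ‖x‖⁻¹ := by
  rw [Complex.norm_real]
  exact (PiLp.norm_apply_le (K x) i).trans (norm_K_le x)

lemma integrable_nearK (i : Fin 2) : Integrable (nearK i) volume := by
  unfold nearK
  rw [integrable_indicator_iff Metric.isOpen_ball.measurableSet]
  refine integrableOn_ball_of_norm_le_rpow (C := 1) (α := 1) (by simp) (by simp)
    (Eventually.of_forall fun x => ?_) (measurable_Ki i).aestronglyMeasurable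
  simpa [Real.rpow_neg_one] using norm_Ki_le i x

lemma norm_farK_le (i : Fin 2) (x : Plane) : ‖farK i x‖ ≤ 1 := by
  unfold farK
  by_cases h : x ∈ (Metric.ball (0 : Plane) 1)ᶜ
  · rw [Set.indicator_of_mem h]
    refine (norm_Ki_le i x).trans (inv_le_one_of_one_le₀ ?_)
    simpa using h
  · rw [Set.indicator_of_notMem h]
    simp

lemma measurable_farK (i : Fin 2) : Measurable (farK i) :=
  (measurable_Ki i).indicator Metric.isOpen_ball.measurableSet.compl

lemma near_add_far (i : Fin 2) (x : Plane) : nearK i x + farK i x = (K x i : ℂ) := by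
  unfold nearK farK
  exact congrFun (Set.indicator_self_add_compl (Metric.ball (0 : Plane) 1)
    (fun x => (K x i : ℂ))) x

lemma integrable_far (w : X) (i : Fin 2) (x : Plane) :
    Integrable (fun y => farK i (x - y) * w y) volume :=
  (integrable_coe w).bdd_mul
    ((measurable_farK i).comp (measurable_const.sub measurable_id)).aestronglyMeasurable
    (Eventually.of_forall fun y => norm_farK_le i (x - y))

lemma integrable_near (w : X) (i : Fin 2) :
    ∀ᵐ x ∂(volume : Measure Plane), Integrable (fun y => nearK i (x - y) * w y) volume := by
  have h := (integrable_coe w).ae_convolution_exists (ContinuousLinearMap.mul ℝ ℂ)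
    (integrable_nearK i)
  filter_upwards [h] with x hx
  refine hx.congr (Eventually.of_forall fun y => ?_)
  simp [mul_comm]

/-- The Biot-Savart integral converges absolutely at almost every point. -/
lemma integrable_velocity (w : X) (i : Fin 2) :
    ∀ᵐ x ∂(volume : Measure Plane), Integrable (fun y => K (x - y) i • w y) volume := by
  filter_upwards [integrable_near w i] with x hx
  refine (hx.add (integrable_far w i x)).congr (Eventually.of_forall fun y => ?_)
  simp only [Pi.add_apply, Complex.real_smul]
  rw [← near_add_far, add_mul]

lemma locallyIntegrable_velocity (w : X) (i : Fin 2) :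
    LocallyIntegrable (velocity w i) volume := by
  have h1 : Integrable (fun x => ∫ y, nearK i (x - y) * w y) volume := by
    refine ((integrable_coe w).integrable_convolution (ContinuousLinearMap.mul ℝ ℂ)
      (integrable_nearK i)).congr (Eventually.of_forall fun x => ?_)
    simp [convolution, mul_comm]
  have hm : AEStronglyMeasurable (fun x => ∫ y, farK i (x - y) * w y) volume := by
    have : AEStronglyMeasurable (fun p : Plane × Plane => farK i (p.1 - p.2) * w p.2)
        ((volume : Measure Plane).prod volume) :=
      ((measurable_farK i).comp (measurable_fst.sub measurable_snd)).aestronglyMeasurable.mul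
        ((integrable_coe w).1.comp_snd)
    exact this.integral_prod_right'
  have h2 : LocallyIntegrable (fun x => ∫ y, farK i (x - y) * w y) volume := by
    refine (locallyIntegrable_const (∫ y, ‖w y‖ : ℝ)).mono hm (Eventually.of_forall fun x => ?_)
    refine (norm_integral_le_integral_norm _).trans ?_
    refine le_trans (integral_mono (integrable_far w i x).norm (integrable_coe w).norm ?_)
      (le_abs_self _)
    intro y
    simp only [norm_mul]
    exact mul_le_of_le_one_left (norm_nonneg _) (norm_farK_le i _)
  refine (h1.locallyIntegrable.add h2).congr ?_
  filter_upwards [integrable_near w i] with x hx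
  simp only [Pi.add_apply, velocity]
  rw [← integral_add hx (integrable_far w i x)]
  refine integral_congr_ae (Eventually.of_forall fun y => ?_)
  simp only [Complex.real_smul]
  rw [← near_add_far, add_mul]

lemma velocity_add (v w : X) (i : Fin 2) :
    velocity ((v + w : X) : Plane → ℂ) i =ᵐ[volume] fun x => velocity v i x + velocity w i x := by
  filter_upwards [integrable_velocity v i, integrable_velocity w i] with x hv hw
  unfold velocity
  rw [← integral_add hv hw]
  refine integral_congr_ae ?_
  filter_upwards [add_ae v w] with y hy
  rw [hy, smul_add]

lemma velocity_smul (c : ℂ) (w : X) (i : Fin 2) (x : Plane) :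
    velocity ((c • w : X) : Plane → ℂ) i x = c * velocity w i x := by
  unfold velocity
  rw [← integral_const_mul]
  refine integral_congr_ae ?_
  filter_upwards [smul_ae c w] with y hy
  rw [hy, mul_smul_comm]

lemma stretch_add (v w : X) :
    stretch ((v + w : X) : Plane → ℂ) =ᵐ[volume] fun x => stretch v x + stretch w x := by
  filter_upwards [velocity_add v w 0, velocity_add v w 1] with x h0 h1
  simp only [stretch, Fin.sum_univ_two, h0, h1, smul_add]
  ring

lemma stretch_smul (c : ℂ) (w : X) (x : Plane) :
    stretch ((c • w : X) : Plane → ℂ) x = c * stretch w x := by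
  simp only [stretch, Fin.sum_univ_two, velocity_smul, mul_add, mul_smul_comm]

lemma contDiff_G : ContDiff ℝ ∞ G := by
  unfold G
  have : ContDiff ℝ ∞ fun x : Plane => ‖x‖ ^ 2 := contDiff_norm_sq ℝ
  fun_prop

lemma continuous_gradient_G (i : Fin 2) : Continuous fun x => gradient G x i := by
  have h : Continuous (gradient G) := by
    unfold gradient
    exact (InnerProductSpace.toDual ℝ Plane).symm.continuous.comp
      (contDiff_G.continuous_fderiv (by simp))
  fun_prop

lemma integrable_smul_stretch (w : X) {φ : Plane → ℝ} (h1 : Continuous φ)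
    (h2 : HasCompactSupport φ) : Integrable (fun x => φ x • stretch w x) volume := by
  have h : ∀ i : Fin 2,
      Integrable (fun x => (φ x * gradient G x i) • velocity w i x) volume := fun i =>
    (locallyIntegrable_velocity w i).integrable_smul_left_of_hasCompactSupport
      (h1.mul (continuous_gradient_G i)) h2.mul_right
  refine ((h 0).add (h 1)).congr (Eventually.of_forall fun x => ?_)
  simp [stretch, Fin.sum_univ_two, smul_add, mul_assoc]

lemma integrable_smul (w : X) {φ : Plane → ℝ} (h1 : Continuous φ)
    (h2 : HasCompactSupport φ) : Integrable (fun x => φ x • w x) volume :=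
  (integrable_coe w).locallyIntegrable.integrable_smul_left_of_hasCompactSupport h1 h2

lemma hasCompactSupport_fderiv_apply {φ : Plane → ℝ} (h2 : HasCompactSupport φ)
    (V : Plane → Plane) : HasCompactSupport fun x => fderiv ℝ φ x (V x) := by
  refine (h2.fderiv (𝕜 := ℝ)).mono fun x hx => ?_
  contrapose! hx
  simp at hx
  simp [hx]

lemma integrable_fderiv_vG (w : X) {φ : Plane → ℝ} (h1 : ContDiff ℝ ∞ φ)
    (h2 : HasCompactSupport φ) :
    Integrable (fun x => fderiv ℝ φ x (vG x) • w x) volume := by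
  have hc : Continuous (fderiv ℝ φ) := h1.continuous_fderiv (by simp)
  have hb : Continuous fun x => ‖fderiv ℝ φ x‖ * ‖x‖ := by fun_prop
  have hs : HasCompactSupport fun x => ‖fderiv ℝ φ x‖ * ‖x‖ :=
    ((h2.fderiv (𝕜 := ℝ)).norm).mul_right
  obtain ⟨C, hC⟩ := hs.exists_bound_of_continuous hb
  have hm : Measurable fun x => fderiv ℝ φ x (vG x) :=
    (isBoundedBilinearMap_apply (𝕜 := ℝ) (E := Plane) (F := ℝ)).continuous.measurable.comp
      (hc.measurable.prodMk measurable_vG)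
  refine (integrable_coe w).bdd_smul C hm.aestronglyMeasurable
    (Eventually.of_forall fun x => ?_)
  refine le_trans ?_ ((le_abs_self _).trans (hC x))
  exact ((fderiv ℝ φ x).le_opNorm _).trans
    (mul_le_mul_of_nonneg_left (norm_vG_le x) (norm_nonneg _))

lemma continuous_laplacian {φ : Plane → ℝ} (h1 : ContDiff ℝ ∞ φ) :
    Continuous (Laplacian.laplacian φ) := by
  rw [laplacian_eq_iteratedFDeriv_stdOrthonormalBasis]
  have := h1.continuous_iteratedFDeriv (m := 2) (WithTop.coe_le_coe.2 (le_top : (2 : ℕ∞) ≤ ⊤))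
  fun_prop

lemma hasCompactSupport_laplacian {φ : Plane → ℝ} (h2 : HasCompactSupport φ) :
    HasCompactSupport (Laplacian.laplacian φ) := by
  refine (h2.iteratedFDeriv (𝕜 := ℝ) 2).mono fun x hx => ?_
  contrapose! hx
  simp at hx
  simp [laplacian_eq_iteratedFDeriv_stdOrthonormalBasis, hx]

lemma integrable_adjL (w : X) {φ : Plane → ℝ} (h1 : ContDiff ℝ ∞ φ)
    (h2 : HasCompactSupport φ) :
    Integrable (fun x => (Laplacian.laplacian φ x - (1 / 2) * fderiv ℝ φ x x) • w x) volume := by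
  have hc : Continuous (fderiv ℝ φ) := h1.continuous_fderiv (by simp)
  refine integrable_smul w ((continuous_laplacian h1).sub ?_)
    ((hasCompactSupport_laplacian h2).sub ?_)
  · fun_prop
  · exact (hasCompactSupport_fderiv_apply h2 id).mul_left

lemma integral_smul_add (v w : X) (a : Plane → ℝ) (hv : Integrable (fun x => a x • v x) volume)
    (hw : Integrable (fun x => a x • w x) volume) :
    ∫ x, a x • (v + w : X) x = (∫ x, a x • v x) + ∫ x, a x • w x := by
  rw [← integral_add hv hw]
  refine integral_congr_ae ?_
  filter_upwards [add_ae v w] with x hx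
  rw [hx, smul_add]

lemma integral_smul_smul (c : ℂ) (w : X) (a : Plane → ℝ) :
    ∫ x, a x • (c • w : X) x = c * ∫ x, a x • w x := by
  rw [← integral_const_mul]
  refine integral_congr_ae ?_
  filter_upwards [smul_ae c w] with x hx
  rw [hx, mul_smul_comm]

lemma integral_smul_zero (a : Plane → ℝ) : ∫ x, a x • (0 : X) x = 0 := by
  refine integral_eq_zero_of_ae ?_
  filter_upwards [zero_ae] with x hx
  rw [hx, smul_zero, Pi.zero_apply]

/-- The graph of `L` on its maximal domain in `X`. -/
def graphL : Submodule ℂ (X × X) where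
  carrier := {p | IsL p.1 p.2}
  zero_mem' := by
    intro φ _ _
    simp only [Prod.fst_zero, Prod.snd_zero, integral_smul_zero]
  add_mem' := by
    intro p q hp hq φ h1 h2
    simp only [Prod.fst_add, Prod.snd_add]
    rw [integral_smul_add _ _ _ (integrable_smul _ h1.continuous h2)
      (integrable_smul _ h1.continuous h2), hp φ h1 h2, hq φ h1 h2,
      integral_smul_add _ _ _ (integrable_adjL _ h1 h2) (integrable_adjL _ h1 h2)]
  smul_mem' := by
    intro c p hp φ h1 h2
    simp only [Prod.smul_fst, Prod.smul_snd]
    rw [integral_smul_smul, integral_smul_smul, hp φ h1 h2]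

lemma integral_stretch_add (v w : X) {φ : Plane → ℝ} (h1 : Continuous φ)
    (h2 : HasCompactSupport φ) :
    ∫ x, φ x • stretch ((v + w : X) : Plane → ℂ) x
      = (∫ x, φ x • stretch v x) + ∫ x, φ x • stretch w x := by
  rw [← integral_add (integrable_smul_stretch v h1 h2) (integrable_smul_stretch w h1 h2)]
  refine integral_congr_ae ?_
  filter_upwards [stretch_add v w] with x hx
  rw [hx, smul_add]

lemma integral_stretch_smul (c : ℂ) (w : X) (φ : Plane → ℝ) :
    ∫ x, φ x • stretch ((c • w : X) : Plane → ℂ) x = c * ∫ x, φ x • stretch w x := by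
  rw [← integral_const_mul]
  refine integral_congr_ae (Eventually.of_forall fun x => ?_)
  simp only
  rw [stretch_smul, mul_smul_comm]

lemma integral_stretch_zero (φ : Plane → ℝ) :
    ∫ x, φ x • stretch ((0 : X) : Plane → ℂ) x = 0 := by
  have := integral_stretch_smul 0 0 φ
  rwa [zero_smul, zero_mul] at this

/-- The graph of `Λ` on its maximal domain in `X`. -/
def graphΛ : Submodule ℂ (X × X) where
  carrier := {p | IsΛ p.1 p.2}
  zero_mem' := by
    intro φ _ _
    simp only [Prod.fst_zero, Prod.snd_zero, integral_smul_zero, integral_stretch_zero,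
      neg_zero, add_zero]
  add_mem' := by
    intro p q hp hq φ h1 h2
    simp only [Prod.fst_add, Prod.snd_add]
    rw [integral_smul_add _ _ _ (integrable_smul _ h1.continuous h2)
      (integrable_smul _ h1.continuous h2), hp φ h1 h2, hq φ h1 h2,
      integral_smul_add _ _ _ (integrable_fderiv_vG _ h1 h2) (integrable_fderiv_vG _ h1 h2),
      integral_stretch_add _ _ h1.continuous h2]
    ring
  smul_mem' := by
    intro c p hp φ h1 h2
    simp only [Prod.smul_fst, Prod.smul_snd]
    rw [integral_smul_smul, integral_smul_smul, hp φ h1 h2, integral_stretch_smul]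
    ring

lemma eq_zero_of_integral (f : X)
    (h : ∀ φ : Plane → ℝ, ContDiff ℝ ∞ φ → HasCompactSupport φ → ∫ x, φ x • f x = 0) :
    f = 0 := by
  have h0 := ae_eq_zero_of_integral_contDiff_smul_eq_zero (integrable_coe f).locallyIntegrable h
  exact (Lp.eq_zero_iff_ae_eq_zero).2 (weight_ac.ae_le h0)

/-- `Lw` is uniquely determined by `w`. -/
lemma graphL_functional (p : X × X) (hp : p ∈ graphL) (h : p.1 = 0) : p.2 = 0 := by
  refine eq_zero_of_integral _ fun φ h1 h2 => ?_
  rw [hp φ h1 h2, h, integral_smul_zero]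

/-- `Λw` is uniquely determined by `w`. -/
lemma graphΛ_functional (p : X × X) (hp : p ∈ graphΛ) (h : p.1 = 0) : p.2 = 0 := by
  refine eq_zero_of_integral _ fun φ h1 h2 => ?_
  rw [hp φ h1 h2, h, integral_smul_zero, integral_stretch_zero]
  simp

/-! ### The operators -/

/-- The operator `L = Δ + (ξ/2)·∇ + 1` in `X`, with domain `{w ∈ X | Lw ∈ X}`. -/
def L : X →ₗ.[ℂ] X := graphL.toLinearPMap

/-- The operator `Λw = v^G·∇w + (K * w)·∇G` in `X`, with domain `{w ∈ X | Λw ∈ X}`. -/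
def Λ : X →ₗ.[ℂ] X := graphΛ.toLinearPMap

lemma L_graph : L.graph = graphL := graphL.toLinearPMap_graph_eq graphL_functional

lemma Λ_graph : Λ.graph = graphΛ := graphΛ.toLinearPMap_graph_eq graphΛ_functional

/-- The kernel of `Λ`, as a subspace of `X`. -/
def kerΛ : Submodule ℂ X := (LinearMap.ker Λ.toFun).map Λ.domain.subtype

section Abstract

variable {E : Type*} [NormedAddCommGroup E] [NormedSpace ℂ E]

/-- The restriction (part) of the operator `T` to the subspace `Y`, viewed as an operator in `Y`:
its domain is `{y ∈ D(T) ∩ Y | T y ∈ Y}`. -/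
def part (T : E →ₗ.[ℂ] E) (Y : Submodule ℂ E) : Y →ₗ.[ℂ] Y :=
  (T.graph.comap (Y.subtype.prodMap Y.subtype)).toLinearPMap

lemma part_graph (T : E →ₗ.[ℂ] E) (Y : Submodule ℂ E) :
    (part T Y).graph = T.graph.comap (Y.subtype.prodMap Y.subtype) := by
  refine Submodule.toLinearPMap_graph_eq _ ?_
  rintro ⟨y, z⟩ hyz hy
  refine Subtype.ext (T.graph_fst_eq_zero_snd (x := (y : E)) (x' := (z : E)) hyz ?_)
  simpa using hy

/-- `R` is the bounded inverse `(T - z)⁻¹`, defined on the whole space. -/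
def IsResolvent (T : E →ₗ.[ℂ] E) (z : ℂ) (R : E →L[ℂ] E) : Prop :=
  (∀ f : E, ∃ h : R f ∈ T.domain, T ⟨R f, h⟩ - z • R f = f) ∧
    ∀ w : T.domain, R (T w - z • (w : E)) = w

/-- The spectrum of an unbounded operator. -/
def spec (T : E →ₗ.[ℂ] E) : Set ℂ := {z | ¬ ∃ R : E →L[ℂ] E, IsResolvent T z R}

/-- The norm `‖(T - z)⁻¹‖`, equal to `∞` when `z` is in the spectrum of `T`
(the infimum is over the at most one bounded inverse of `T - z`). -/
def resolventNorm (T : E →ₗ.[ℂ] E) (z : ℂ) : ℝ≥0∞ :=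
  ⨅ (R : E →L[ℂ] E) (_ : IsResolvent T z R), ‖R‖ₑ

end Abstract

/-- The operator `L_⊥ - αΛ_⊥`, restriction of `L - αΛ` to `ker(Λ)^⊥`. -/
def perpOp (α : ℝ) : kerΛᗮ →ₗ.[ℂ] kerΛᗮ := part (L - (α : ℂ) • Λ) kerΛᗮ

/-- The spectral lower bound `Σ(α) = inf {Re z | z ∈ spec(-L_⊥ + αΛ_⊥)}`, as an extended real. -/
def spectralBound (α : ℝ) : EReal := ⨅ z ∈ spec (-perpOp α), (z.re : EReal)

/-- The pseudospectral bound `Ψ(α) = (sup_{λ ∈ ℝ} ‖(L_⊥ - αΛ_⊥ - iλ)⁻¹‖)⁻¹` in `[0, ∞]`. -/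
def pseudospectralBound (α : ℝ) : ℝ≥0∞ :=
  (⨆ l : ℝ, resolventNorm (perpOp α) (Complex.I * l))⁻¹

end LambOseen

end

/-!
In the Hilbert space `X` the operator `L` is diagonal. With `z = ξ₁ + iξ₂` and `H_{a,b}` the complex
Hermite polynomials, the functions `G H_{a,b}` are orthogonal and complete, and satisfy
`L (G H_{a,b}) = -(a+b)/2 G H_{a,b}`; cutting off shows that the distributional relation `f = Lw`
may be tested against `H_{a,b}`, so that the maximal domain of `L` is the spectral one
(`mem_graphL_iff`).

The operator `Λ` is skew-symmetric and is controlled by the quadratic form of `1 - L`. Since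
`v^G·∇G = 0`, the transport term of `G H` is `G v^G·∇H`, which costs one derivative of the
polynomial factor only; the nonlocal term is bounded by Schur's test, and is an integral operator
with an antisymmetric kernel, because `∇G = -(ξ/2) G`. Hence `‖Λw‖² ≤ C ⟪w, (1 - L)w⟫`
(`norm_sq_sum_lamE_le`, `exists_mem_graphΛ`); in particular `D(L) ⊆ D(Λ)`, and `Re ⟪w, Λw⟫ = 0` on
`D(L)` (`re_inner_of_mem_graphΛ`).

The kernel of `Λ` is spanned by the radial functions and `∂₁G, ∂₂G`, that is, by the `G H_{a,b}`
with `a = b` or `a + b = 1` (`mem_kerΛ_orthogonal_iff`). To see this, decompose `Λu = 0` in polar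
coordinates: the kernel of the nonlocal term acts on the angular mode `k ≥ 1` as a multiple of
`min(r/s, s/r)^k`, and the `k`-th mode `m` of `u` solves
`k Φ(r) m(r) = gR(r)/4 ∫ min(r/s, s/r)^k m(s) s ds`. For `k = 1` this positive kernel has the
positive solution `r gR(r)`, which comes from `∂G`; by the equality case of the triangle inequality
every solution is a multiple of it, and for `k ≥ 2` a comparison with it leaves only `m = 0`.

On `ker(Λ)^⊥` the eigenvalues of `-L` that occur are those with `a + b ≥ 2`, so they are at least
`1`, and `Re ⟪w, (L_⊥ - αΛ_⊥)w⟫ ≤ -‖w‖²` (`re_inner_perpOp_le`). For large real `x` the operator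
`L - αΛ - x` is onto, by a Neumann series, because `‖Λ(L - x)⁻¹‖ = O(x^{-1/2})`
(`perpOp_surjective`). Therefore the half-plane `Re z > -1` lies in the resolvent set, with
`‖(T - z)⁻¹‖ ≤ 1/(1 + Re z)` for `T = L_⊥ - αΛ_⊥`; taking `z = iλ` gives `Ψ(α) ≥ 1`
(`resolventNorm_imaginary_le`). Finally, a spectral point of `T` at distance `d` from the imaginary
axis forces `‖(T - iλ)⁻¹‖ ≥ 1/d` at the same height, whence `Σ(α) ≥ Ψ(α)`
(`inv_iSup_resolventNorm_le`).
-/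

open scoped ComplexConjugate Topology

namespace LambOseen

/-! ### Complex Hermite polynomials -/

/-- The complex coordinate `z = ξ₁ + i ξ₂` on the plane, as a real-linear map. -/
noncomputable def zz : Plane →L[ℝ] ℂ :=
  (Complex.orthonormalBasisOneI.repr.symm.toContinuousLinearEquiv : Plane →L[ℝ] ℂ)

lemma zz_apply (x : Plane) : zz x = x 0 + x 1 * Complex.I := by
  simp [zz, Complex.orthonormalBasisOneI]

lemma norm_zz (x : Plane) : ‖zz x‖ = ‖x‖ :=
  Complex.orthonormalBasisOneI.repr.symm.norm_map x

/-- The conjugate coordinate `ξ₁ - i ξ₂`. -/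
noncomputable def zc : Plane →L[ℝ] ℂ := (Complex.conjCLE : ℂ →L[ℝ] ℂ).comp zz

lemma zc_apply (x : Plane) : zc x = conj (zz x) := rfl

lemma norm_zc (x : Plane) : ‖zc x‖ = ‖x‖ := by simp [zc_apply, norm_zz]

lemma zz_mul_zc (x : Plane) : zz x * zc x = (‖x‖ ^ 2 : ℝ) := by
  rw [zc_apply, Complex.mul_conj, Complex.normSq_eq_norm_sq, norm_zz]

/-- The complex Hermite (Itô) polynomials `H_{a,b}(z, z̄)`, normalised to have leading
monomial `z^a z̄^b`; they are the eigenfunctions of `Δ - (ξ/2)·∇`. -/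
noncomputable def herm : ℕ → ℕ → Plane → ℂ
  | 0, b, x => zc x ^ b
  | a + 1, b, x => zz x * herm a b x - 4 * b * herm a (b - 1) x

lemma herm_zero (b : ℕ) (x : Plane) : herm 0 b x = zc x ^ b := rfl

lemma herm_succ (a b : ℕ) (x : Plane) :
    herm (a + 1) b x = zz x * herm a b x - 4 * b * herm a (b - 1) x := rfl

lemma herm_succ_right (a b : ℕ) (x : Plane) :
    herm a (b + 1) x = zc x * herm a b x - 4 * a * herm (a - 1) b x := by
  induction a generalizing b with
  | zero => simp [herm_zero, pow_succ, mul_comm]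
  | succ a ih =>
    have key : (a : ℂ) * (herm a b x - zz x * herm (a - 1) b x) =
        b * (herm a b x - zc x * herm a (b - 1) x) := by
      rcases a with _ | a
      · rcases b with _ | b
        · simp
        · simp [herm_zero, pow_succ, mul_comm]
      · rcases b with _ | b
        · simp [herm_succ]
        · have h1 := ih b
          simp only [Nat.add_sub_cancel] at h1 ⊢
          have h2 := herm_succ a (b + 1) x
          simp only [Nat.add_sub_cancel] at h2
          push_cast at *
          linear_combination (-(b : ℂ) - 1) * h1 + ((a : ℂ) + 1) * h2
    rw [herm_succ, ih, herm_succ a b]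
    simp only [Nat.add_sub_cancel]
    push_cast
    linear_combination 4 * key

lemma conj_herm (a b : ℕ) (x : Plane) : conj (herm a b x) = herm b a x := by
  induction a generalizing b with
  | zero =>
    induction b with
    | zero => simp [herm_zero]
    | succ b ih =>
      rw [herm_succ, ← ih]
      simp [herm_zero, zc_apply, pow_succ, mul_comm]
  | succ a ih =>
    rw [herm_succ_right, herm_succ]
    have h4 : conj (4 : ℂ) = 4 := Complex.conj_ofNat 4
    simp [ih, zc_apply, h4]

lemma hasFDerivAt_herm (a b : ℕ) (x : Plane) :
    HasFDerivAt (herm a b)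
      (((a : ℂ) * herm (a - 1) b x) • zz + ((b : ℂ) * herm a (b - 1) x) • zc) x := by
  induction a generalizing b with
  | zero =>
    have h := (zc.hasFDerivAt (x := x)).pow b
    refine h.congr_fderiv ?_
    ext v
    simp [herm_zero]
  | succ a ih =>
    have h := ((zz.hasFDerivAt (x := x)).mul (ih b)).sub ((ih (b - 1)).const_mul (4 * (b : ℂ)))
    refine h.congr_fderiv ?_
    ext v
    have e1 : (a : ℂ) * herm a b x =
        a * (zz x * herm (a - 1) b x - 4 * b * herm (a - 1) (b - 1) x) := by
      rcases a with _ | a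
      · simp
      · rw [herm_succ]; simp
    have e2 : (b : ℂ) * herm (a + 1) (b - 1) x =
        b * (zz x * herm a (b - 1) x - 4 * (b - 1 : ℕ) * herm a (b - 1 - 1) x) := by
      rw [herm_succ]
    simp only [sub_apply, add_apply,
      smul_apply, smul_eq_mul, Nat.add_sub_cancel, e2]
    push_cast
    linear_combination (-(zz v)) * e1

lemma contDiff_herm (a b : ℕ) : ContDiff ℝ ∞ (herm a b) := by
  induction a generalizing b with
  | zero =>
    have : herm 0 b = fun x => zc x ^ b := by ext x; rfl
    rw [this]
    exact zc.contDiff.pow b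
  | succ a ih =>
    have : herm (a + 1) b = fun x => zz x * herm a b x - 4 * b * herm a (b - 1) x := by
      ext x; rfl
    rw [this]
    exact (zz.contDiff.mul (ih b)).sub (contDiff_const.mul (ih (b - 1)))

lemma continuous_herm (a b : ℕ) : Continuous (herm a b) := (contDiff_herm a b).continuous

/-- The angular derivative of `H_{a,b}`: it has angular mode `a - b`. -/
lemma zz_herm_sub_zc_herm (a b : ℕ) (x : Plane) :
    zz x * (a * herm (a - 1) b x) - zc x * (b * herm a (b - 1) x) = (a - b) * herm a b x := by
  have h1 : (a : ℂ) * herm a b x =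
      a * (zz x * herm (a - 1) b x - 4 * b * herm (a - 1) (b - 1) x) := by
    rcases a with _ | a
    · simp
    · rw [herm_succ]; simp
  have h2 : (b : ℂ) * herm a b x =
      b * (zc x * herm a (b - 1) x - 4 * a * herm (a - 1) (b - 1) x) := by
    rcases b with _ | b
    · simp
    · rw [herm_succ_right]; simp
  linear_combination h2 - h1

/-- The Euler-type identity behind the eigenvalue equation `(Δ - (ξ/2)·∇) H = -(a+b)/2 H`. -/
lemma zz_herm_add_zc_herm (a b : ℕ) (x : Plane) :
    zz x * (a * herm (a - 1) b x) + zc x * (b * herm a (b - 1) x) =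
      (a + b) * herm a b x + 8 * a * b * herm (a - 1) (b - 1) x := by
  have h1 : (a : ℂ) * herm a b x =
      a * (zz x * herm (a - 1) b x - 4 * b * herm (a - 1) (b - 1) x) := by
    rcases a with _ | a
    · simp
    · rw [herm_succ]; simp
  have h2 : (b : ℂ) * herm a b x =
      b * (zc x * herm a (b - 1) x - 4 * a * herm (a - 1) (b - 1) x) := by
    rcases b with _ | b
    · simp
    · rw [herm_succ_right]; simp
  linear_combination - h2 - h1

/-! ### Multipliers and the scalar product of `X` -/

/-- Functions of at most exponential growth, the class of multipliers that are integrable against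
elements of `X`. -/
def ExpGrowth {F : Type*} [NormedAddCommGroup F] (f : Plane → F) : Prop :=
  ∃ C c : ℝ, 0 ≤ C ∧ 0 ≤ c ∧ ∀ x, ‖f x‖ ≤ C * Real.exp (c * ‖x‖)

lemma ExpGrowth.mono {F F' : Type*} [NormedAddCommGroup F] [NormedAddCommGroup F']
    {f : Plane → F} {g : Plane → F'} (hf : ExpGrowth f) (C : ℝ) (hC : 0 ≤ C)
    (h : ∀ x, ‖g x‖ ≤ C * ‖f x‖) : ExpGrowth g := by
  obtain ⟨A, c, hA, hc, hf⟩ := hf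
  refine ⟨C * A, c, by positivity, hc, fun x => (h x).trans ?_⟩
  rw [mul_assoc]
  exact mul_le_mul_of_nonneg_left (hf x) hC

lemma ExpGrowth.mul {f g : Plane → ℂ} (hf : ExpGrowth f) (hg : ExpGrowth g) :
    ExpGrowth fun x => f x * g x := by
  obtain ⟨A, a, hA, ha, hf⟩ := hf
  obtain ⟨B, b, hB, hb, hg⟩ := hg
  refine ⟨A * B, a + b, by positivity, by positivity, fun x => ?_⟩
  rw [norm_mul, add_mul, Real.exp_add]
  calc ‖f x‖ * ‖g x‖ ≤ (A * Real.exp (a * ‖x‖)) * (B * Real.exp (b * ‖x‖)) := by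
        gcongr; exacts [hf x, hg x]
    _ = _ := by ring

lemma ExpGrowth.add {f g : Plane → ℂ} (hf : ExpGrowth f) (hg : ExpGrowth g) :
    ExpGrowth fun x => f x + g x := by
  obtain ⟨A, a, hA, ha, hf⟩ := hf
  obtain ⟨B, b, hB, hb, hg⟩ := hg
  refine ⟨A + B, a + b, by positivity, by positivity, fun x => ?_⟩
  have h1 : Real.exp (a * ‖x‖) ≤ Real.exp ((a + b) * ‖x‖) := by gcongr; linarith
  have h2 : Real.exp (b * ‖x‖) ≤ Real.exp ((a + b) * ‖x‖) := by gcongr; linarith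
  calc ‖f x + g x‖ ≤ ‖f x‖ + ‖g x‖ := norm_add_le _ _
    _ ≤ A * Real.exp (a * ‖x‖) + B * Real.exp (b * ‖x‖) := add_le_add (hf x) (hg x)
    _ ≤ A * Real.exp ((a + b) * ‖x‖) + B * Real.exp ((a + b) * ‖x‖) := by gcongr
    _ = _ := by ring

lemma expGrowth_const (c : ℂ) : ExpGrowth fun _ : Plane => c :=
  ⟨‖c‖, 0, norm_nonneg _, le_rfl, by simp⟩

lemma ExpGrowth.const_mul {f : Plane → ℂ} (hf : ExpGrowth f) (c : ℂ) :
    ExpGrowth fun x => c * f x := (expGrowth_const c).mul hf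

lemma expGrowth_clm {F : Type*} [NormedAddCommGroup F] [NormedSpace ℝ F] (l : Plane →L[ℝ] F) :
    ExpGrowth l := by
  refine ⟨‖l‖, 1, norm_nonneg _, zero_le_one, fun x => (l.le_opNorm x).trans ?_⟩
  gcongr
  have := Real.add_one_le_exp (1 * ‖x‖)
  linarith

lemma expGrowth_herm (a b : ℕ) : ExpGrowth (herm a b) := by
  induction a generalizing b with
  | zero =>
    induction b with
    | zero => simpa [ExpGrowth, herm_zero] using expGrowth_const 1
    | succ b ih =>
      refine ((expGrowth_clm zc).mul ih).mono 1 zero_le_one fun x => ?_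
      simp [herm_zero, pow_succ, mul_comm]
  | succ a ih =>
    refine (((expGrowth_clm zz).mul (ih b)).add ((ih (b - 1)).const_mul (-(4 * b)))).mono 1
      zero_le_one fun x => le_of_eq ?_
    rw [herm_succ, one_mul]
    congr 1
    ring

lemma integrable_exp_mul_G (c : ℝ) : Integrable (fun x : Plane => Real.exp (c * ‖x‖) * G x) := by
  have h := GaussianFourier.integrable_cexp_neg_mul_sq_norm_add_of_euclideanSpace
    (ι := Fin 2) (b := (1 / 8 : ℂ)) (by norm_num) 0 0
  have h2 := (h.norm).const_mul ((4 * Real.pi)⁻¹ * Real.exp (2 * c ^ 2))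
  refine h2.mono' (by
    have := continuous_G
    exact (by fun_prop : Continuous fun x : Plane => Real.exp (c * ‖x‖) * G x).aestronglyMeasurable)
    (Eventually.of_forall fun x => ?_)
  rw [Complex.norm_exp, Real.norm_of_nonneg (mul_nonneg (Real.exp_pos _).le (G_pos x).le)]
  have : (-(1 / 8 : ℂ) * (‖x‖ : ℂ) ^ 2 + 0 * inner ℝ (0 : Plane) x).re = -‖x‖ ^ 2 / 8 := by
    rw [show (-(1 / 8 : ℂ) * (‖x‖ : ℂ) ^ 2 + 0 * inner ℝ (0 : Plane) x) =
      ((-‖x‖ ^ 2 / 8 : ℝ) : ℂ) by push_cast; ring]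
    exact Complex.ofReal_re _
  rw [this, G, mul_left_comm, ← Real.exp_add, mul_assoc, ← Real.exp_add]
  refine mul_le_mul_of_nonneg_left (Real.exp_le_exp.2 ?_) (by positivity)
  nlinarith [sq_nonneg (‖x‖ - 4 * c)]

lemma ExpGrowth.integrable_mul_G {f : Plane → ℂ} (hf : ExpGrowth f)
    (hm : AEStronglyMeasurable f volume) : Integrable (fun x => f x * G x) := by
  obtain ⟨C, c, hC, hc, h⟩ := hf
  refine ((integrable_exp_mul_G c).const_mul C).mono'
    (hm.mul (Complex.continuous_ofReal.comp continuous_G).aestronglyMeasurable)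
    (Eventually.of_forall fun x => ?_)
  rw [norm_mul, Complex.norm_real, Real.norm_of_nonneg (G_pos x).le, ← mul_assoc]
  exact mul_le_mul_of_nonneg_right (h x) (G_pos x).le

lemma memLp_mul_G {f : Plane → ℂ} (hf : ExpGrowth f)
    (hm : AEStronglyMeasurable f volume) : MemLp (fun x => f x * G x) 2 weight := by
  have hm' : AEStronglyMeasurable (fun x => f x * G x) volume :=
    hm.mul (Complex.continuous_ofReal.comp continuous_G).aestronglyMeasurable
  rw [memLp_two_iff_integrable_sq_norm (hm'.mono_ac weight_ac)]
  have : Integrable (fun x => (f x * G x) * (conj (f x) * G x)) weight := by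
    rw [integrable_weight_iff]
    have h2 : ExpGrowth fun x => f x * conj (f x) :=
      hf.mul (hf.mono 1 zero_le_one fun x => by simp)
    refine (h2.integrable_mul_G
      (hm.mul (Complex.continuous_conj.comp_aestronglyMeasurable hm))).congr
      (Eventually.of_forall fun x => ?_)
    have h2 : (G x : ℂ) ≠ 0 := by exact_mod_cast (G_pos x).ne'
    simp only [Complex.real_smul]
    push_cast
    field_simp
  refine this.norm.congr (Eventually.of_forall fun x => ?_)
  simp
  ring

/-- Elements of `X` are integrable against functions of exponential growth. -/
lemma ExpGrowth.integrable_mul_coe {f : Plane → ℂ} (hf : ExpGrowth f)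
    (hm : AEStronglyMeasurable f volume) (w : X) : Integrable (fun x => f x * w x) := by
  have h : Integrable (fun x => (f x * G x) * w x) weight :=
    memLp_one_iff_integrable.1 ((Lp.memLp w).mul (memLp_mul_G hf hm))
  rw [integrable_weight_iff] at h
  refine h.congr (Eventually.of_forall fun x => ?_)
  have h2 : (G x : ℂ) ≠ 0 := by exact_mod_cast (G_pos x).ne'
  simp only [Complex.real_smul]
  push_cast
  field_simp

/-- The element `f G` of `X`. -/
noncomputable def mulG (f : Plane → ℂ) (hf : ExpGrowth f) (hc : Continuous f) : X :=
  (memLp_mul_G hf hc.aestronglyMeasurable).toLp _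

lemma coeFn_mulG (f : Plane → ℂ) (hf : ExpGrowth f) (hc : Continuous f) :
    (mulG f hf hc : Plane → ℂ) =ᵐ[volume] fun x => f x * G x :=
  volume_ac.ae_eq (MemLp.coeFn_toLp _)

lemma inner_eq_integral (v w : X) :
    ⟪v, w⟫_ℂ = ∫ x, (G x)⁻¹ • (conj (v x) * w x) := by
  rw [L2.inner_def]
  unfold weight
  rw [integral_withDensity_eq_integral_toReal_smul measurable_dens (by simp)]
  refine integral_congr_ae (Eventually.of_forall fun x => ?_)
  simp only
  rw [ENNReal.toReal_ofReal (inv_nonneg.2 (G_pos x).le)]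
  simp [mul_comm]

lemma inner_mulG (f : Plane → ℂ) (hf : ExpGrowth f) (hc : Continuous f) (w : X) :
    ⟪mulG f hf hc, w⟫_ℂ = ∫ x, conj (f x) * w x := by
  rw [inner_eq_integral]
  refine integral_congr_ae ?_
  filter_upwards [coeFn_mulG f hf hc] with x hx
  have h2 : (G x : ℂ) ≠ 0 := by exact_mod_cast (G_pos x).ne'
  rw [hx]
  simp only [Complex.real_smul, map_mul, Complex.conj_ofReal]
  push_cast
  field_simp

/-! ### Orthogonality of the Hermite functions -/

lemma hasFDerivAt_G (x : Plane) : HasFDerivAt G ((-(G x / 2)) • innerSL ℝ x) x := by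
  have h : HasFDerivAt (fun x : Plane => ‖x‖ ^ 2) ((2 : ℝ) • innerSL ℝ x) x := by
    refine (hasStrictFDerivAt_norm_sq x).hasFDerivAt.congr_fderiv ?_
    ext v
    simp
  have h2 := ((h.const_mul (-1 / 4 : ℝ)).exp).const_mul (4 * Real.pi)⁻¹
  refine (h2.congr_of_eventuallyEq (Eventually.of_forall fun y => ?_)).congr_fderiv ?_
  · simp only [G]
    congr 2
    ring
  · ext v
    simp only [G, smul_apply, smul_eq_mul]
    rw [show -1 / 4 * ‖x‖ ^ 2 = -‖x‖ ^ 2 / 4 by ring]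
    ring

lemma integral_G : ∫ x, (G x : ℂ) = 1 := by
  have h := GaussianFourier.integral_rexp_neg_mul_sq_norm (V := Plane) (b := 1 / 4) (by norm_num)
  have h2 : ∫ x, G x = 1 := by
    unfold G
    rw [integral_const_mul]
    rw [show (fun x : Plane => Real.exp (-‖x‖ ^ 2 / 4)) =
      fun x => Real.exp (-(1 / 4) * ‖x‖ ^ 2) by ext x; congr 1; ring, h]
    simp
    field_simp
  rw [integral_complex_ofReal, h2, Complex.ofReal_one]

/-- Integration by parts against the Gaussian in a fixed direction. -/
lemma integral_fderiv_mul_G {f : Plane → ℂ} {f' : Plane → Plane →L[ℝ] ℂ} (v : Plane)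
    (hf : ∀ x, HasFDerivAt f (f' x) x) (hg : ExpGrowth f)
    (hc' : Continuous fun x => f' x v) (hg' : ExpGrowth fun x => f' x v) :
    ∫ x, f' x v * G x = ∫ x, (inner ℝ x v / 2 : ℝ) * f x * G x := by
  have hcf : Continuous f := continuous_iff_continuousAt.2 fun x => (hf x).continuousAt
  have hG : ∀ x, HasFDerivAt (fun x => (G x : ℂ))
      (Complex.ofRealCLM.comp ((-(G x / 2)) • innerSL ℝ x)) x := fun x =>
    Complex.ofRealCLM.hasFDerivAt.comp x (hasFDerivAt_G x)
  have e1 : (fun x => fderiv ℝ f x v * (G x : ℂ)) = fun x => f' x v * G x := by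
    ext x; rw [(hf x).fderiv]
  have e2 : (fun x => f x * fderiv ℝ (fun x => (G x : ℂ)) x v) =
      fun x => -((inner ℝ x v / 2 : ℝ) * f x * G x) := by
    ext x; rw [(hG x).fderiv]
    simp
    ring
  have hin : ExpGrowth fun x : Plane => ((inner ℝ x v / 2 : ℝ) : ℂ) :=
    (expGrowth_clm (innerSL ℝ v)).mono (1 / 2) (by norm_num) fun x => by
      simp [real_inner_comm x v]
      linarith
  have i1 : Integrable fun x => f' x v * (G x : ℂ) := hg'.integrable_mul_G hc'.aestronglyMeasurable
  have i2 : Integrable fun x => ((inner ℝ x v / 2 : ℝ) : ℂ) * f x * (G x : ℂ) :=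
    (hin.mul hg).integrable_mul_G (by fun_prop)
  have := integral_mul_fderiv_eq_neg_fderiv_mul_of_integrable (μ := (volume : Measure Plane))
    (f := f) (g := fun x => (G x : ℂ)) (v := v) (by rw [e1]; exact i1) (by rw [e2]; exact i2.neg)
    (hg.integrable_mul_G hcf.aestronglyMeasurable)
    (fun x _ => (hf x).differentiableAt) (fun x _ => (hG x).differentiableAt)
  rw [e1, e2, integral_neg, neg_inj] at this
  exact this.symm

/-- Adjointness of `z - 4∂_{z̄}` in complex form: `∫ z f G = 4 ∫ (∂f/∂z̄) G`. -/
lemma integral_zz_mul_G {f p q : Plane → ℂ}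
    (hf : ∀ x, HasFDerivAt f (p x • zz + q x • zc) x) (hg : ExpGrowth f)
    (hcp : Continuous p) (hp : ExpGrowth p) (hcq : Continuous q) (hq : ExpGrowth q) :
    ∫ x, zz x * f x * G x = 4 * ∫ x, q x * G x := by
  have hcf : Continuous f := continuous_iff_continuousAt.2 fun x => (hf x).continuousAt
  have key : ∀ v : Plane, ∫ x, (p x * zz v + q x * zc v) * G x =
      ∫ x, (inner ℝ x v / 2 : ℝ) * f x * G x := fun v =>
    integral_fderiv_mul_G v hf hg (by simp; fun_prop) (by
      simpa [mul_comm] using (hp.const_mul (zz v)).add (hq.const_mul (zc v)))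
  have ip : Integrable fun x => p x * (G x : ℂ) := hp.integrable_mul_G hcp.aestronglyMeasurable
  have iq : Integrable fun x => q x * (G x : ℂ) := hq.integrable_mul_G hcq.aestronglyMeasurable
  have key2 : ∀ v : Plane, zz v * (∫ x, p x * G x) + zc v * ∫ x, q x * G x =
      ∫ x, (inner ℝ x v / 2 : ℝ) * f x * G x := fun v => by
    rw [← key, ← integral_const_mul, ← integral_const_mul, ← integral_add (ip.const_mul _)
      (iq.const_mul _)]
    congr 1; ext x; ring
  have hin : ∀ v : Plane, Integrable fun x => ((inner ℝ x v / 2 : ℝ) : ℂ) * f x * (G x : ℂ) := by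
    intro v
    have hin : ExpGrowth fun x : Plane => ((inner ℝ x v / 2 : ℝ) : ℂ) :=
      (expGrowth_clm (innerSL ℝ v)).mono (1 / 2) (by norm_num) fun x => by
        simp [real_inner_comm x v]
        linarith
    exact (hin.mul hg).integrable_mul_G (by fun_prop)
  have h0 := key2 (EuclideanSpace.single 0 1)
  have h1 := key2 (EuclideanSpace.single 1 1)
  have e : ∫ x, zz x * f x * G x =
      2 * (∫ x, (inner ℝ x (EuclideanSpace.single (0 : Fin 2) (1 : ℝ)) / 2 : ℝ) * f x * G x) +
      2 * Complex.I *
        ∫ x, (inner ℝ x (EuclideanSpace.single (1 : Fin 2) (1 : ℝ)) / 2 : ℝ) * f x * G x := by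
    rw [← integral_const_mul, ← integral_const_mul, ← integral_add ((hin _).const_mul _)
      ((hin _).const_mul _)]
    congr 1; ext x
    simp [zz_apply, EuclideanSpace.inner_single_right]
    ring
  rw [e, ← h0, ← h1]
  simp only [zz_apply, zc_apply]
  simp
  linear_combination (2 * (∫ x, p x * G x) - 2 * ∫ x, q x * G x) * Complex.I_sq

lemma hasFDerivAt_herm_mul (a b c d : ℕ) (x : Plane) :
    HasFDerivAt (fun x => herm a b x * herm c d x)
      ((a * herm (a - 1) b x * herm c d x + c * herm a b x * herm (c - 1) d x) • zz +
        (b * herm a (b - 1) x * herm c d x + d * herm a b x * herm c (d - 1) x) • zc) x := by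
  refine ((hasFDerivAt_herm a b x).mul (hasFDerivAt_herm c d x)).congr_fderiv ?_
  ext v
  simp
  ring

lemma integrable_herm_mul (a b c d : ℕ) :
    Integrable fun x => herm a b x * herm c d x * (G x : ℂ) :=
  ((expGrowth_herm a b).mul (expGrowth_herm c d)).integrable_mul_G
    ((continuous_herm a b).mul (continuous_herm c d)).aestronglyMeasurable

/-- Lowering relation: the transpose of `z - 4∂_{z̄}` with respect to `G dξ` is `4∂_{z̄}`. -/
lemma integral_herm_succ_mul (a b c d : ℕ) :
    ∫ x, herm (a + 1) b x * herm c d x * G x =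
      4 * d * ∫ x, herm a b x * herm c (d - 1) x * G x := by
  have gr := fun a b => expGrowth_herm a b
  have co := fun a b => continuous_herm a b
  have h := integral_zz_mul_G (hasFDerivAt_herm_mul a b c d) ((gr a b).mul (gr c d))
    (by fun_prop (disch := assumption))
    ((((gr _ _).const_mul _).mul (gr _ _)).add (((gr _ _).const_mul _).mul (gr _ _)))
    (by fun_prop) ((((gr _ _).const_mul _).mul (gr _ _)).add (((gr _ _).const_mul _).mul (gr _ _)))
  have i1 : Integrable fun x => zz x * (herm a b x * herm c d x) * (G x : ℂ) :=
    ((expGrowth_clm zz).mul ((gr a b).mul (gr c d))).integrable_mul_G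
      (by fun_prop)
  have e1 : ∫ x, herm (a + 1) b x * herm c d x * G x =
      (∫ x, zz x * (herm a b x * herm c d x) * G x) -
        4 * b * ∫ x, herm a (b - 1) x * herm c d x * G x := by
    rw [← integral_const_mul, ← integral_sub i1 ((integrable_herm_mul _ _ _ _).const_mul _)]
    congr 1; ext x
    rw [herm_succ]; ring
  have e2 : ∫ x, (b * herm a (b - 1) x * herm c d x + d * herm a b x * herm c (d - 1) x) * G x =
      b * (∫ x, herm a (b - 1) x * herm c d x * G x) +
        d * ∫ x, herm a b x * herm c (d - 1) x * G x := by
    rw [← integral_const_mul, ← integral_const_mul,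
      ← integral_add ((integrable_herm_mul _ _ _ _).const_mul _)
        ((integrable_herm_mul _ _ _ _).const_mul _)]
    congr 1; ext x; ring
  rw [e1, h, e2]
  ring

lemma conj_integral_herm_mul (a b c d : ℕ) :
    conj (∫ x, herm a b x * herm c d x * G x) = ∫ x, herm b a x * herm d c x * G x := by
  rw [← integral_conj]
  congr 1; ext x
  simp [conj_herm]

lemma integral_herm_succ_right_mul (a b c d : ℕ) :
    ∫ x, herm a (b + 1) x * herm c d x * G x =
      4 * c * ∫ x, herm a b x * herm (c - 1) d x * G x := by
  have h := congrArg conj (integral_herm_succ_mul b a d c)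
  have h4 : conj (4 : ℂ) = 4 := Complex.conj_ofNat 4
  rw [conj_integral_herm_mul, map_mul, conj_integral_herm_mul] at h
  simpa [h4] using h

/-- Orthogonality of the Hermite polynomials, as a bilinear integral: conjugation exchanges the two
indices, see `conj_herm`. -/
lemma integral_herm_mul_herm (a b c d : ℕ) :
    ∫ x, herm a b x * herm c d x * G x =
      if a = d ∧ b = c then (4 : ℂ) ^ (a + b) * a.factorial * b.factorial else 0 := by
  induction a generalizing d with
  | zero =>
    induction b generalizing c with
    | zero =>
      have comm : ∫ x, herm 0 0 x * herm c d x * G x = ∫ x, herm c d x * herm 0 0 x * G x := by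
        congr 1; ext x; ring
      rcases c with _ | c
      · rcases d with _ | d
        · simp [herm_zero, integral_G]
        · rw [comm, integral_herm_succ_right_mul]
          simp
      · rw [comm, integral_herm_succ_mul]
        simp
    | succ b ih =>
      rw [integral_herm_succ_right_mul]
      rcases c with _ | c
      · simp
      · rw [Nat.add_sub_cancel, ih]
        by_cases h : 0 = d ∧ b = c
        · rw [if_pos h, if_pos (by omega), ← h.2, Nat.factorial_succ]
          push_cast; ring
        · rw [if_neg h, if_neg (by omega), mul_zero]
  | succ a ih =>
    rw [integral_herm_succ_mul]
    rcases d with _ | d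
    · simp
    · rw [Nat.add_sub_cancel, ih]
      by_cases h : a = d ∧ b = c
      · rw [if_pos h, if_pos (by omega), ← h.1, Nat.factorial_succ]
        push_cast; ring
      · rw [if_neg h, if_neg (by omega), mul_zero]

/-- The element `G H_{a,b}` of `X`. -/
noncomputable def hermX (i : ℕ × ℕ) : X :=
  mulG (herm i.1 i.2) (expGrowth_herm _ _) (continuous_herm _ _)

lemma inner_hermX (i : ℕ × ℕ) (w : X) : ⟪hermX i, w⟫_ℂ = ∫ x, herm i.2 i.1 x * w x := by
  rw [hermX, inner_mulG]
  simp only [conj_herm]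

/-- The squared norm of `G H_{a,b}`. -/
noncomputable def hermSq (i : ℕ × ℕ) : ℝ := 4 ^ (i.1 + i.2) * i.1.factorial * i.2.factorial

lemma hermSq_pos (i : ℕ × ℕ) : 0 < hermSq i := by unfold hermSq; positivity

lemma inner_hermX_hermX (i j : ℕ × ℕ) :
    ⟪hermX i, hermX j⟫_ℂ = if i = j then (hermSq i : ℂ) else 0 := by
  rw [inner_hermX]
  have h : ∫ x, herm i.2 i.1 x * (hermX j : Plane → ℂ) x =
      ∫ x, herm i.2 i.1 x * herm j.1 j.2 x * G x := by
    refine integral_congr_ae ?_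
    filter_upwards [coeFn_mulG (herm j.1 j.2) (expGrowth_herm _ _) (continuous_herm _ _)] with x hx
    rw [hermX, hx]; ring
  rw [h, integral_herm_mul_herm]
  by_cases hij : i = j
  · subst hij
    simp [hermSq]
    ring
  · rw [if_neg hij, if_neg]
    rintro ⟨h1, h2⟩
    exact hij (Prod.ext h2 h1)

/-- The normalised eigenfunctions `e_{a,b}` of `L`. -/
noncomputable def hermE (i : ℕ × ℕ) : X := (((Real.sqrt (hermSq i))⁻¹ : ℝ) : ℂ) • hermX i

lemma orthonormal_hermE : Orthonormal ℂ hermE := by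
  rw [orthonormal_iff_ite]
  intro i j
  rw [hermE, hermE, inner_smul_left, inner_smul_right, inner_hermX_hermX]
  by_cases h : i = j
  · subst h
    have h2 := Real.mul_self_sqrt (hermSq_pos i).le
    have h3 := (Real.sqrt_pos.2 (hermSq_pos i)).ne'
    simp only [if_true, Complex.conj_ofReal]
    rw [← Complex.ofReal_mul, ← Complex.ofReal_mul]
    norm_cast
    field_simp
    rw [pow_two, h2]
  · simp [h]

/-! ### Completeness of the Hermite functions -/

/-- An integrable function with vanishing Fourier transform vanishes. -/
lemma ae_eq_zero_of_fourier_eq_zero {u : Plane → ℂ} (hu : Integrable u)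
    (h : ∀ k : Plane, ∫ x, Complex.exp (Complex.I * (inner ℝ k x : ℝ)) * u x = 0) :
    u =ᵐ[volume] 0 := by
  refine ae_eq_zero_of_integral_contDiff_smul_eq_zero hu.locallyIntegrable fun φ h1 h2 => ?_
  have h1' : ContDiff ℝ ∞ fun x => (φ x : ℂ) := Complex.ofRealCLM.contDiff.comp h1
  have h2' : HasCompactSupport fun x => (φ x : ℂ) :=
    h2.comp_left (g := fun t : ℝ => (t : ℂ)) Complex.ofReal_zero
  set ψ : SchwartzMap Plane ℂ := h2'.toSchwartzMap h1'
  set η : SchwartzMap Plane ℂ := FourierTransform.fourierInv ψ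
  have hη : FourierTransform.fourier η = ψ := FourierTransform.fourier_fourierInv_eq ψ
  have key := VectorFourier.integral_fourierIntegral_smul_eq_flip (L := innerₗ Plane)
      (μ := volume) (ν := volume) Real.continuous_fourierChar continuous_inner η.integrable hu
  have e1 : ∀ x, VectorFourier.fourierIntegral Real.fourierChar volume (innerₗ Plane).flip u x
      = 0 := by
    intro x
    rw [← h (-(2 * Real.pi) • x)]
    unfold VectorFourier.fourierIntegral
    congr 1; ext y
    rw [Circle.smul_def, Real.fourierChar_apply, smul_eq_mul]
    congr 2
    simp [inner_smul_left, real_inner_comm]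
    ring
  simp only [e1, smul_zero, integral_zero] at key
  rw [← key]
  congr 1; ext x
  have : FourierTransform.fourier η x = ψ x := by rw [hη]
  have e3 : VectorFourier.fourierIntegral Real.fourierChar volume (innerₗ Plane) η x = ψ x := this
  rw [e3]
  simp [ψ]

/-- Multiplication by a linear function maps Hermite polynomials to combinations of Hermite
polynomials, so all moments of `u` vanish. -/
lemma integral_inner_pow_herm_eq_zero {u : X} (h : ∀ i, ⟪hermX i, u⟫_ℂ = 0) (k : Plane)
    (n a b : ℕ) : ∫ x, (inner ℝ k x : ℝ) ^ n * (herm a b x * u x) = 0 := by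
  induction n generalizing a b with
  | zero => simpa [inner_hermX] using h (b, a)
  | succ n ih =>
    have gk : ∀ n : ℕ, ExpGrowth fun x : Plane => (((inner ℝ k x : ℝ) : ℂ)) ^ n := by
      intro n
      induction n with
      | zero => simpa using expGrowth_const 1
      | succ n ih =>
        simp only [pow_succ]
        exact ih.mul ((expGrowth_clm (innerSL ℝ k)).mono 1 zero_le_one fun x => by simp)
    have hi : ∀ c d, Integrable fun x => (((inner ℝ k x : ℝ) : ℂ)) ^ n * (herm c d x * u x) := by
      intro c d
      simp only [← mul_assoc]
      have := continuous_herm c d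
      exact ((gk n).mul (expGrowth_herm c d)).integrable_mul_coe (by fun_prop) u
    have hk : ∀ x : Plane, ((inner ℝ k x : ℝ) : ℂ) = (zc k * zz x + zz k * zc x) / 2 := by
      intro x
      simp only [zc_apply, zz_apply]
      simp [PiLp.inner_apply, Fin.sum_univ_two]
      linear_combination (k 1 * x 1 : ℂ) * Complex.I_sq
    have e : (fun x => (((inner ℝ k x : ℝ) : ℂ)) ^ (n + 1) * (herm a b x * u x)) = fun x =>
        (zc k / 2) * ((((inner ℝ k x : ℝ) : ℂ)) ^ n * (herm (a + 1) b x * u x)) +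
        (zc k / 2 * (4 * b)) * ((((inner ℝ k x : ℝ) : ℂ)) ^ n * (herm a (b - 1) x * u x)) +
        (zz k / 2) * ((((inner ℝ k x : ℝ) : ℂ)) ^ n * (herm a (b + 1) x * u x)) +
        (zz k / 2 * (4 * a)) * ((((inner ℝ k x : ℝ) : ℂ)) ^ n * (herm (a - 1) b x * u x)) := by
      ext x
      rw [pow_succ, herm_succ, herm_succ_right]
      linear_combination ((inner ℝ k x : ℝ) : ℂ) ^ n * herm a b x * u x * hk x
    rw [e, integral_add, integral_add, integral_add]
    · simp only [integral_const_mul, ih, mul_zero, add_zero]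
    all_goals
      first
      | exact (hi _ _).const_mul _
      | exact ((hi _ _).const_mul _).add ((hi _ _).const_mul _)
      | exact (((hi _ _).const_mul _).add ((hi _ _).const_mul _)).add ((hi _ _).const_mul _)

/-- Completeness of the Hermite functions: the Fourier transform of `u` is a convergent power
series whose coefficients are moments of `u`. -/
lemma eq_zero_of_inner_hermX {u : X} (h : ∀ i, ⟪hermX i, u⟫_ℂ = 0) : u = 0 := by
  refine (Lp.eq_zero_iff_ae_eq_zero).2 (weight_ac.ae_le
    (ae_eq_zero_of_fourier_eq_zero (integrable_coe u) fun k => ?_))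
  have hm : AEStronglyMeasurable (u : Plane → ℂ) volume := (integrable_coe u).1
  have hs := hasSum_integral_of_dominated_convergence (μ := (volume : Measure Plane))
    (F := fun (n : ℕ) x => ((n.factorial : ℂ)⁻¹ * Complex.I ^ n) *
      ((((inner ℝ k x : ℝ) : ℂ)) ^ n * (herm 0 0 x * u x)))
    (f := fun x => Complex.exp (Complex.I * (inner ℝ k x : ℝ)) * u x)
    (fun n x => (‖k‖ * ‖x‖) ^ n / n.factorial * ‖u x‖)
    (fun n => by have := continuous_herm 0 0; fun_prop)
    (fun n => Eventually.of_forall fun x => by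
      simp only [herm_zero, pow_zero, one_mul, norm_mul, norm_pow, norm_inv, Complex.norm_I,
        one_pow, mul_one, Complex.norm_natCast, Complex.norm_real, Real.norm_eq_abs]
      rw [← mul_assoc, div_eq_inv_mul]
      gcongr
      exact abs_real_inner_le_norm k x)
    (Eventually.of_forall fun x => (Real.summable_pow_div_factorial _).mul_right _)
    (by
      have e : (fun x : Plane => ∑' n : ℕ, (‖k‖ * ‖x‖) ^ n / n.factorial * ‖u x‖) =
          fun x => Real.exp (‖k‖ * ‖x‖) * ‖u x‖ := by
        ext x
        rw [tsum_mul_right, Real.exp_eq_exp_ℝ, NormedSpace.exp_eq_tsum_div]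
      rw [e]
      have hg : ExpGrowth fun x : Plane => ((Real.exp (‖k‖ * ‖x‖) : ℝ) : ℂ) :=
        ⟨1, ‖k‖, zero_le_one, norm_nonneg _, fun x => by
          rw [Complex.norm_real, Real.norm_of_nonneg (Real.exp_pos _).le, one_mul]⟩
      refine (hg.integrable_mul_coe (by fun_prop) u).norm.congr (Eventually.of_forall fun x => ?_)
      simp only [norm_mul, Complex.norm_real, Real.norm_of_nonneg (Real.exp_pos _).le])
    (Eventually.of_forall fun x => by
      have := (NormedSpace.expSeries_div_hasSum_exp (Complex.I * (inner ℝ k x : ℝ))).mul_right (u x)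
      rw [← Complex.exp_eq_exp_ℂ] at this
      convert! this using 2 with n
      simp [herm_zero, mul_pow]
      ring)
  simp only [integral_const_mul, integral_inner_pow_herm_eq_zero h, mul_zero] at hs
  exact hs.unique hasSum_zero

lemma hermE_orthogonal_eq_bot : (Submodule.span ℂ (Set.range hermE))ᗮ = ⊥ := by
  rw [eq_bot_iff]
  intro u hu
  refine eq_zero_of_inner_hermX fun i => ?_
  have h := (Submodule.mem_orthogonal _ _).1 hu (hermE i) (Submodule.subset_span ⟨i, rfl⟩)
  rw [hermE, inner_smul_left] at h
  have h3 := (Real.sqrt_pos.2 (hermSq_pos i)).ne'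
  simpa [h3] using h

/-- The Hermite functions as a Hilbert basis of `X`. -/
noncomputable def hermBasis : HilbertBasis (ℕ × ℕ) ℂ X :=
  HilbertBasis.mkOfOrthogonalEqBot orthonormal_hermE hermE_orthogonal_eq_bot

lemma hermBasis_apply (i : ℕ × ℕ) : hermBasis i = hermE i := by simp [hermBasis]

/-! ### The eigenvalue equation for `L` -/

/-- The derivative of `f` in the direction `v`. -/
noncomputable def dirD {F : Type*} [NormedAddCommGroup F] [NormedSpace ℝ F] (v : Plane)
    (f : Plane → F) (x : Plane) : F := fderiv ℝ f x v

/-- The standard basis vectors of the plane. -/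
noncomputable def stdE (i : Fin 2) : Plane := EuclideanSpace.single i 1

lemma contDiff_dirD {F : Type*} [NormedAddCommGroup F] [NormedSpace ℝ F] (v : Plane)
    {f : Plane → F} (hf : ContDiff ℝ ∞ f) : ContDiff ℝ ∞ (dirD v f) :=
  (hf.fderiv_right (m := ∞) (by simp)).clm_apply contDiff_const

lemma dirD_mul (v : Plane) {f g : Plane → ℂ} (hf : ContDiff ℝ ∞ f) (hg : ContDiff ℝ ∞ g)
    (x : Plane) : dirD v (fun x => f x * g x) x = f x * dirD v g x + dirD v f x * g x := by
  unfold dirD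
  rw [fderiv_fun_mul (hf.differentiable (by simp) x) (hg.differentiable (by simp) x)]
  simp [mul_comm]

lemma laplacian_eq_sum {F : Type*} [NormedAddCommGroup F] [NormedSpace ℝ F]
    {f : Plane → F} (hf : ContDiff ℝ ∞ f) (x : Plane) :
    Laplacian.laplacian f x = ∑ i, dirD (stdE i) (dirD (stdE i) f) x := by
  rw [laplacian_eq_iteratedFDeriv_orthonormalBasis f (EuclideanSpace.basisFun (Fin 2) ℝ)]
  refine Finset.sum_congr rfl fun i _ => ?_
  rw [iteratedFDeriv_two_apply]
  have h : DifferentiableAt ℝ (fderiv ℝ f) x :=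
    (hf.fderiv_right (m := ∞) (by simp)).differentiable (by simp) x
  unfold dirD
  rw [fderiv_clm_apply h (differentiableAt_const _)]
  simp [stdE]

lemma laplacian_mul {f g : Plane → ℂ} (hf : ContDiff ℝ ∞ f) (hg : ContDiff ℝ ∞ g) (x : Plane) :
    Laplacian.laplacian (fun x => f x * g x) x = f x * Laplacian.laplacian g x +
      2 * ∑ i, dirD (stdE i) f x * dirD (stdE i) g x + Laplacian.laplacian f x * g x := by
  rw [laplacian_eq_sum (hf.mul hg), laplacian_eq_sum hf, laplacian_eq_sum hg, Finset.mul_sum,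
    Finset.mul_sum, Finset.sum_mul, ← Finset.sum_add_distrib, ← Finset.sum_add_distrib]
  refine Finset.sum_congr rfl fun i _ => ?_
  have e : dirD (stdE i) (fun x => f x * g x) =
      fun x => f x * dirD (stdE i) g x + dirD (stdE i) f x * g x :=
    funext fun x => dirD_mul _ hf hg x
  rw [e]
  have d1 := contDiff_dirD (stdE i) hf
  have d2 := contDiff_dirD (stdE i) hg
  have e2 : dirD (stdE i) (fun x => f x * dirD (stdE i) g x + dirD (stdE i) f x * g x) x =
      dirD (stdE i) (fun x => f x * dirD (stdE i) g x) x +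
        dirD (stdE i) (fun x => dirD (stdE i) f x * g x) x := by
    unfold dirD at d1 d2 ⊢
    rw [fderiv_fun_add ((hf.mul d2).differentiable (by simp) x)
      ((d1.mul hg).differentiable (by simp) x)]
    rfl
  rw [e2, dirD_mul _ hf d2, dirD_mul _ d1 hg]
  ring

lemma dirD_herm (v : Plane) (a b : ℕ) : dirD v (herm a b) =
    fun x => zz v * (a * herm (a - 1) b x) + zc v * (b * herm a (b - 1) x) := by
  ext x
  unfold dirD
  rw [(hasFDerivAt_herm a b x).fderiv]
  simp
  ring

lemma dirD_lincomb (v : Plane) (c d : ℂ) {f g : Plane → ℂ} (hf : ContDiff ℝ ∞ f)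
    (hg : ContDiff ℝ ∞ g) (x : Plane) :
    dirD v (fun x => c * f x + d * g x) x = c * dirD v f x + d * dirD v g x := by
  unfold dirD
  have h1 := hf.differentiable (by simp) x
  have h2 := hg.differentiable (by simp) x
  rw [fderiv_fun_add (h1.const_mul _) (h2.const_mul _), fderiv_const_mul h1, fderiv_const_mul h2]
  rfl

lemma laplacian_herm (a b : ℕ) (x : Plane) :
    Laplacian.laplacian (herm a b) x = 4 * a * b * herm (a - 1) (b - 1) x := by
  have e : ∀ v : Plane, dirD v (dirD v (herm a b)) x = zz v * (a * dirD v (herm (a - 1) b) x) +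
      zc v * (b * dirD v (herm a (b - 1)) x) := by
    intro v
    rw [dirD_herm v a b]
    have := dirD_lincomb v (zz v * a) (zc v * b) (contDiff_herm (a - 1) b)
      (contDiff_herm a (b - 1)) x
    simp only [mul_assoc] at this ⊢
    exact this
  rw [laplacian_eq_sum (contDiff_herm a b), Fin.sum_univ_two, e, e]
  simp only [dirD_herm, zz_apply, zc_apply, stdE]
  simp
  linear_combination (a * (((a - 1 : ℕ) : ℂ) * herm (a - 1 - 1) b x) +
    b * (((b - 1 : ℕ) : ℂ) * herm a (b - 1 - 1) x) -
    2 * a * b * herm (a - 1) (b - 1) x) * Complex.I_sq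

lemma fderiv_herm_self (a b : ℕ) (x : Plane) :
    fderiv ℝ (herm a b) x x = (a + b) * herm a b x + 8 * a * b * herm (a - 1) (b - 1) x := by
  have := congrFun (dirD_herm x a b) x
  unfold dirD at this
  rw [this, zz_herm_add_zc_herm]

/-- The eigenvalue equation for the Hermite polynomials. -/
lemma adjL_herm (a b : ℕ) (x : Plane) :
    Laplacian.laplacian (herm a b) x - (1 / 2) * fderiv ℝ (herm a b) x x =
      -((a + b) / 2) * herm a b x := by
  rw [laplacian_herm, fderiv_herm_self]
  ring

lemma ExpGrowth.of_hasCompactSupport {f : Plane → ℂ} (hc : Continuous f)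
    (hs : HasCompactSupport f) : ExpGrowth f := by
  obtain ⟨C, hC⟩ := hs.exists_bound_of_continuous hc
  exact ⟨C, 0, (norm_nonneg _).trans (hC 0), le_rfl, by simpa using hC⟩

lemma hasCompactSupport_dirD {F : Type*} [NormedAddCommGroup F] [NormedSpace ℝ F] (v : Plane)
    {f : Plane → F} (hs : HasCompactSupport f) : HasCompactSupport (dirD v f) := by
  refine (hs.fderiv (𝕜 := ℝ)).mono fun x hx => ?_
  contrapose! hx
  simp at hx
  simp [dirD, hx]

lemma expGrowth_dirD_herm (v : Plane) (a b : ℕ) : ExpGrowth (dirD v (herm a b)) := by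
  rw [dirD_herm]
  exact (((expGrowth_herm _ _).const_mul _).const_mul _).add
    (((expGrowth_herm _ _).const_mul _).const_mul _)

/-- Symmetry of `Δ - (ξ/2)·∇` with respect to `G dξ`, tested on an eigenfunction. -/
lemma integral_adjL_symm {φ : Plane → ℂ} (hφ : ContDiff ℝ ∞ φ) (hs : HasCompactSupport φ)
    (a b : ℕ) :
    ∫ x, (Laplacian.laplacian φ x - (1 / 2) * fderiv ℝ φ x x) * herm a b x * G x =
      ∫ x, φ x * (-((a + b) / 2) * herm a b x) * G x := by
  set p := herm a b with hp
  have cp : ContDiff ℝ ∞ p := contDiff_herm a b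
  -- Green's identity: both sides differ by the divergence of `G (φ ∇p - p ∇φ)`.
  have key : ∀ i, ∫ x, (φ x * dirD (stdE i) (dirD (stdE i) p) x -
      dirD (stdE i) (dirD (stdE i) φ) x * p x) * G x =
      ∫ x, (x i / 2 : ℝ) * (φ x * dirD (stdE i) p x - dirD (stdE i) φ x * p x) * G x := by
    intro i
    have c1 := contDiff_dirD (stdE i) cp
    have c2 := contDiff_dirD (stdE i) hφ
    have c3 := contDiff_dirD (stdE i) c1
    have c4 := contDiff_dirD (stdE i) c2
    have cf : ContDiff ℝ ∞ fun x => φ x * dirD (stdE i) p x - dirD (stdE i) φ x * p x :=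
      (hφ.mul c1).sub (c2.mul cp)
    have sf : HasCompactSupport fun x => φ x * dirD (stdE i) p x - dirD (stdE i) φ x * p x :=
      (hs.mul_right).sub ((hasCompactSupport_dirD _ hs).mul_right)
    have := integral_fderiv_mul_G (stdE i)
      (fun x => (cf.differentiable (by simp) x).hasFDerivAt)
      (ExpGrowth.of_hasCompactSupport cf.continuous sf)
      (contDiff_dirD (stdE i) cf).continuous
      (ExpGrowth.of_hasCompactSupport (contDiff_dirD (stdE i) cf).continuous
        (hasCompactSupport_dirD (stdE i) sf))
    have e : ∀ x, fderiv ℝ (fun x => φ x * dirD (stdE i) p x - dirD (stdE i) φ x * p x) x (stdE i)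
        = φ x * dirD (stdE i) (dirD (stdE i) p) x - dirD (stdE i) (dirD (stdE i) φ) x * p x := by
      intro x
      rw [fderiv_fun_sub ((hφ.mul c1).differentiable (by simp) x)
        ((c2.mul cp).differentiable (by simp) x)]
      have h1 := dirD_mul (stdE i) hφ c1 x
      have h2 := dirD_mul (stdE i) c2 cp x
      unfold dirD at h1 h2 ⊢
      rw [sub_apply, h1, h2]
      ring
    simp only [e] at this
    rw [this]
    congr 1; ext x
    simp [stdE, EuclideanSpace.inner_single_right]
  have int : ∀ i, Integrable fun x => (φ x * dirD (stdE i) (dirD (stdE i) p) x -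
      dirD (stdE i) (dirD (stdE i) φ) x * p x) * (G x : ℂ) := by
    intro i
    have c3 := contDiff_dirD (stdE i) (contDiff_dirD (stdE i) cp)
    have c4 := contDiff_dirD (stdE i) (contDiff_dirD (stdE i) hφ)
    have cf := ((hφ.mul c3).sub (c4.mul cp)).continuous
    exact (ExpGrowth.of_hasCompactSupport cf (hs.mul_right.sub
      ((hasCompactSupport_dirD _ (hasCompactSupport_dirD _ hs)).mul_right))).integrable_mul_G
      cf.aestronglyMeasurable
  have int2 : ∀ i, Integrable fun x => (x i / 2 : ℝ) *
      (φ x * dirD (stdE i) p x - dirD (stdE i) φ x * p x) * (G x : ℂ) := by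
    intro i
    have c1 := contDiff_dirD (stdE i) cp
    have c2 := contDiff_dirD (stdE i) hφ
    have cf : Continuous fun x => ((x i / 2 : ℝ) : ℂ) *
        (φ x * dirD (stdE i) p x - dirD (stdE i) φ x * p x) :=
      (by fun_prop : Continuous fun x : Plane => ((x i / 2 : ℝ) : ℂ)).mul
        ((hφ.mul c1).sub (c2.mul cp)).continuous
    exact (ExpGrowth.of_hasCompactSupport cf (((hs.mul_right).sub
      ((hasCompactSupport_dirD _ hs).mul_right)).mul_left)).integrable_mul_G
      cf.aestronglyMeasurable
  have sum := congrArg₂ (· + ·) (key 0) (key 1)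
  simp only at sum
  rw [← integral_add (int 0) (int 1), ← integral_add (int2 0) (int2 1)] at sum
  -- what remains is the integrability needed to split the integrals
  have cL : Continuous fun x => (Laplacian.laplacian φ x - (1 / 2) * fderiv ℝ φ x x) := by
    have h1 : Continuous (Laplacian.laplacian φ) := by
      rw [show Laplacian.laplacian φ = fun x => ∑ i, dirD (stdE i) (dirD (stdE i) φ) x from
        funext (laplacian_eq_sum hφ)]
      exact continuous_finsetSum _ fun i _ =>
        (contDiff_dirD (stdE i) (contDiff_dirD (stdE i) hφ)).continuous
    have h2 : Continuous (fderiv ℝ φ) := hφ.continuous_fderiv (by simp)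
    fun_prop
  have sL : HasCompactSupport fun x =>
      (Laplacian.laplacian φ x - (1 / 2) * fderiv ℝ φ x x) := by
    have h1 : HasCompactSupport (Laplacian.laplacian φ) := by
      rw [show Laplacian.laplacian φ = fun x => ∑ i, dirD (stdE i) (dirD (stdE i) φ) x from
        funext (laplacian_eq_sum hφ)]
      simp only [Fin.sum_univ_two]
      exact (hasCompactSupport_dirD _ (hasCompactSupport_dirD _ hs)).add
        (hasCompactSupport_dirD _ (hasCompactSupport_dirD _ hs))
    have h2 : HasCompactSupport fun x => fderiv ℝ φ x x := by
      refine (hs.fderiv (𝕜 := ℝ)).mono fun x hx => ?_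
      contrapose! hx
      simp at hx
      simp [hx]
    exact h1.sub h2.mul_left
  have i1 : Integrable fun x =>
      (Laplacian.laplacian φ x - (1 / 2) * fderiv ℝ φ x x) * p x * (G x : ℂ) :=
    (ExpGrowth.of_hasCompactSupport (cL.mul cp.continuous) sL.mul_right).integrable_mul_G
      (cL.mul cp.continuous).aestronglyMeasurable
  have i2 : Integrable fun x => φ x * (-((a + b) / 2) * p x) * (G x : ℂ) :=
    (ExpGrowth.of_hasCompactSupport (hφ.continuous.mul (continuous_const.mul cp.continuous))
      hs.mul_right).integrable_mul_G
      (hφ.continuous.mul (continuous_const.mul cp.continuous)).aestronglyMeasurable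
  have hx : ∀ (f : Plane → ℂ) (x : Plane),
      fderiv ℝ f x x = x 0 * dirD (stdE 0) f x + x 1 * dirD (stdE 1) f x := by
    intro f x
    have : x = x 0 • stdE 0 + x 1 • stdE 1 := by
      ext i; fin_cases i <;> simp [stdE]
    conv_lhs => rw [show fderiv ℝ f x x = fderiv ℝ f x (x 0 • stdE 0 + x 1 • stdE 1) by
      rw [← this]]
    simp [dirD]
  rw [← sub_eq_zero, ← integral_sub i1 i2, ← neg_eq_zero, ← sub_eq_zero.2 sum, ← integral_neg]
  refine Eq.trans ?_ (integral_sub ((int 0).add (int 1)) ((int2 0).add (int2 1)))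
  congr 1; ext x
  have := adjL_herm a b x
  rw [← hp, laplacian_eq_sum cp, hx, Fin.sum_univ_two] at this
  rw [← this, laplacian_eq_sum hφ, hx φ, Fin.sum_univ_two]
  push_cast
  ring

lemma hermX_mem_graphL (i : ℕ × ℕ) :
    (hermX i, (-((i.1 + i.2) / 2) : ℂ) • hermX i) ∈ graphL := by
  intro φ h1 h2
  have h1' : ContDiff ℝ ∞ fun x => (φ x : ℂ) := Complex.ofRealCLM.contDiff.comp h1
  have h2' : HasCompactSupport fun x => (φ x : ℂ) :=
    h2.comp_left (g := fun t : ℝ => (t : ℂ)) Complex.ofReal_zero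
  have key := integral_adjL_symm h1' h2' i.1 i.2
  have ae := coeFn_mulG (herm i.1 i.2) (expGrowth_herm _ _) (continuous_herm _ _)
  have e1 : ∫ x, φ x • ((-((i.1 + i.2) / 2) : ℂ) • hermX i : X) x =
      ∫ x, (φ x : ℂ) * (-((i.1 + i.2) / 2) * herm i.1 i.2 x) * G x := by
    refine integral_congr_ae ?_
    filter_upwards [ae, smul_ae (-((i.1 + i.2) / 2) : ℂ) (hermX i)] with x hx hx2
    rw [hx2, hermX, hx, Complex.real_smul]
    ring
  have e2 : ∫ x, (Laplacian.laplacian φ x - (1 / 2) * fderiv ℝ φ x x) • (hermX i : Plane → ℂ) x =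
      ∫ x, (Laplacian.laplacian (fun x => (φ x : ℂ)) x -
        (1 / 2) * fderiv ℝ (fun x => (φ x : ℂ)) x x) * herm i.1 i.2 x * G x := by
    refine integral_congr_ae ?_
    filter_upwards [ae] with x hx
    have l1 : Laplacian.laplacian (fun x => (φ x : ℂ)) x = Laplacian.laplacian φ x :=
      (h1.contDiffAt.of_le (by norm_cast) :
        ContDiffAt ℝ 2 φ x).laplacian_CLM_comp_left (l := Complex.ofRealCLM)
    have l2 : fderiv ℝ (fun x => (φ x : ℂ)) x x = fderiv ℝ φ x x := by
      have := (Complex.ofRealCLM.hasFDerivAt.comp x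
        ((h1.differentiable (by simp) x).hasFDerivAt)).fderiv
      change fderiv ℝ (Complex.ofRealCLM ∘ φ) x x = _
      rw [this]; rfl
    rw [hermX, hx, l1, l2, Complex.real_smul]
    push_cast
    ring
  exact e1.trans (key.symm.trans e2.symm)

/-- The relation defining `L` extends to complex test functions. -/
lemma IsL.complex {w f : X} (h : IsL w f) {φ : Plane → ℂ} (h1 : ContDiff ℝ ∞ φ)
    (h2 : HasCompactSupport φ) :
    ∫ x, φ x * f x = ∫ x, (Laplacian.laplacian φ x - (1 / 2) * fderiv ℝ φ x x) * w x := by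
  have hl : ∀ (l : ℂ →L[ℝ] ℝ) , ContDiff ℝ ∞ (fun x => l (φ x)) ∧
      HasCompactSupport (fun x => l (φ x)) ∧
      (∀ x, Laplacian.laplacian (fun x => l (φ x)) x = l (Laplacian.laplacian φ x)) ∧
      ∀ x, fderiv ℝ (fun x => l (φ x)) x x = l (fderiv ℝ φ x x) := by
    intro l
    refine ⟨l.contDiff.comp h1, h2.comp_left (g := l) (map_zero l), fun x =>
      (h1.contDiffAt.of_le (by norm_cast) :
        ContDiffAt ℝ 2 φ x).laplacian_CLM_comp_left (l := l), fun x => ?_⟩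
    have := (l.hasFDerivAt.comp x ((h1.differentiable (by simp) x).hasFDerivAt)).fderiv
    change fderiv ℝ (l ∘ φ) x x = _
    rw [this]; rfl
  obtain ⟨r1, r2, r3, r4⟩ := hl Complex.reCLM
  obtain ⟨i1, i2, i3, i4⟩ := hl Complex.imCLM
  have hr := h _ r1 r2
  have hi := h _ i1 i2
  have e1 : ∫ x, φ x * f x = (∫ x, Complex.reCLM (φ x) • f x) +
      Complex.I * ∫ x, Complex.imCLM (φ x) • f x := by
    rw [← integral_const_mul, ← integral_add (integrable_smul f r1.continuous r2)
      ((integrable_smul f i1.continuous i2).const_mul _)]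
    congr 1; ext x
    conv_lhs => rw [← Complex.re_add_im (φ x)]
    simp only [Complex.real_smul, Complex.reCLM_apply, Complex.imCLM_apply]
    ring
  rw [e1, hr, hi, ← integral_const_mul, ← integral_add (integrable_adjL w r1 r2)
      ((integrable_adjL w i1 i2).const_mul _)]
  congr 1; ext x
  rw [r3, r4, i3, i4]
  conv_rhs => rw [← Complex.re_add_im (Laplacian.laplacian φ x),
    ← Complex.re_add_im (fderiv ℝ φ x x)]
  simp only [Complex.real_smul, Complex.reCLM_apply, Complex.imCLM_apply]
  push_cast
  ring

/-! ### The maximal domain of `L` -/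

/-- A smooth cutoff function, equal to `1` near the origin. -/
noncomputable def cutoff : Plane → ℂ := fun x => ((⟨1, 2, one_pos, one_lt_two⟩ :
  ContDiffBump (0 : Plane)) x : ℝ)

lemma contDiff_cutoff : ContDiff ℝ ∞ cutoff :=
  Complex.ofRealCLM.contDiff.comp (ContDiffBump.contDiff _)

lemma hasCompactSupport_cutoff : HasCompactSupport cutoff :=
  (ContDiffBump.hasCompactSupport _).comp_left (g := fun t : ℝ => (t : ℂ)) Complex.ofReal_zero

lemma cutoff_zero : cutoff 0 = 1 := by
  unfold cutoff
  rw [ContDiffBump.one_of_mem_closedBall]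
  · simp
  · simp

lemma dirD_comp_smul {f : Plane → ℂ} (hf : ContDiff ℝ ∞ f) (c : ℝ) (v x : Plane) :
    dirD v (fun x => f (c • x)) x = c * dirD v f (c • x) := by
  unfold dirD
  have h : HasFDerivAt (fun x : Plane => c • x) (c • ContinuousLinearMap.id ℝ Plane) x :=
    (ContinuousLinearMap.id ℝ Plane).hasFDerivAt.const_smul c
  have := ((hf.differentiable (by simp) (c • x)).hasFDerivAt.comp x h).fderiv
  change fderiv ℝ (f ∘ fun x => c • x) x v = _
  rw [this]
  simp

/-- The distributional relation `f = Lw` can be tested against Hermite polynomials. -/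
lemma inner_hermX_of_mem_graphL {w f : X} (h : (w, f) ∈ graphL) (i : ℕ × ℕ) :
    ⟪hermX i, f⟫_ℂ = -((i.1 + i.2) / 2) * ⟪hermX i, w⟫_ℂ := by
  obtain ⟨b, a⟩ := i
  rw [inner_hermX, inner_hermX]
  simp only
  set p := herm a b with hp
  have cp : ContDiff ℝ ∞ p := contDiff_herm a b
  have gp : ExpGrowth p := expGrowth_herm a b
  have bd : ∀ f : Plane → ℂ, Continuous f → HasCompactSupport f → ∃ C, ∀ x, ‖f x‖ ≤ C :=
    fun f h1 h2 => h2.exists_bound_of_continuous h1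
  have c0 := contDiff_cutoff
  have s0 := hasCompactSupport_cutoff
  obtain ⟨C0, h0⟩ := bd _ c0.continuous s0
  have cd := fun i => contDiff_dirD (stdE i) c0
  have sd := fun i => hasCompactSupport_dirD (stdE i) s0
  choose C1 h1 using fun i => bd _ (cd i).continuous (sd i)
  choose C2 h2 using fun i => bd _ (contDiff_dirD (stdE i) (cd i)).continuous
    (hasCompactSupport_dirD (stdE i) (sd i))
  have p0 : 0 ≤ C0 := (norm_nonneg _).trans (h0 0)
  have p1 : ∀ i, 0 ≤ C1 i := fun i => (norm_nonneg _).trans (h1 i 0)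
  have p2 : ∀ i, 0 ≤ C2 i := fun i => (norm_nonneg _).trans (h2 i 0)
  -- test with `χₙ H_{a,b}`, where the cutoff `χₙ` lives on the scale `n`
  set ε : ℕ → ℝ := fun n => 1 / ((n : ℝ) + 1) with hε
  have εpos : ∀ n, 0 < ε n := fun n => by simp only [hε]; positivity
  have εle : ∀ n, ε n ≤ 1 := fun n => by
    simp only [hε]
    rw [div_le_one (by positivity)]
    have : (0 : ℝ) ≤ n := n.cast_nonneg
    linarith
  have εlim : Tendsto ε atTop (𝓝 0) := tendsto_one_div_add_atTop_nhds_zero_nat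
  set χ : ℕ → Plane → ℂ := fun n x => cutoff (ε n • x) with hχ
  have cχ : ∀ n, ContDiff ℝ ∞ (χ n) := fun n => c0.comp (contDiff_const_smul (ε n))
  have sχ : ∀ n, HasCompactSupport (χ n) := fun n =>
    s0.comp_homeomorph (Homeomorph.smulOfNeZero (ε n) (εpos n).ne')
  have dχ : ∀ n v x, dirD v (χ n) x = ε n * dirD v cutoff (ε n • x) := fun n v x =>
    dirD_comp_smul c0 _ v x
  have ddχ : ∀ n i x, dirD (stdE i) (dirD (stdE i) (χ n)) x =
      ε n * (ε n * dirD (stdE i) (dirD (stdE i) cutoff) (ε n • x)) := by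
    intro n i x
    rw [show dirD (stdE i) (χ n) = fun x => ε n * dirD (stdE i) cutoff (ε n • x) from
      funext fun x => dχ n _ x]
    have c := (cd i).comp (contDiff_const_smul (ε n) : ContDiff ℝ ∞ fun x : Plane => ε n • x)
    have := dirD_lincomb (stdE i) (ε n) 0 c c x
    simp only [zero_mul, add_zero] at this
    refine this.trans ?_
    congr 1
    exact dirD_comp_smul (cd i) _ _ _
  have hx : ∀ (f : Plane → ℂ) (x : Plane),
      fderiv ℝ f x x = x 0 * dirD (stdE 0) f x + x 1 * dirD (stdE 1) f x := by
    intro f x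
    have : x = x 0 • stdE 0 + x 1 • stdE 1 := by
      ext i; fin_cases i <;> simp [stdE]
    conv_lhs => rw [show fderiv ℝ f x x = fderiv ℝ f x (x 0 • stdE 0 + x 1 • stdE 1) by
      rw [← this]]
    simp [dirD]
  -- the terms in which a derivative falls on the cutoff
  set r : ℕ → Plane → ℂ := fun n x => 2 * ∑ i, dirD (stdE i) (χ n) x * dirD (stdE i) p x +
    (Laplacian.laplacian (χ n) x - (1 / 2) * fderiv ℝ (χ n) x x) * p x with hr
  have test : ∀ n, ∫ x, χ n x * p x * f x =
      ∫ x, (χ n x * (-((a + b) / 2) * p x) + r n x) * w x := by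
    intro n
    rw [IsL.complex h ((cχ n).mul cp) (sχ n).mul_right]
    congr 1; ext x
    rw [laplacian_mul (cχ n) cp, ← adjL_herm a b x]
    have := dirD_mul x (cχ n) cp x
    unfold dirD at this
    rw [this]
    simp only [hr, dirD]
    ring
  -- these terms are at most `ε n * B`, with `B` of exponential growth
  set B : Plane → ℝ := fun x => 2 * (C1 0 * ‖dirD (stdE 0) p x‖ + C1 1 * ‖dirD (stdE 1) p x‖) +
    (C2 0 + C2 1 + (C1 0 + C1 1) * ‖x‖) * ‖p x‖ with hB
  have rbound : ∀ n x, ‖r n x‖ ≤ ε n * B x := by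
    intro n x
    have q1 : ∀ i, ‖dirD (stdE i) (χ n) x‖ ≤ ε n * C1 i := by
      intro i
      rw [dχ, norm_mul, Complex.norm_real, Real.norm_of_nonneg (εpos n).le]
      exact mul_le_mul_of_nonneg_left (h1 i _) (εpos n).le
    have q2 : ∀ i, ‖dirD (stdE i) (dirD (stdE i) (χ n)) x‖ ≤ ε n * C2 i := by
      intro i
      rw [ddχ, norm_mul, norm_mul, Complex.norm_real, Real.norm_of_nonneg (εpos n).le]
      refine mul_le_mul_of_nonneg_left ?_ (εpos n).le
      calc ε n * _ ≤ 1 * C2 i := mul_le_mul (εle n) (h2 i _) (norm_nonneg _) zero_le_one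
        _ = C2 i := one_mul _
    have q3 : ∀ i, ‖(x i : ℂ)‖ ≤ ‖x‖ := fun i => by
      rw [Complex.norm_real]; exact PiLp.norm_apply_le x i
    have q4 : ‖fderiv ℝ (χ n) x x‖ ≤ ε n * ((C1 0 + C1 1) * ‖x‖) := by
      rw [hx]
      refine (norm_add_le _ _).trans ?_
      rw [norm_mul, norm_mul]
      have a1 := mul_le_mul (q3 0) (q1 0) (norm_nonneg _) (norm_nonneg x)
      have a2 := mul_le_mul (q3 1) (q1 1) (norm_nonneg _) (norm_nonneg x)
      linarith
    have q5 : ‖Laplacian.laplacian (χ n) x‖ ≤ ε n * (C2 0 + C2 1) := by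
      rw [laplacian_eq_sum (cχ n), Fin.sum_univ_two]
      refine (norm_add_le _ _).trans ?_
      linarith [q2 0, q2 1]
    have q6 : ‖Laplacian.laplacian (χ n) x - (1 / 2) * fderiv ℝ (χ n) x x‖ ≤
        ε n * (C2 0 + C2 1 + (C1 0 + C1 1) * ‖x‖) := by
      refine (norm_sub_le _ _).trans ?_
      rw [norm_mul]
      have : ‖(1 / 2 : ℂ)‖ ≤ 1 := by norm_num
      have := mul_le_of_le_one_left (norm_nonneg (fderiv ℝ (χ n) x x)) this
      linarith
    simp only [hr, Fin.sum_univ_two]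
    refine (norm_add_le _ _).trans ?_
    rw [norm_mul, norm_mul]
    have a3 : ‖dirD (stdE 0) (χ n) x * dirD (stdE 0) p x +
        dirD (stdE 1) (χ n) x * dirD (stdE 1) p x‖ ≤
        ε n * (C1 0 * ‖dirD (stdE 0) p x‖ + C1 1 * ‖dirD (stdE 1) p x‖) := by
      refine (norm_add_le _ _).trans ?_
      rw [norm_mul, norm_mul]
      have a1 := mul_le_mul_of_nonneg_right (q1 0) (norm_nonneg (dirD (stdE 0) p x))
      have a2 := mul_le_mul_of_nonneg_right (q1 1) (norm_nonneg (dirD (stdE 1) p x))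
      linarith
    have a4 := mul_le_mul_of_nonneg_right q6 (norm_nonneg (p x))
    have : ‖(2 : ℂ)‖ = 2 := by norm_num
    rw [this]
    simp only [hB]
    linarith
  have gB : ExpGrowth fun x => (B x : ℂ) := by
    have g1 : ∀ i, ExpGrowth fun x => (‖dirD (stdE i) p x‖ : ℂ) := fun i =>
      (expGrowth_dirD_herm (stdE i) a b).mono 1 zero_le_one (by simp [hp])
    have g2 : ExpGrowth fun x => (‖p x‖ : ℂ) := gp.mono 1 zero_le_one (by simp)
    have g3 : ExpGrowth fun x : Plane => (‖x‖ : ℂ) :=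
      (expGrowth_clm zz).mono 1 zero_le_one (by simp [norm_zz])
    simp only [hB]
    push_cast
    exact ((((g1 0).const_mul _).add ((g1 1).const_mul _)).const_mul _).add
      (((expGrowth_const _).add (g3.const_mul _)).mul g2)
  have cB : Continuous fun x => (B x : ℂ) := by
    have k1 := fun i => (contDiff_dirD (stdE i) cp).continuous
    have k2 := cp.continuous
    simp only [hB]
    have k10 := k1 0
    have k11 := k1 1
    fun_prop
  have Bw : Integrable fun x => B x * ‖w x‖ := by
    refine (gB.integrable_mul_coe cB.aestronglyMeasurable w).norm.congr
      (Eventually.of_forall fun x => ?_)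
    have : 0 ≤ B x := by
      have := (norm_nonneg _).trans (rbound 0 x)
      exact nonneg_of_mul_nonneg_right this (εpos 0)
    simp [abs_of_nonneg this]
  have pw : ∀ v : X, Integrable fun x => p x * v x := fun v =>
    gp.integrable_mul_coe cp.continuous.aestronglyMeasurable v
  have mr : ∀ n, Continuous (r n) := by
    intro n
    have k1 := fun i => (contDiff_dirD (stdE i) cp).continuous
    have k2 := fun i => (contDiff_dirD (stdE i) (cχ n)).continuous
    have k3 := fun i => (contDiff_dirD (stdE i) (contDiff_dirD (stdE i) (cχ n))).continuous
    have k4 : Continuous (Laplacian.laplacian (χ n)) := by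
      rw [show Laplacian.laplacian (χ n) = fun x => ∑ i, dirD (stdE i) (dirD (stdE i) (χ n)) x from
        funext (laplacian_eq_sum (cχ n))]
      exact continuous_finsetSum _ fun i _ => k3 i
    have k5 : Continuous (fderiv ℝ (χ n)) := (cχ n).continuous_fderiv (by simp)
    have k6 := cp.continuous
    have k7 : Continuous fun x => ∑ i, dirD (stdE i) (χ n) x * dirD (stdE i) p x :=
      continuous_finsetSum _ fun i _ => (k2 i).mul (k1 i)
    simp only [hr]
    fun_prop
  have χlim : ∀ x, Tendsto (fun n => χ n x) atTop (𝓝 1) := by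
    intro x
    have : Tendsto (fun n => ε n • x) atTop (𝓝 ((0 : ℝ) • x)) := εlim.smul_const x
    rw [zero_smul] at this
    have := (c0.continuous.tendsto 0).comp this
    rwa [cutoff_zero] at this
  have lim1 : Tendsto (fun n => ∫ x, χ n x * p x * f x) atTop (𝓝 (∫ x, p x * f x)) := by
    refine tendsto_integral_of_dominated_convergence (fun x => C0 * ‖p x * f x‖)
      (fun n => ?_) ((pw f).norm.const_mul _) (fun n => Eventually.of_forall fun x => ?_)
      (Eventually.of_forall fun x => ?_)
    · exact ((cχ n).continuous.mul cp.continuous).aestronglyMeasurable.mul (integrable_coe f).1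
    · rw [mul_assoc, norm_mul]
      exact mul_le_mul_of_nonneg_right (h0 _) (norm_nonneg _)
    · simpa using ((χlim x).mul_const (p x)).mul_const (f x)
  have lim2 : Tendsto (fun n => ∫ x, (χ n x * (-((a + b) / 2) * p x) + r n x) * w x) atTop
      (𝓝 (∫ x, -((a + b) / 2) * (p x * w x))) := by
    refine tendsto_integral_of_dominated_convergence
      (fun x => C0 * ‖(-((a + b) / 2) : ℂ)‖ * ‖p x * w x‖ + B x * ‖w x‖)
      (fun n => ?_) (((pw w).norm.const_mul _).add Bw)
      (fun n => Eventually.of_forall fun x => ?_)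
      (Eventually.of_forall fun x => ?_)
    · exact (((cχ n).continuous.mul (continuous_const.mul cp.continuous)).add
        (mr n)).aestronglyMeasurable.mul (integrable_coe w).1
    · rw [add_mul]
      refine (norm_add_le _ _).trans (add_le_add ?_ ?_)
      · rw [norm_mul, norm_mul, norm_mul, norm_mul]
        calc _ ≤ C0 * (‖(-((a + b) / 2) : ℂ)‖ * ‖p x‖) * ‖w x‖ := by
              gcongr; exact h0 _
          _ = _ := by ring
      · rw [norm_mul]
        refine mul_le_mul_of_nonneg_right ((rbound n x).trans ?_) (norm_nonneg _)
        exact mul_le_of_le_one_left (nonneg_of_mul_nonneg_right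
          ((norm_nonneg _).trans (rbound 0 x)) (εpos 0)) (εle n)
    · have l1 : Tendsto (fun n => r n x) atTop (𝓝 0) := by
        refine squeeze_zero_norm (rbound · x) ?_
        simpa using εlim.mul_const (B x)
      have := ((((χlim x).mul_const (-((a + b) / 2) * p x)).add l1).mul_const (w x))
      simpa [mul_assoc] using this
  have := tendsto_nhds_unique lim1 (lim2.congr fun n => (test n).symm)
  rw [this, integral_const_mul]
  ring

/-- A subspace cut out by continuous conditions, one for each test function, is closed. -/
lemma isClosed_graph_of_tests (S : Submodule ℂ (X × X))
    (F : (Plane → ℝ) → X × X → ℂ) (hF : ∀ φ, ContDiff ℝ ∞ φ → HasCompactSupport φ →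
      Continuous (F φ)) (hS : ∀ p, p ∈ S ↔ ∀ φ, ContDiff ℝ ∞ φ → HasCompactSupport φ → F φ p = 0) :
    IsClosed (S : Set (X × X)) := by
  have : (S : Set (X × X)) = ⋂ (φ : Plane → ℝ) (_ : ContDiff ℝ ∞ φ) (_ : HasCompactSupport φ),
      {p | F φ p = 0} := by
    ext p
    simp [hS]
  rw [this]
  exact isClosed_iInter fun φ => isClosed_iInter fun h1 => isClosed_iInter fun h2 =>
    isClosed_eq (hF φ h1 h2) continuous_const

/-- Integration against a bounded function is a continuous functional on `X`. -/
lemma continuous_integral_bdd_smul {a : Plane → ℝ} (hm : AEStronglyMeasurable a volume) (C : ℝ)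
    (hC : ∀ x, ‖a x‖ ≤ C) : Continuous fun w : X => ∫ x, a x • w x := by
  have hm' : AEStronglyMeasurable (fun x => (a x : ℂ)) volume :=
    Complex.continuous_ofReal.comp_aestronglyMeasurable hm
  have g : ExpGrowth fun x => (a x : ℂ) :=
    ⟨C, 0, (norm_nonneg _).trans (hC 0), le_rfl, fun x => by simpa using hC x⟩
  have : (fun w : X => ∫ x, a x • w x) = fun w : X => ⟪(memLp_mul_G g hm').toLp _, w⟫_ℂ := by
    ext w
    rw [inner_eq_integral]
    refine integral_congr_ae ?_
    filter_upwards [volume_ac.ae_eq (memLp_mul_G g hm').coeFn_toLp] with x hx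
    have h2 : (G x : ℂ) ≠ 0 := by exact_mod_cast (G_pos x).ne'
    rw [hx]
    simp only [Complex.real_smul, map_mul, Complex.conj_ofReal]
    push_cast
    field_simp
  rw [this]
  fun_prop

lemma isClosed_graphL : IsClosed (graphL : Set (X × X)) := by
  refine isClosed_graph_of_tests graphL (fun φ p => (∫ x, φ x • p.2 x) -
    ∫ x, (Laplacian.laplacian φ x - (1 / 2) * fderiv ℝ φ x x) • p.1 x) (fun φ h1 h2 => ?_)
    (fun p => ?_)
  · have hc : Continuous fun x => Laplacian.laplacian φ x - (1 / 2) * fderiv ℝ φ x x := by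
      have h1 := continuous_laplacian h1
      have hc : Continuous (fderiv ℝ φ) := ‹ContDiff ℝ ∞ φ›.continuous_fderiv (by simp)
      fun_prop
    have hs : HasCompactSupport fun x => Laplacian.laplacian φ x - (1 / 2) * fderiv ℝ φ x x :=
      (hasCompactSupport_laplacian h2).sub (hasCompactSupport_fderiv_apply h2 id).mul_left
    obtain ⟨C, hC⟩ := h2.exists_bound_of_continuous h1.continuous
    obtain ⟨C', hC'⟩ := hs.exists_bound_of_continuous hc
    exact ((continuous_integral_bdd_smul h1.continuous.aestronglyMeasurable C hC).comp
      continuous_snd).sub ((continuous_integral_bdd_smul hc.aestronglyMeasurable C' hC').comp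
      continuous_fst)
  · simp only [sub_eq_zero]
    exact Iff.rfl

/-- Half the degree: minus the eigenvalue of `L` on `e_{a,b}`. -/
noncomputable def lev (i : ℕ × ℕ) : ℝ := ((i.1 : ℝ) + i.2) / 2

lemma hermE_mem_graphL (i : ℕ × ℕ) : (hermE i, (-(lev i : ℂ)) • hermE i) ∈ graphL := by
  have := graphL.smul_mem (((Real.sqrt (hermSq i))⁻¹ : ℝ) : ℂ) (hermX_mem_graphL i)
  rw [hermE]
  convert! this using 1
  rw [Prod.smul_mk, smul_comm]
  simp [lev]

/-- `L` is diagonal in the Hermite basis, on its maximal domain. -/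
lemma mem_graphL_iff {w f : X} :
    (w, f) ∈ graphL ↔ ∀ i, ⟪hermBasis i, f⟫_ℂ = -(lev i : ℂ) * ⟪hermBasis i, w⟫_ℂ := by
  constructor
  · intro h i
    rw [hermBasis_apply, hermE, inner_smul_left, inner_smul_left, inner_hermX_of_mem_graphL h]
    simp only [lev]
    push_cast
    ring
  · intro h
    have h1 := hermBasis.hasSum_repr w
    have h2 := hermBasis.hasSum_repr f
    have h3 := h1.prodMk h2
    refine isClosed_graphL.mem_of_tendsto h3 (Eventually.of_forall fun s => ?_)
    refine Submodule.sum_mem _ fun i _ => ?_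
    have := graphL.smul_mem (hermBasis.repr w i) (hermE_mem_graphL i)
    convert! this using 1
    rw [Prod.smul_mk, hermBasis_apply, HilbertBasis.repr_apply_apply, HilbertBasis.repr_apply_apply,
      h i, smul_smul]
    congr 2
    ring

/-! ### Polar coordinates -/

/-- The point with polar coordinates `(r, θ)`. -/
noncomputable def pt (p : ℝ × ℝ) : Plane := !₂[p.1 * Real.cos p.2, p.1 * Real.sin p.2]

lemma zz_pt (p : ℝ × ℝ) : zz (pt p) = p.1 * Complex.exp (p.2 * Complex.I) := by
  rw [zz_apply, Complex.exp_mul_I]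
  simp [pt]
  ring

lemma norm_pt (p : ℝ × ℝ) : ‖pt p‖ = |p.1| := by
  rw [← norm_zz, zz_pt, norm_mul, Complex.norm_exp_ofReal_mul_I, mul_one, Complex.norm_real,
    Real.norm_eq_abs]

lemma continuous_pt : Continuous pt := by
  unfold pt
  fun_prop

/-- The radial measure `r dr` on `(0, ∞)`. -/
noncomputable def radM : Measure ℝ :=
  (volume.restrict (Set.Ioi 0)).withDensity fun r => ENNReal.ofReal r

/-- The angular measure `dθ` on `(-π, π)`. -/
noncomputable def angM : Measure ℝ := volume.restrict (Set.Ioo (-Real.pi) Real.pi)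

instance : SFinite radM := by unfold radM; infer_instance

instance : IsFiniteMeasure angM := by
  unfold angM
  exact ⟨by simp⟩

/-- Integration in polar coordinates. -/
lemma measurePreserving_pt : MeasurePreserving pt (radM.prod angM) volume := by
  refine ⟨continuous_pt.measurable, ?_⟩
  ext s hs
  rw [Measure.map_apply continuous_pt.measurable hs]
  have hE : MeasurePreserving (Complex.orthonormalBasisOneI.repr : ℂ → Plane) volume volume :=
    Complex.orthonormalBasisOneI.repr.measurePreserving
  have h1 : radM.prod angM = ((volume : Measure (ℝ × ℝ)).restrict polarCoord.target).withDensity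
      fun p => ENNReal.ofReal p.1 := by
    unfold radM angM
    rw [prod_withDensity_left (by fun_prop), Measure.prod_restrict]
    rfl
  have h2 : (pt ⁻¹' s).indicator (1 : ℝ × ℝ → ℝ≥0∞) =
      fun p => ((Complex.orthonormalBasisOneI.repr : ℂ → Plane) ⁻¹' s).indicator 1
        (Complex.polarCoord.symm p) := by
    ext p
    have : (Complex.orthonormalBasisOneI.repr : ℂ → Plane) (Complex.polarCoord.symm p) = pt p := by
      apply Complex.orthonormalBasisOneI.repr.symm.injective
      rw [LinearIsometryEquiv.symm_apply_apply]
      have h : zz (pt p) = Complex.orthonormalBasisOneI.repr.symm (pt p) := rfl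
      rw [← h, zz_pt, Complex.polarCoord_symm_apply, Complex.exp_mul_I]
      push_cast
      rfl
    simp only [Set.indicator, Set.mem_preimage, this]
    rfl
  rw [← hE.measure_preimage hs.nullMeasurableSet, h1,
    ← lintegral_indicator_one (continuous_pt.measurable hs), h2,
    ← lintegral_indicator_one (hE.measurable hs),
    ← Complex.lintegral_comp_polarCoord_symm,
    lintegral_withDensity_eq_lintegral_mul₀ (by fun_prop)
      (by
        rw [← h2]
        exact (measurable_one.indicator (continuous_pt.measurable hs)).aemeasurable)]
  rfl

lemma ae_radM_pos : ∀ᵐ r ∂radM, 0 < r :=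
  (withDensity_absolutelyContinuous _ _).ae_le (ae_restrict_mem measurableSet_Ioi)

lemma ae_radM_ne (s : ℝ) : ∀ᵐ r ∂radM, r ≠ s :=
  (withDensity_absolutelyContinuous _ _).ae_le
    (ae_restrict_of_ae (by simp [ae_iff]))

lemma integrable_comp_pt {f : Plane → ℂ} (hf : Integrable f) :
    Integrable (fun p => f (pt p)) (radM.prod angM) :=
  measurePreserving_pt.integrable_comp_of_integrable hf

lemma integral_polar {f : Plane → ℂ} (hf : Integrable f) :
    ∫ x, f x = ∫ r, ∫ θ, f (pt (r, θ)) ∂angM ∂radM := by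
  rw [← integral_prod _ (integrable_comp_pt hf), ← measurePreserving_pt.map_eq,
    integral_map continuous_pt.aemeasurable (by rw [measurePreserving_pt.map_eq]; exact hf.1)]

lemma hasDerivAt_pt (r θ : ℝ) : HasDerivAt (fun θ => pt (r, θ)) (perp (pt (r, θ))) θ := by
  have h : HasDerivAt (fun θ => (![r * Real.cos θ, r * Real.sin θ] : Fin 2 → ℝ))
      ![-(r * Real.sin θ), r * Real.cos θ] θ := by
    rw [hasDerivAt_pi]
    intro i
    fin_cases i
    · simpa using (Real.hasDerivAt_cos θ).const_mul r
    · simpa using (Real.hasDerivAt_sin θ).const_mul r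
  have := (PiLp.continuousLinearEquiv 2 ℝ (fun _ : Fin 2 => ℝ)).symm.hasFDerivAt.comp_hasDerivAt θ h
  convert! this using 1

/-- Angular derivatives integrate to zero against radial weights. -/
lemma integral_radial_mul_fderiv_perp {F : Plane → ℂ} (hF : ContDiff ℝ 1 F) (ρ : ℝ → ℂ)
    (hi : Integrable fun x => ρ ‖x‖ * fderiv ℝ F x (perp x)) :
    ∫ x, ρ ‖x‖ * fderiv ℝ F x (perp x) = 0 := by
  rw [integral_polar hi]
  refine integral_eq_zero_of_ae ?_
  filter_upwards with r
  simp only [norm_pt, Pi.zero_apply]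
  rw [integral_const_mul]
  have hd : ∀ θ, HasDerivAt (fun θ => F (pt (r, θ)))
      (fderiv ℝ F (pt (r, θ)) (perp (pt (r, θ)))) θ := fun θ =>
    ((hF.differentiable (by simp) _).hasFDerivAt).comp_hasDerivAt θ (hasDerivAt_pt r θ)
  have hc : Continuous fun θ => fderiv ℝ F (pt (r, θ)) (perp (pt (r, θ))) := by
    have h1 : Continuous (fderiv ℝ F) := hF.continuous_fderiv (by simp)
    have h2 : Continuous fun θ => pt (r, θ) := continuous_pt.comp (by fun_prop)
    exact (h1.comp h2).clm_apply (continuous_perp.comp h2)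
  have : ∫ θ, fderiv ℝ F (pt (r, θ)) (perp (pt (r, θ))) ∂angM = 0 := by
    unfold angM
    rw [← integral_Ioc_eq_integral_Ioo,
      ← intervalIntegral.integral_of_le (by linarith [Real.pi_pos]),
      intervalIntegral.integral_eq_sub_of_hasDerivAt (fun θ _ => hd θ) (hc.intervalIntegrable _ _)]
    simp [pt]
  rw [this, mul_zero]

lemma integral_angM_exp (m : ℤ) :
    ∫ θ, Complex.exp (m * θ * Complex.I) ∂angM = if m = 0 then 2 * (Real.pi : ℂ) else 0 := by
  unfold angM
  rw [← integral_Ioc_eq_integral_Ioo, ← intervalIntegral.integral_of_le (by linarith [Real.pi_pos])]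
  split_ifs with h
  · subst h
    simp
    ring
  · have hc : (m * Complex.I : ℂ) ≠ 0 := by simp [h]
    rw [show (fun θ : ℝ => Complex.exp (m * θ * Complex.I)) =
      fun θ : ℝ => Complex.exp ((m * Complex.I) * θ) by ext θ; congr 1; ring,
      integral_exp_mul_complex hc]
    have : Complex.exp (m * Complex.I * Real.pi) =
        Complex.exp (m * Complex.I * (-Real.pi : ℝ)) := by
      rw [Complex.exp_eq_exp_iff_exists_int]
      exact ⟨m, by push_cast; ring⟩
    rw [this, sub_self, zero_div]

/-! ### The kernel of the nonlocal term -/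

/-- The kernel `ξ · K(ξ - η) = (2π)⁻¹ (ξ₁ η₂ - ξ₂ η₁) / |ξ - η|²`, antisymmetric in `(ξ, η)`. -/
noncomputable def kap (x y : Plane) : ℝ := (x 0 * y 1 - x 1 * y 0) / (2 * Real.pi * ‖x - y‖ ^ 2)

lemma kap_eq (x y : Plane) : kap x y = ∑ i, x i * K (x - y) i := by
  simp [kap, K, perp, Fin.sum_univ_two]
  field_simp
  ring

lemma kap_antisymm (x y : Plane) : kap y x = -kap x y := by
  unfold kap
  rw [norm_sub_rev, ← neg_div]
  congr 1
  ring

lemma abs_kap_le (x y : Plane) : |kap x y| ≤ ‖x‖ * ‖x - y‖⁻¹ := by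
  have : kap x y = inner ℝ (K (x - y)) x := by
    rw [kap_eq, PiLp.inner_apply]
    simp
  rw [this]
  refine (abs_real_inner_le_norm _ _).trans ?_
  rw [mul_comm]
  exact mul_le_mul_of_nonneg_left (norm_K_le _) (norm_nonneg _)

lemma measurable_kap : Measurable fun p : Plane × Plane => kap p.1 p.2 := by
  unfold kap
  fun_prop

/-- The ratio `min(r/s, s/r)`. -/
noncomputable def rat (s r : ℝ) : ℝ := min s r / max s r

lemma rat_comm (s r : ℝ) : rat s r = rat r s := by rw [rat, rat, min_comm, max_comm]

lemma rat_pos {s r : ℝ} (hs : 0 < s) (hr : 0 < r) : 0 < rat s r :=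
  div_pos (lt_min hs hr) (hs.trans_le (le_max_left _ _))

lemma rat_le_one {s r : ℝ} (hs : 0 < s) : rat s r ≤ 1 :=
  (div_le_one (hs.trans_le (le_max_left _ _))).2 min_le_max

lemma rat_lt_one {s r : ℝ} (hs : 0 < s) (h : r ≠ s) : rat s r < 1 :=
  (div_lt_one (hs.trans_le (le_max_left _ _))).2 (by simpa [eq_comm] using h)

lemma measurable_rat : Measurable fun p : ℝ × ℝ => rat p.1 p.2 := by
  unfold rat
  fun_prop

/-- The kernel `kap` in polar coordinates, written as a difference of two geometric series. -/
lemma kap_pt {s r : ℝ} (hs : 0 < s) (hr : 0 < r) (h : r ≠ s) (t θ : ℝ) :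
    (kap (pt (s, t)) (pt (r, θ)) : ℂ) = (4 * Real.pi * Complex.I)⁻¹ *
      ((1 - rat s r * Complex.exp ((θ - t) * Complex.I))⁻¹ -
        (1 - rat s r * Complex.exp (-((θ - t) * Complex.I)))⁻¹) := by
  have ρ0 := rat_pos hs hr
  have ρ1 := rat_lt_one hs h
  set ρ := rat s r with hρ
  set φ := θ - t with hφ
  have hM : 0 < max s r := hs.trans_le (le_max_left _ _)
  have e1 : s * r = ρ * max s r ^ 2 := by
    rw [hρ, rat, ← min_mul_max s r]; field_simp
  have e2 : s ^ 2 + r ^ 2 = (1 + ρ ^ 2) * max s r ^ 2 := by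
    rw [hρ, rat, div_pow]
    field_simp
    rcases le_total s r with h | h
    · simp [h]; ring
    · simp [h]
  have hnorm : ‖pt (s, t) - pt (r, θ)‖ ^ 2 = (1 - 2 * ρ * Real.cos φ + ρ ^ 2) * max s r ^ 2 := by
    rw [EuclideanSpace.norm_sq_eq, Fin.sum_univ_two]
    simp only [pt, PiLp.sub_apply, Real.norm_eq_abs, sq_abs]
    simp only [Matrix.cons_val_zero, Matrix.cons_val_one]
    rw [hφ, Real.cos_sub]
    linear_combination s ^ 2 * Real.sin_sq_add_cos_sq t + r ^ 2 * Real.sin_sq_add_cos_sq θ + e2 -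
      2 * (Real.cos θ * Real.cos t + Real.sin θ * Real.sin t) * e1
  have hnum : pt (s, t) 0 * pt (r, θ) 1 - pt (s, t) 1 * pt (r, θ) 0 =
      ρ * Real.sin φ * max s r ^ 2 := by
    simp only [pt, PiLp.toLp_apply, Matrix.cons_val_zero, Matrix.cons_val_one]
    rw [hφ, Real.sin_sub]
    linear_combination (Real.sin θ * Real.cos t - Real.cos θ * Real.sin t) * e1
  have hden : 0 < 1 - 2 * ρ * Real.cos φ + ρ ^ 2 := by
    nlinarith [Real.cos_le_one φ, sq_nonneg (1 - ρ)]
  have hk : kap (pt (s, t)) (pt (r, θ)) =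
      ρ * Real.sin φ / (2 * Real.pi * (1 - 2 * ρ * Real.cos φ + ρ ^ 2)) := by
    rw [kap, hnum, hnorm]
    field_simp
  have c1 : Complex.exp (((θ : ℂ) - t) * Complex.I) = Real.cos φ + Real.sin φ * Complex.I := by
    rw [show ((θ : ℂ) - t) = (φ : ℂ) by rw [hφ]; push_cast; ring, Complex.exp_mul_I]
    push_cast; rfl
  have c2 : Complex.exp (-(((θ : ℂ) - t) * Complex.I)) = Real.cos φ - Real.sin φ * Complex.I := by
    rw [show -(((θ : ℂ) - t) * Complex.I) = (-φ : ℂ) * Complex.I by rw [hφ]; push_cast; ring,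
      Complex.exp_mul_I, Complex.cos_neg, Complex.sin_neg]
    push_cast; ring
  have hcs : (Real.sin φ : ℂ) ^ 2 + (Real.cos φ : ℂ) ^ 2 = 1 := by
    exact_mod_cast Real.sin_sq_add_cos_sq φ
  have hprod : (1 - ρ * (Real.cos φ + Real.sin φ * Complex.I)) *
      (1 - ρ * (Real.cos φ - Real.sin φ * Complex.I)) =
      ((1 - 2 * ρ * Real.cos φ + ρ ^ 2 : ℝ) : ℂ) := by
    push_cast at hcs ⊢
    linear_combination (ρ : ℂ) ^ 2 * hcs - (ρ : ℂ) ^ 2 * Complex.sin φ ^ 2 * Complex.I_sq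
  have hden' : ((1 - 2 * ρ * Real.cos φ + ρ ^ 2 : ℝ) : ℂ) ≠ 0 := by exact_mod_cast hden.ne'
  have hA := left_ne_zero_of_mul (hprod ▸ hden')
  have hB := right_ne_zero_of_mul (hprod ▸ hden')
  have hpi : (Real.pi : ℂ) ≠ 0 := by exact_mod_cast Real.pi_ne_zero
  have hI := Complex.I_ne_zero
  rw [hk, c1, c2, inv_sub_inv hA hB, hprod]
  rw [Complex.ofReal_div, Complex.ofReal_mul (2 * Real.pi)]
  field_simp
  push_cast
  ring

/-- Convolution of an angular mode with the kernel `kap`: on circles, `kap` acts as the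
conjugate Poisson kernel. -/
lemma integral_kap_mode {s r : ℝ} (hs : 0 < s) (hr : 0 < r) (h : r ≠ s) (t : ℝ) (k : ℕ) :
    ∫ θ, (kap (pt (s, t)) (pt (r, θ)) : ℂ) * Complex.exp (k * θ * Complex.I) ∂angM =
      if k = 0 then 0 else Complex.I / 2 * (rat s r : ℂ) ^ k * Complex.exp (k * t * Complex.I) := by
  set ρ := rat s r with hρ
  have ρ0 : 0 < ρ := rat_pos hs hr
  have ρ1 : ρ < 1 := rat_lt_one hs h
  -- the terms of the expansion of `kap` into geometric series, times the mode `e^{ikθ}`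
  set F : ℕ → ℝ → ℂ := fun n θ => (4 * Real.pi * Complex.I)⁻¹ * (ρ : ℂ) ^ n *
    (Complex.exp (-(n * t * Complex.I)) * Complex.exp ((n + k : ℤ) * θ * Complex.I) -
      Complex.exp (n * t * Complex.I) * Complex.exp ((k - n : ℤ) * θ * Complex.I)) with hF
  have hsum : ∀ θ : ℝ, HasSum (fun n => F n θ)
      ((kap (pt (s, t)) (pt (r, θ)) : ℂ) * Complex.exp (k * θ * Complex.I)) := by
    intro θ
    have n1 : ‖(ρ : ℂ) * Complex.exp ((θ - t) * Complex.I)‖ < 1 := by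
      rw [show ((θ : ℂ) - t) = ((θ - t : ℝ) : ℂ) by push_cast; ring, norm_mul,
        Complex.norm_exp_ofReal_mul_I, Complex.norm_real, Real.norm_of_nonneg ρ0.le, mul_one]
      exact ρ1
    have n2 : ‖(ρ : ℂ) * Complex.exp (-((θ - t) * Complex.I))‖ < 1 := by
      rw [show -(((θ : ℂ) - t) * Complex.I) = ((t - θ : ℝ) : ℂ) * Complex.I by push_cast; ring,
        norm_mul,
        Complex.norm_exp_ofReal_mul_I, Complex.norm_real, Real.norm_of_nonneg ρ0.le, mul_one]
      exact ρ1
    have := (((hasSum_geometric_of_norm_lt_one n1).sub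
      (hasSum_geometric_of_norm_lt_one n2)).mul_left (4 * Real.pi * Complex.I : ℂ)⁻¹).mul_right
      (Complex.exp (k * θ * Complex.I))
    rw [hρ, ← kap_pt hs hr h t θ, ← hρ] at this
    convert! this using 2 with n
    simp only [hF]
    rw [mul_pow, mul_pow, ← Complex.exp_nat_mul, ← Complex.exp_nat_mul]
    have a1 : Complex.exp (-(n * t * Complex.I)) * Complex.exp ((n + k : ℤ) * θ * Complex.I) =
        Complex.exp (n * ((θ - t) * Complex.I)) * Complex.exp (k * θ * Complex.I) := by
      rw [← Complex.exp_add, ← Complex.exp_add]; congr 1; push_cast; ring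
    have a2 : Complex.exp (n * t * Complex.I) * Complex.exp ((k - n : ℤ) * θ * Complex.I) =
        Complex.exp (n * (-((θ - t) * Complex.I))) * Complex.exp (k * θ * Complex.I) := by
      rw [← Complex.exp_add, ← Complex.exp_add]; congr 1; push_cast; ring
    rw [a1, a2]
    ring
  have hbound : ∀ n θ, ‖F n θ‖ ≤ ‖(4 * Real.pi * Complex.I : ℂ)⁻¹‖ * ρ ^ n * 2 := by
    intro n θ
    simp only [hF]
    rw [norm_mul, norm_mul, norm_pow, Complex.norm_real, Real.norm_of_nonneg ρ0.le]
    refine mul_le_mul_of_nonneg_left ((norm_sub_le _ _).trans ?_) (by positivity)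
    have u : ∀ a : ℝ, ‖Complex.exp (a * Complex.I)‖ = 1 := Complex.norm_exp_ofReal_mul_I
    have b1 : ‖Complex.exp (-(n * t * Complex.I))‖ = 1 := by
      rw [← u (-(n * t))]; congr 2; push_cast; ring
    have b2 : ‖Complex.exp (n * t * Complex.I)‖ = 1 := by
      rw [← u (n * t)]; congr 2; push_cast; ring
    have b3 : ∀ m : ℤ, ‖Complex.exp (m * θ * Complex.I)‖ = 1 := by
      intro m
      rw [← u (m * θ)]; congr 2; push_cast; ring
    rw [norm_mul, norm_mul, b1, b2, b3, b3]
    norm_num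
  have key := hasSum_integral_of_dominated_convergence (μ := angM) (F := F)
    (f := fun θ => (kap (pt (s, t)) (pt (r, θ)) : ℂ) * Complex.exp (k * θ * Complex.I))
    (fun n _ => ‖(4 * Real.pi * Complex.I : ℂ)⁻¹‖ * ρ ^ n * 2)
    (fun n => (by fun_prop : Continuous (F n)).aestronglyMeasurable)
    (fun n => Eventually.of_forall (hbound n))
    (Eventually.of_forall fun θ =>
      ((summable_geometric_of_lt_one ρ0.le ρ1).mul_left _).mul_right _)
    (integrable_const _) (Eventually.of_forall hsum)
  -- only the term `n = k` survives the integration over the circle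
  have hint : ∀ n, ∫ θ, F n θ ∂angM = if n = k then (if k = 0 then 0 else
      Complex.I / 2 * (ρ : ℂ) ^ k * Complex.exp (k * t * Complex.I)) else 0 := by
    intro n
    have ie : ∀ m : ℤ, Integrable (fun θ : ℝ => Complex.exp (m * θ * Complex.I)) angM := by
      intro m
      refine Integrable.of_bound (by fun_prop) 1 (Eventually.of_forall fun θ => ?_)
      rw [← Complex.norm_exp_ofReal_mul_I (m * θ)]
      push_cast
      exact le_rfl
    simp only [hF]
    rw [integral_const_mul, integral_sub ((ie _).const_mul _) ((ie _).const_mul _),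
      integral_const_mul, integral_const_mul, integral_angM_exp, integral_angM_exp]
    by_cases hn : n = k
    · subst hn
      by_cases h0 : n = 0
      · subst h0; simp
      · rw [if_pos rfl, if_neg h0, if_neg (by omega), if_pos (by omega)]
        have : (Real.pi : ℂ) ≠ 0 := by exact_mod_cast Real.pi_ne_zero
        have hI := Complex.I_ne_zero
        field_simp
        rw [Complex.I_sq]
        ring
    · rw [if_neg hn, if_neg (by omega : ¬ ((k : ℤ) - n = 0))]
      by_cases h0 : (n : ℤ) + k = 0
      · omega
      · rw [if_neg h0]; simp
  simp only [hint] at key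
  exact key.unique (hasSum_ite_eq k _)

/-! ### Boundedness of the nonlocal term -/

/-- The majorant `|ξ|⁻¹` of the Biot-Savart kernel. -/
noncomputable def invN (x : Plane) : ℝ≥0∞ := ENNReal.ofReal ‖x‖⁻¹

@[fun_prop]
lemma measurable_invN : Measurable invN := by unfold invN; fun_prop

lemma lintegral_invN_ball : ∫⁻ x in Metric.ball (0 : Plane) 1, invN x < ⊤ := by
  have : IntegrableOn (fun x : Plane => ‖x‖⁻¹) (Metric.ball 0 1) := by
    refine integrableOn_ball_of_norm_le_rpow (C := 1) (α := 1) (by simp) (by simp)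
      (Eventually.of_forall fun x => ?_) (by fun_prop)
    simp [Real.rpow_neg_one]
  refine lt_of_eq_of_lt (lintegral_congr fun x => ?_) this.hasFiniteIntegral
  rw [invN, Real.enorm_of_nonneg (inv_nonneg.2 (norm_nonneg x))]

/-- A constant with `∫ |x - y|⁻¹ g(y) dy ≤ invC * M` whenever `0 ≤ g ≤ M` and `∫ g ≤ M`. -/
noncomputable def invC : ℝ≥0∞ := (∫⁻ x in Metric.ball (0 : Plane) 1, invN x) + 1

lemma invC_lt_top : invC < ⊤ := ENNReal.add_lt_top.2 ⟨lintegral_invN_ball, ENNReal.one_lt_top⟩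

/-- Split the integral at `|x - y| = 1`. -/
lemma lintegral_invN_mul_le {g : Plane → ℝ≥0∞} {M : ℝ≥0∞}
    (h1 : ∀ᵐ x, g x ≤ M) (h2 : ∫⁻ x, g x ≤ M) (x : Plane) :
    ∫⁻ y, invN (x - y) * g y ≤ invC * M := by
  have hle : ∀ᵐ y, invN (x - y) * g y ≤
      (Metric.ball (0 : Plane) 1).indicator invN (x - y) * M + g y := by
    filter_upwards [h1] with y hy
    by_cases h : x - y ∈ Metric.ball (0 : Plane) 1
    · rw [Set.indicator_of_mem h]
      exact le_add_right (mul_le_mul_right hy _)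
    · rw [Set.indicator_of_notMem h, zero_mul, zero_add]
      refine mul_le_of_le_one_left (zero_le) ?_
      rw [invN]
      refine ENNReal.ofReal_le_one.2 (inv_le_one_of_one_le₀ ?_)
      simpa using h
  have hm : Measurable ((Metric.ball (0 : Plane) 1).indicator invN) :=
    measurable_invN.indicator measurableSet_ball
  calc ∫⁻ y, invN (x - y) * g y
      ≤ ∫⁻ y, ((Metric.ball (0 : Plane) 1).indicator invN (x - y) * M + g y) :=
        lintegral_mono_ae hle
    _ = (∫⁻ y, (Metric.ball (0 : Plane) 1).indicator invN (x - y)) * M + ∫⁻ y, g y := by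
        have hm' : Measurable fun y => (Metric.ball (0 : Plane) 1).indicator invN (x - y) :=
          hm.comp (by fun_prop)
        rw [lintegral_add_left (hm'.mul_const M), lintegral_mul_const _ hm']
    _ = (∫⁻ x in Metric.ball (0 : Plane) 1, invN x) * M + ∫⁻ y, g y := by
        rw [lintegral_sub_left_eq_self (fun y => (Metric.ball (0 : Plane) 1).indicator invN y) x,
          lintegral_indicator measurableSet_ball]
    _ ≤ (∫⁻ x in Metric.ball (0 : Plane) 1, invN x) * M + M := by gcongr
    _ = invC * M := by rw [invC, add_mul, one_mul]

lemma invN_sub_comm (x y : Plane) : invN (x - y) = invN (y - x) := by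
  rw [invN, invN, norm_sub_rev]

/-- Absolute convergence of the double integrals of the kernel `kap`. -/
lemma integrable_kap_mul {φ u : Plane → ℂ} (hm : AEStronglyMeasurable φ volume) {M : ℝ}
    (h1 : ∀ x, ‖φ x‖ * ‖x‖ ≤ M) (h2 : Integrable fun x => ‖φ x‖ * ‖x‖) (hu : Integrable u) :
    Integrable (fun p : Plane × Plane => φ p.1 * (kap p.1 p.2 * u p.2))
      ((volume : Measure Plane).prod volume) := by
  have hk : Measurable fun p : Plane × Plane => (kap p.1 p.2 : ℂ) :=
    Complex.measurable_ofReal.comp measurable_kap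
  have hmeas : AEStronglyMeasurable (fun p : Plane × Plane => φ p.1 * (kap p.1 p.2 * u p.2))
      ((volume : Measure Plane).prod volume) :=
    hm.comp_fst.mul (hk.aestronglyMeasurable.mul hu.1.comp_snd)
  refine ⟨hmeas, ?_⟩
  set I : ℝ≥0∞ := ∫⁻ x, ENNReal.ofReal (‖φ x‖ * ‖x‖) with hI
  have hIfin : I < ⊤ := by
    refine lt_of_eq_of_lt (lintegral_congr fun x => ?_) h2.hasFiniteIntegral
    rw [Real.enorm_of_nonneg (by positivity)]
  have bound : ∀ y, ∫⁻ x, ‖φ x * (kap x y * u y)‖ₑ ≤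
      invC * (ENNReal.ofReal M + I) * ‖u y‖ₑ := by
    intro y
    have hg : AEMeasurable fun x : Plane => ENNReal.ofReal (‖φ x‖ * ‖x‖) := by
      have := hm.norm
      exact (this.aemeasurable.mul (by fun_prop)).ennreal_ofReal
    calc ∫⁻ x, ‖φ x * (kap x y * u y)‖ₑ
        ≤ ∫⁻ x, invN (y - x) * ENNReal.ofReal (‖φ x‖ * ‖x‖) * ‖u y‖ₑ := by
          refine lintegral_mono fun x => ?_
          simp only
          rw [enorm_mul, enorm_mul, ← mul_assoc]
          refine mul_le_mul_left ?_ _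
          rw [← enorm_mul, invN_sub_comm, invN, ← ENNReal.ofReal_mul (by positivity),
            ← ofReal_norm]
          refine ENNReal.ofReal_le_ofReal ?_
          rw [norm_mul, Complex.norm_real, Real.norm_eq_abs]
          calc ‖φ x‖ * |kap x y| ≤ ‖φ x‖ * (‖x‖ * ‖x - y‖⁻¹) :=
                mul_le_mul_of_nonneg_left (abs_kap_le x y) (norm_nonneg _)
            _ = _ := by ring
      _ = (∫⁻ x, invN (y - x) * ENNReal.ofReal (‖φ x‖ * ‖x‖)) * ‖u y‖ₑ := by
          rw [lintegral_mul_const'' _ (by fun_prop)]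
      _ ≤ _ := by
          refine mul_le_mul_left ?_ _
          exact lintegral_invN_mul_le
            (Eventually.of_forall fun x => le_add_right (ENNReal.ofReal_le_ofReal (h1 x)))
            (le_add_left le_rfl) y
  unfold HasFiniteIntegral
  rw [lintegral_prod_symm _ hmeas.enorm]
  calc ∫⁻ y, ∫⁻ x, ‖φ x * (kap x y * u y)‖ₑ
      ≤ ∫⁻ y, invC * (ENNReal.ofReal M + I) * ‖u y‖ₑ := lintegral_mono bound
    _ = invC * (ENNReal.ofReal M + I) * ∫⁻ y, ‖u y‖ₑ := by
        rw [lintegral_const_mul'' _ hu.1.enorm]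
    _ < ⊤ := ENNReal.mul_lt_top (ENNReal.mul_lt_top invC_lt_top
        (ENNReal.add_lt_top.2 ⟨ENNReal.ofReal_lt_top, hIfin⟩)) hu.hasFiniteIntegral

/-- The integral operator with kernel `kap`. -/
noncomputable def kapInt (u : Plane → ℂ) (x : Plane) : ℂ := ∫ y, kap x y * u y

lemma gradient_G_apply (x : Plane) (i : Fin 2) : gradient G x i = -(G x / 2) * x i := by
  unfold gradient
  rw [(hasFDerivAt_G x).fderiv]
  have : (InnerProductSpace.toDual ℝ Plane).symm ((-(G x / 2)) • innerSL ℝ x) =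
      (-(G x / 2)) • x := by
    rw [LinearIsometryEquiv.symm_apply_eq]
    ext v
    simp
  rw [this]
  simp

/-- Since `∇G = -(ξ/2) G`, the nonlocal term is `-(G/2)` times an integral operator with an
antisymmetric kernel. -/
lemma stretch_ae (w : X) :
    stretch w =ᵐ[volume] fun x => -((G x / 2 : ℝ) : ℂ) * kapInt w x := by
  filter_upwards [integrable_velocity w 0, integrable_velocity w 1] with x h0 h1
  have e : ∀ i, gradient G x i • velocity w i x =
      -((G x / 2 : ℝ) : ℂ) * ∫ y, (x i : ℂ) * (K (x - y) i • w y) := by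
    intro i
    rw [gradient_G_apply, velocity, integral_const_mul, Complex.real_smul]
    push_cast
    ring
  rw [stretch, Fin.sum_univ_two, e, e, ← mul_add, ← integral_add (h0.const_mul _) (h1.const_mul _),
    kapInt]
  congr 2
  ext y
  rw [kap_eq, Fin.sum_univ_two]
  simp only [Complex.real_smul]
  push_cast
  ring

lemma G_le_one (x : Plane) : G x ≤ 1 := by
  unfold G
  have h1 : Real.exp (-‖x‖ ^ 2 / 4) ≤ 1 := Real.exp_le_one_iff.2 (by nlinarith [sq_nonneg ‖x‖])
  have h2 : (4 * Real.pi)⁻¹ ≤ 1 := inv_le_one_of_one_le₀ (by linarith [Real.pi_gt_three])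
  calc _ ≤ (1 : ℝ) * 1 := by gcongr
    _ = 1 := one_mul 1

lemma G_mul_norm_sq_le (x : Plane) : G x * ‖x‖ ^ 2 ≤ 4 := by
  unfold G
  have h2 : (4 * Real.pi)⁻¹ ≤ 1 := inv_le_one_of_one_le₀ (by linarith [Real.pi_gt_three])
  have h3 := Real.add_one_le_exp (‖x‖ ^ 2 / 4)
  have h4 : Real.exp (-‖x‖ ^ 2 / 4) * Real.exp (‖x‖ ^ 2 / 4) = 1 := by
    rw [← Real.exp_add]; simp; ring
  have h5 := Real.exp_pos (-‖x‖ ^ 2 / 4)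
  have h6 : Real.exp (-‖x‖ ^ 2 / 4) * ‖x‖ ^ 2 ≤ 4 := by nlinarith
  calc _ = (4 * Real.pi)⁻¹ * (Real.exp (-‖x‖ ^ 2 / 4) * ‖x‖ ^ 2) := by ring
    _ ≤ 1 * 4 := mul_le_mul h2 h6 (by positivity) zero_le_one
    _ = 4 := one_mul 4

/-- The squared norm in `X` as a lower integral. -/
noncomputable def wSq (f : Plane → ℂ) : ℝ≥0∞ := ∫⁻ x, ENNReal.ofReal (G x)⁻¹ * ‖f x‖ₑ ^ 2

lemma eLpNorm_sq_eq {f : Plane → ℂ} (hf : AEStronglyMeasurable f volume) :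
    eLpNorm f 2 weight ^ 2 = wSq f := by
  rw [eLpNorm_eq_lintegral_rpow_enorm_toReal (by simp) (by simp)]
  rw [← ENNReal.rpow_natCast, ← ENNReal.rpow_mul]
  simp only [ENNReal.toReal_ofNat, Nat.cast_ofNat]
  rw [show (1 / 2 * 2 : ℝ) = 1 by norm_num, ENNReal.rpow_one]
  unfold weight
  rw [lintegral_withDensity_eq_lintegral_mul₀ measurable_dens.aemeasurable (by fun_prop), wSq]
  refine lintegral_congr fun x => ?_
  simp only [Pi.mul_apply]
  congr 1
  exact_mod_cast ENNReal.rpow_natCast _ 2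

lemma wSq_coe (w : X) : wSq w = ENNReal.ofReal (‖w‖ ^ 2) := by
  rw [← eLpNorm_sq_eq (integrable_coe w).1, Lp.norm_def, ← ENNReal.toReal_pow,
    ENNReal.ofReal_toReal (ENNReal.pow_ne_top (Lp.eLpNorm_ne_top w))]

lemma lintegral_mul_sq_le {f g : Plane → ℝ≥0∞} (hf : AEMeasurable f) (hg : AEMeasurable g) :
    (∫⁻ x, f x * g x) ^ 2 ≤ (∫⁻ x, f x ^ 2) * ∫⁻ x, g x ^ 2 := by
  have h := ENNReal.lintegral_mul_le_Lp_mul_Lq (volume : Measure Plane)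
    (Real.HolderConjugate.two_two) hf hg
  have e : ∀ t : ℝ≥0∞, (t ^ (1 / 2 : ℝ)) ^ 2 = t := by
    intro t
    rw [← ENNReal.rpow_natCast, ← ENNReal.rpow_mul]
    norm_num
  have e2 : ∀ t : ℝ≥0∞, t ^ (2 : ℝ) = t ^ 2 := fun t => by
    rw [← ENNReal.rpow_natCast]; norm_num
  calc (∫⁻ x, f x * g x) ^ 2 ≤ _ := pow_le_pow_left₀ (zero_le) h 2
    _ = _ := by rw [mul_pow, e, e]; simp only [e2]

/-- Boundedness of the stretching operator, by Schur's test. -/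
lemma wSq_kapInt_le {u : Plane → ℂ} (hu : AEStronglyMeasurable u volume) :
    wSq (fun x => -((G x / 2 : ℝ) : ℂ) * kapInt u x) ≤
      (invC * 1) * (invC * (4 + ∫⁻ x, ENNReal.ofReal (G x * ‖x‖ ^ 2))) * wSq u := by
  set C1 : ℝ≥0∞ := 4 + ∫⁻ x, ENNReal.ofReal (G x * ‖x‖ ^ 2) with hC1
  have mG : Measurable G := continuous_G.measurable
  have hGint : ∫⁻ y, ENNReal.ofReal (G y) ≤ 1 := by
    have h1 := integral_G
    rw [integral_complex_ofReal] at h1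
    have h2 : ∫ x, G x = 1 := by exact_mod_cast h1
    have hi : Integrable G := integrable_G.re
    rw [← ofReal_integral_eq_lintegral_ofReal hi (Eventually.of_forall fun x => (G_pos x).le), h2]
    simp
  have step : ∀ x, ENNReal.ofReal (G x)⁻¹ * ‖-((G x / 2 : ℝ) : ℂ) * kapInt u x‖ₑ ^ 2 ≤
      (invC * 1) * ∫⁻ y, (invN (y - x) * ENNReal.ofReal (G x * ‖x‖ ^ 2)) *
        (ENNReal.ofReal (G y)⁻¹ * ‖u y‖ₑ ^ 2) := by
    intro x
    have hG := G_pos x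
    have a1 : ‖kapInt u x‖ₑ ≤ ENNReal.ofReal ‖x‖ * ∫⁻ y, invN (x - y) * ‖u y‖ₑ := by
      rw [← lintegral_const_mul' _ _ ENNReal.ofReal_ne_top]
      refine (enorm_integral_le_lintegral_enorm _).trans (lintegral_mono fun y => ?_)
      rw [enorm_mul, ← mul_assoc]
      refine mul_le_mul_left ?_ _
      rw [invN, ← ENNReal.ofReal_mul (norm_nonneg _), ← ofReal_norm, Complex.norm_real,
        Real.norm_eq_abs]
      exact ENNReal.ofReal_le_ofReal (abs_kap_le x y)
    -- Cauchy-Schwarz with the weights `G` and `G⁻¹`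
    have a2 : (∫⁻ y, invN (x - y) * ‖u y‖ₑ) ^ 2 ≤
        (invC * 1) * ∫⁻ y, invN (y - x) * (ENNReal.ofReal (G y)⁻¹ * ‖u y‖ₑ ^ 2) := by
      have e : ∀ y, invN (x - y) * ‖u y‖ₑ = ENNReal.ofReal (Real.sqrt (‖x - y‖⁻¹ * G y)) *
          (ENNReal.ofReal (Real.sqrt (‖x - y‖⁻¹ * (G y)⁻¹)) * ‖u y‖ₑ) := by
        intro y
        rw [← mul_assoc, ← ENNReal.ofReal_mul (Real.sqrt_nonneg _), ← Real.sqrt_mul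
          (mul_nonneg (by positivity) (G_pos y).le)]
        rw [show ‖x - y‖⁻¹ * G y * (‖x - y‖⁻¹ * (G y)⁻¹) = ‖x - y‖⁻¹ ^ 2 by
          have := (G_pos y).ne'; field_simp, Real.sqrt_sq (by positivity), invN]
      simp only [e]
      refine (lintegral_mul_sq_le (by fun_prop) (by fun_prop)).trans ?_
      refine mul_le_mul' ?_ (le_of_eq ?_)
      · refine le_of_eq_of_le (lintegral_congr fun y => ?_) (lintegral_invN_mul_le
          (g := fun y => ENNReal.ofReal (G y))
          (Eventually.of_forall fun y => ENNReal.ofReal_le_one.2 (G_le_one y)) hGint x)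
        rw [← ENNReal.ofReal_pow (Real.sqrt_nonneg _),
          Real.sq_sqrt (mul_nonneg (by positivity) (G_pos y).le),
          ENNReal.ofReal_mul (by positivity), invN]
      · refine lintegral_congr fun y => ?_
        rw [mul_pow, ← ENNReal.ofReal_pow (Real.sqrt_nonneg _),
          Real.sq_sqrt (mul_nonneg (by positivity) (inv_nonneg.2 (G_pos y).le)),
          ENNReal.ofReal_mul (by positivity), invN_sub_comm, invN, mul_assoc]
    calc ENNReal.ofReal (G x)⁻¹ * ‖-((G x / 2 : ℝ) : ℂ) * kapInt u x‖ₑ ^ 2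
        = ENNReal.ofReal (G x / 4) * ‖kapInt u x‖ₑ ^ 2 := by
          rw [enorm_mul, mul_pow, ← mul_assoc, enorm_neg, ← ofReal_norm,
            Complex.norm_real, Real.norm_of_nonneg (by positivity),
            ← ENNReal.ofReal_pow (by positivity), ← ENNReal.ofReal_mul (by positivity)]
          congr 2
          field_simp
          norm_num
      _ ≤ ENNReal.ofReal (G x / 4) *
          (ENNReal.ofReal ‖x‖ * ∫⁻ y, invN (x - y) * ‖u y‖ₑ) ^ 2 := by gcongr
      _ ≤ ENNReal.ofReal (G x) *
          (ENNReal.ofReal (‖x‖ ^ 2) * ((invC * 1) *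
            ∫⁻ y, invN (y - x) * (ENNReal.ofReal (G y)⁻¹ * ‖u y‖ₑ ^ 2))) := by
          rw [mul_pow, ← ENNReal.ofReal_pow (norm_nonneg _)]
          gcongr
          linarith
      _ = (invC * 1) * (ENNReal.ofReal (G x * ‖x‖ ^ 2) *
            ∫⁻ y, invN (y - x) * (ENNReal.ofReal (G y)⁻¹ * ‖u y‖ₑ ^ 2)) := by
          rw [ENNReal.ofReal_mul hG.le]
          ring
      _ = _ := by
          rw [← lintegral_const_mul' _ _ ENNReal.ofReal_ne_top]
          congr 1
          refine lintegral_congr fun y => ?_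
          ring
  have mN : Measurable fun p : Plane × Plane => invN (p.2 - p.1) :=
    measurable_invN.comp (by fun_prop)
  calc wSq (fun x => -((G x / 2 : ℝ) : ℂ) * kapInt u x)
      ≤ ∫⁻ x, (invC * 1) * ∫⁻ y, (invN (y - x) * ENNReal.ofReal (G x * ‖x‖ ^ 2)) *
        (ENNReal.ofReal (G y)⁻¹ * ‖u y‖ₑ ^ 2) := lintegral_mono step
    _ = (invC * 1) * ∫⁻ x, ∫⁻ y, (invN (y - x) * ENNReal.ofReal (G x * ‖x‖ ^ 2)) *
        (ENNReal.ofReal (G y)⁻¹ * ‖u y‖ₑ ^ 2) := by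
        rw [lintegral_const_mul' _ _ (by simpa using invC_lt_top.ne)]
    _ = (invC * 1) * ∫⁻ y, ∫⁻ x, (invN (y - x) * ENNReal.ofReal (G x * ‖x‖ ^ 2)) *
        (ENNReal.ofReal (G y)⁻¹ * ‖u y‖ₑ ^ 2) := by
        rw [lintegral_lintegral_swap]
        have m2 : AEMeasurable (fun y => ENNReal.ofReal (G y)⁻¹ * ‖u y‖ₑ ^ 2) volume := by
          fun_prop
        have m3 : Measurable fun p : Plane × Plane => ENNReal.ofReal (G p.1 * ‖p.1‖ ^ 2) := by
          fun_prop
        exact ((mN.mul m3).aemeasurable).mul m2.comp_snd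
    _ ≤ (invC * 1) * ∫⁻ y, (invC * C1) * (ENNReal.ofReal (G y)⁻¹ * ‖u y‖ₑ ^ 2) := by
        refine mul_le_mul_right (lintegral_mono fun y => ?_) _
        have m1 : Measurable fun x => invN (y - x) * ENNReal.ofReal (G x * ‖x‖ ^ 2) :=
          (measurable_invN.comp (by fun_prop)).mul (by fun_prop)
        simp only
        rw [lintegral_mul_const _ m1]
        refine mul_le_mul_left ?_ _
        refine lintegral_invN_mul_le (Eventually.of_forall fun x => ?_)
          (le_add_left le_rfl) y
        refine le_add_right ((ENNReal.ofReal_le_ofReal (G_mul_norm_sq_le x)).trans ?_)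
        simp
    _ = _ := by
        rw [lintegral_const_mul' _ _ ?_, ← mul_assoc, wSq]
        refine (ENNReal.mul_lt_top invC_lt_top (ENNReal.add_lt_top.2 ⟨by simp, ?_⟩)).ne
        have h1 : ExpGrowth fun x : Plane => zz x * zc x :=
          (expGrowth_clm zz).mul (expGrowth_clm zc)
        have h2 := (h1.integrable_mul_G (by fun_prop)).hasFiniteIntegral
        refine lt_of_eq_of_lt (lintegral_congr fun x => ?_) h2
        simp only
        rw [zz_mul_zc, ← Complex.ofReal_mul, ← ofReal_norm, Complex.norm_real,
          Real.norm_of_nonneg (mul_nonneg (by positivity) (G_pos x).le), mul_comm]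

/-- The constant in the `X`-bound of the stretching operator. -/
noncomputable def stC : ℝ≥0∞ :=
  (invC * 1) * (invC * (4 + ∫⁻ x, ENNReal.ofReal (G x * ‖x‖ ^ 2)))

lemma stC_lt_top : stC < ⊤ := by
  have h1 : ExpGrowth fun x : Plane => zz x * zc x := (expGrowth_clm zz).mul (expGrowth_clm zc)
  have h2 := (h1.integrable_mul_G (by fun_prop)).hasFiniteIntegral
  have h3 : ∫⁻ x, ENNReal.ofReal (G x * ‖x‖ ^ 2) < ⊤ := by
    refine lt_of_eq_of_lt (lintegral_congr fun x => ?_) h2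
    simp only
    rw [zz_mul_zc, ← Complex.ofReal_mul, ← ofReal_norm, Complex.norm_real,
      Real.norm_of_nonneg (mul_nonneg (by positivity) (G_pos x).le), mul_comm]
  exact ENNReal.mul_lt_top (ENNReal.mul_lt_top invC_lt_top (by simp))
    (ENNReal.mul_lt_top invC_lt_top (ENNReal.add_lt_top.2 ⟨by simp, h3⟩))

lemma wSq_congr {f g : Plane → ℂ} (h : f =ᵐ[volume] g) : wSq f = wSq g := by
  refine lintegral_congr_ae ?_
  filter_upwards [h] with x hx
  rw [hx]

lemma aestronglyMeasurable_stretch (w : X) : AEStronglyMeasurable (stretch w) volume := by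
  have h : ∀ i, AEStronglyMeasurable (fun x => gradient G x i • velocity w i x) volume := fun i =>
    (continuous_gradient_G i).aestronglyMeasurable.smul
      (locallyIntegrable_velocity w i).aestronglyMeasurable
  refine ((h 0).add (h 1)).congr (Eventually.of_forall fun x => ?_)
  simp [stretch, Fin.sum_univ_two]

lemma wSq_stretch_le (w : X) : wSq (stretch w) ≤ stC * ENNReal.ofReal (‖w‖ ^ 2) := by
  rw [wSq_congr (stretch_ae w), ← wSq_coe]
  exact wSq_kapInt_le (integrable_coe w).1

lemma memLp_stretch (w : X) : MemLp (stretch w) 2 weight := by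
  refine ⟨(aestronglyMeasurable_stretch w).mono_ac weight_ac, ?_⟩
  have h : eLpNorm (stretch w) 2 weight ^ 2 < ⊤ := by
    rw [eLpNorm_sq_eq (aestronglyMeasurable_stretch w)]
    exact (wSq_stretch_le w).trans_lt (ENNReal.mul_lt_top stC_lt_top ENNReal.ofReal_lt_top)
  by_contra hne
  rw [not_lt, top_le_iff] at hne
  simp [hne] at h

/-- The nonlocal part `w ↦ (K * w)·∇G` as a bounded operator on `X`. -/
noncomputable def St : X →L[ℂ] X :=
  LinearMap.mkContinuous
    { toFun := fun w => (memLp_stretch w).toLp _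
      map_add' := fun v w => by
        rw [← MemLp.toLp_add]
        exact MemLp.toLp_congr _ _ (weight_ac.ae_eq (stretch_add v w))
      map_smul' := fun c w => by
        rw [RingHom.id_apply, ← MemLp.toLp_const_smul]
        exact MemLp.toLp_congr _ _ (Eventually.of_forall fun x => stretch_smul c w x) }
    (Real.sqrt stC.toReal) (fun w => by
      have h : wSq ((memLp_stretch w).toLp (stretch w) : X) ≤ stC * ENNReal.ofReal (‖w‖ ^ 2) := by
        rw [wSq_congr (volume_ac.ae_eq (memLp_stretch w).coeFn_toLp)]
        exact wSq_stretch_le w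
      rw [wSq_coe, ← ENNReal.ofReal_toReal stC_lt_top.ne,
        ← ENNReal.ofReal_mul ENNReal.toReal_nonneg,
        ENNReal.ofReal_le_ofReal_iff (by positivity)] at h
      refine abs_le_of_sq_le_sq' ?_ (by positivity) |>.2
      rw [mul_pow, Real.sq_sqrt ENNReal.toReal_nonneg]
      exact h)

lemma coeFn_St (w : X) : (St w : Plane → ℂ) =ᵐ[volume] stretch w :=
  volume_ac.ae_eq (memLp_stretch w).coeFn_toLp

lemma coeFn_St' (w : X) :
    (St w : Plane → ℂ) =ᵐ[volume] fun x => -((G x / 2 : ℝ) : ℂ) * kapInt w x :=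
  (coeFn_St w).trans (stretch_ae w)

lemma integral_stretch_eq (w : X) (φ : Plane → ℝ) :
    ∫ x, φ x • stretch w x = ∫ x, φ x • (St w : Plane → ℂ) x := by
  refine integral_congr_ae ?_
  filter_upwards [coeFn_St w] with x hx
  rw [hx]

/-! ### Skew-symmetry of the nonlocal term -/

/-- Antisymmetry of the integral operator with kernel `kap`. -/
lemma integral_mul_kapInt {φ u : Plane → ℂ} (hm : AEStronglyMeasurable φ volume) {M : ℝ}
    (h1 : ∀ x, ‖φ x‖ * ‖x‖ ≤ M) (h2 : Integrable fun x => ‖φ x‖ * ‖x‖) (hu : Integrable u) :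
    ∫ x, φ x * kapInt u x = -∫ y, u y * kapInt φ y := by
  have h := integrable_kap_mul hm h1 h2 hu
  have e1 : ∫ x, φ x * kapInt u x = ∫ x, ∫ y, φ x * (kap x y * u y) := by
    congr 1; ext x; rw [kapInt, integral_const_mul]
  rw [e1, integral_integral_swap h, ← integral_neg]
  congr 1; ext y
  rw [kapInt, ← integral_const_mul, ← integral_neg]
  congr 1; ext x
  rw [kap_antisymm x y]
  push_cast
  ring

lemma ExpGrowth.bdd_mul_G {f : Plane → ℂ} (hf : ExpGrowth f) :
    ∃ M : ℝ, ∀ x, ‖f x * G x‖ ≤ M := by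
  obtain ⟨C, c, hC, hc, h⟩ := hf
  refine ⟨C * Real.exp (c ^ 2), fun x => ?_⟩
  rw [norm_mul, Complex.norm_real, Real.norm_of_nonneg (G_pos x).le]
  have h2 : (4 * Real.pi)⁻¹ ≤ 1 := inv_le_one_of_one_le₀ (by linarith [Real.pi_gt_three])
  calc ‖f x‖ * G x ≤ C * Real.exp (c * ‖x‖) * (1 * Real.exp (-‖x‖ ^ 2 / 4)) := by
        unfold G; gcongr; exact h x
    _ = C * Real.exp (c * ‖x‖ + -‖x‖ ^ 2 / 4) := by rw [Real.exp_add]; ring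
    _ ≤ C * Real.exp (c ^ 2) := by
        refine mul_le_mul_of_nonneg_left (Real.exp_le_exp.2 ?_) hC
        nlinarith [sq_nonneg (‖x‖ / 2 - c)]

lemma integral_mul_kapInt_of_expGrowth {f u : Plane → ℂ} (hf : ExpGrowth f)
    (hm : AEStronglyMeasurable f volume) (hu : Integrable u) :
    ∫ x, (f x * G x) * kapInt u x = -∫ y, u y * kapInt (fun x => f x * G x) y := by
  have hz : ExpGrowth fun x => f x * zz x := hf.mul (expGrowth_clm zz)
  obtain ⟨M, hM⟩ := hz.bdd_mul_G
  have e : ∀ x, ‖f x * G x‖ * ‖x‖ = ‖f x * zz x * G x‖ := by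
    intro x; rw [norm_mul, norm_mul, norm_mul, norm_zz]; ring
  refine integral_mul_kapInt (M := M)
    (hm.mul (Complex.continuous_ofReal.comp continuous_G).aestronglyMeasurable)
    (fun x => (e x).trans_le (hM x)) ?_ hu
  simp only [e]
  exact (hz.integrable_mul_G (by fun_prop)).norm

lemma inner_mulG_St (f : Plane → ℂ) (hf : ExpGrowth f) (hc : Continuous f) (w : X) :
    ⟪mulG f hf hc, St w⟫_ℂ = -(1 / 2) * ∫ x, (conj (f x) * G x) * kapInt w x := by
  rw [inner_mulG, ← integral_const_mul]
  refine integral_congr_ae ?_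
  filter_upwards [coeFn_St' w] with x hx
  rw [hx]
  push_cast
  ring

/-- `St` is skew-symmetric on the functions `f G`. -/
lemma inner_mulG_St_mulG (f g : Plane → ℂ) (hf : ExpGrowth f) (hc : Continuous f)
    (hg : ExpGrowth g) (hd : Continuous g) :
    ⟪mulG f hf hc, St (mulG g hg hd)⟫_ℂ = -⟪St (mulG f hf hc), mulG g hg hd⟫_ℂ := by
  have hk : ∀ (h : Plane → ℂ) (h1 : ExpGrowth h) (h2 : Continuous h),
      kapInt (mulG h h1 h2) = kapInt fun x => h x * G x := by
    intro h h1 h2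
    ext x
    refine integral_congr_ae ?_
    filter_upwards [coeFn_mulG h h1 h2] with y hy
    rw [hy]
  have hf' : ExpGrowth fun x => conj (f x) := hf.mono 1 zero_le_one (by simp)
  have h4 : conj (2 : ℂ) = 2 := Complex.conj_ofNat 2
  rw [← inner_conj_symm (St (mulG f hf hc)), inner_mulG_St, inner_mulG_St, hk, hk,
    integral_mul_kapInt_of_expGrowth hf' (by fun_prop)
      (hg.integrable_mul_G hd.aestronglyMeasurable), map_mul, ← integral_conj]
  simp only [map_neg, map_div₀, map_one, h4]
  have : ∫ y, g y * ↑(G y) * kapInt (fun x => conj (f x) * ↑(G x)) y =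
      ∫ a, conj (conj (g a) * ↑(G a) * kapInt (fun x => f x * ↑(G x)) a) := by
    congr 1; ext y
    simp only [map_mul, Complex.conj_conj, Complex.conj_ofReal]
    congr 1
    rw [kapInt, kapInt, ← integral_conj]
    congr 1; ext x
    simp
  rw [this]
  ring

/-! ### The transport term on the Hermite functions -/

lemma memLp_bdd_mul {m : Plane → ℂ} (hm : Measurable m) (hb : ∀ x, ‖m x‖ ≤ 1) (w : X) :
    MemLp (fun x => m x * w x) 2 weight :=
  (Lp.memLp w).of_le_mul (c := 1) (hm.aestronglyMeasurable.mul (Lp.memLp w).1)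
    (Eventually.of_forall fun x => by
      rw [norm_mul]; exact mul_le_mul_of_nonneg_right (hb x) (norm_nonneg _))

/-- Multiplication by a measurable function bounded by `1`, as a bounded operator on `X`. -/
noncomputable def mulOp (m : Plane → ℂ) (hm : Measurable m) (hb : ∀ x, ‖m x‖ ≤ 1) : X →L[ℂ] X :=
  LinearMap.mkContinuous
    { toFun := fun w => (memLp_bdd_mul hm hb w).toLp _
      map_add' := fun v w => by
        rw [← MemLp.toLp_add]
        refine MemLp.toLp_congr _ _ ?_
        filter_upwards [Lp.coeFn_add v w] with x hx
        simp only [hx, Pi.add_apply, mul_add]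
      map_smul' := fun c w => by
        rw [RingHom.id_apply, ← MemLp.toLp_const_smul]
        refine MemLp.toLp_congr _ _ ?_
        filter_upwards [Lp.coeFn_smul c w] with x hx
        simp only [hx, Pi.smul_apply, smul_eq_mul]
        ring }
    1 (fun w => Lp.norm_le_mul_norm_of_ae_le_mul (by
      filter_upwards [(memLp_bdd_mul hm hb w).coeFn_toLp] with x hx
      change ‖((memLp_bdd_mul hm hb w).toLp _ : X) x‖ ≤ _
      rw [hx, norm_mul]
      exact mul_le_mul_of_nonneg_right (hb x) (norm_nonneg _)))

lemma coeFn_mulOp (m : Plane → ℂ) (hm : Measurable m) (hb : ∀ x, ‖m x‖ ≤ 1) (w : X) :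
    (mulOp m hm hb w : Plane → ℂ) =ᵐ[volume] fun x => m x * w x :=
  volume_ac.ae_eq (memLp_bdd_mul hm hb w).coeFn_toLp

lemma norm_mulOp_le (m : Plane → ℂ) (hm : Measurable m) (hb : ∀ x, ‖m x‖ ≤ 1) (w : X) :
    ‖mulOp m hm hb w‖ ≤ ‖w‖ := by
  have h : ‖mulOp m hm hb‖ ≤ 1 := by
    unfold mulOp
    exact LinearMap.mkContinuous_norm_le _ zero_le_one _
  simpa using (mulOp m hm hb).le_of_opNorm_le h w

/-- The angular velocity `Φ(r) = (2π)⁻¹ (1 - exp(-r²/4)) / r²` of the vortex. -/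
noncomputable def phiR (r : ℝ) : ℝ := (2 * Real.pi)⁻¹ * (1 - Real.exp (-r ^ 2 / 4)) / r ^ 2

/-- The radial profile of `G`. -/
noncomputable def gR (r : ℝ) : ℝ := (4 * Real.pi)⁻¹ * Real.exp (-r ^ 2 / 4)

lemma vG_eq (x : Plane) : vG x = phiR ‖x‖ • perp x := rfl

lemma G_eq (x : Plane) : G x = gR ‖x‖ := rfl

@[fun_prop]
lemma measurable_phiR : Measurable phiR := by unfold phiR; fun_prop

lemma exp_le_one (r : ℝ) : Real.exp (-r ^ 2 / 4) ≤ 1 :=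
  Real.exp_le_one_iff.2 (by nlinarith [sq_nonneg r])

lemma two_pi_inv_le : (2 * Real.pi)⁻¹ ≤ 1 :=
  inv_le_one_of_one_le₀ (by linarith [Real.pi_gt_three])

lemma phiR_nonneg (r : ℝ) : 0 ≤ phiR r := by
  unfold phiR
  have h1 := exp_le_one r
  have h3 : 0 ≤ 1 - Real.exp (-r ^ 2 / 4) := by linarith
  positivity

lemma phiR_pos {r : ℝ} (hr : 0 < r) : 0 < phiR r := by
  unfold phiR
  have h1 : Real.exp (-r ^ 2 / 4) < 1 := by
    rw [← Real.exp_zero]; exact Real.exp_lt_exp.2 (by nlinarith)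
  have h3 : 0 < 1 - Real.exp (-r ^ 2 / 4) := by linarith
  positivity

lemma phiR_le_one (r : ℝ) : phiR r ≤ 1 := by
  unfold phiR
  have h2 : 1 - Real.exp (-r ^ 2 / 4) ≤ r ^ 2 := by
    nlinarith [Real.add_one_le_exp (-r ^ 2 / 4)]
  refine div_le_one_of_le₀ ?_ (by positivity)
  calc _ ≤ 1 * (r ^ 2) := mul_le_mul two_pi_inv_le h2
        (by linarith [exp_le_one r]) zero_le_one
    _ = _ := one_mul _

lemma phiR_mul_le_one {r : ℝ} (hr : 0 ≤ r) : phiR r * r ≤ 1 := by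
  rcases le_total r 1 with h | h
  · calc _ ≤ (1 : ℝ) * 1 := mul_le_mul (phiR_le_one r) h hr zero_le_one
      _ = 1 := one_mul 1
  · have h0 : 0 < r := by linarith
    have : phiR r * r = (2 * Real.pi)⁻¹ * (1 - Real.exp (-r ^ 2 / 4)) / r := by
      unfold phiR; field_simp
    rw [this]
    refine div_le_one_of_le₀ ?_ hr
    have := exp_le_one r
    calc _ ≤ (1 : ℝ) * 1 := mul_le_mul two_pi_inv_le
          (by linarith [Real.exp_pos (-r ^ 2 / 4)]) (by linarith) zero_le_one
      _ ≤ r := by linarith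

lemma zz_perp (x : Plane) : zz (perp x) = Complex.I * zz x := by
  simp [zz_apply, perp]
  linear_combination -(x 1 : ℂ) * Complex.I_sq

lemma zc_perp (x : Plane) : zc (perp x) = -Complex.I * zc x := by
  rw [zc_apply, zz_perp, zc_apply]; simp

/-- `H_{a,b}` has angular mode `a - b`. -/
lemma fderiv_herm_perp (a b : ℕ) (x : Plane) :
    fderiv ℝ (herm a b) x (perp x) = Complex.I * (a - b) * herm a b x := by
  have := congrFun (dirD_herm (perp x) a b) x
  unfold dirD at this
  rw [this, zz_perp, zc_perp]
  linear_combination Complex.I * zz_herm_sub_zc_herm a b x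

/-- Multiplication by `i Φ z`. -/
noncomputable def Mz : X →L[ℂ] X :=
  mulOp (fun x => Complex.I * (phiR ‖x‖ * zz x))
    (by have := zz.continuous.measurable; fun_prop) (fun x => by
      rw [norm_mul, Complex.norm_I, one_mul, norm_mul, Complex.norm_real,
        Real.norm_of_nonneg (phiR_nonneg _), norm_zz]
      exact phiR_mul_le_one (norm_nonneg x))

/-- Multiplication by `i Φ z̄`. -/
noncomputable def Mzc : X →L[ℂ] X :=
  mulOp (fun x => Complex.I * (phiR ‖x‖ * zc x))
    (by have := zc.continuous.measurable; fun_prop) (fun x => by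
      rw [norm_mul, Complex.norm_I, one_mul, norm_mul, Complex.norm_real,
        Real.norm_of_nonneg (phiR_nonneg _), norm_zc]
      exact phiR_mul_le_one (norm_nonneg x))

/-- The normalised `∂_z`-derivative of the polynomial factor of `e_{a,b}`. -/
noncomputable def dE (i : ℕ × ℕ) : X := ((Real.sqrt i.1 / 2 : ℝ) : ℂ) • hermE (i.1 - 1, i.2)

/-- The normalised `∂_{z̄}`-derivative of the polynomial factor of `e_{a,b}`. -/
noncomputable def dcE (i : ℕ × ℕ) : X := ((Real.sqrt i.2 / 2 : ℝ) : ℂ) • hermE (i.1, i.2 - 1)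

lemma dE_eq (i : ℕ × ℕ) :
    dE i = ((Real.sqrt (hermSq i))⁻¹ * i.1 : ℂ) • hermX (i.1 - 1, i.2) := by
  obtain ⟨a, b⟩ := i
  rw [dE, hermE, smul_smul, ← Complex.ofReal_mul]
  rcases a with _ | a
  · simp
  · have h1 : hermSq (a + 1, b) = (2 * Real.sqrt (a + 1 : ℕ)) ^ 2 * hermSq (a, b) := by
      rw [mul_pow, Real.sq_sqrt (Nat.cast_nonneg _)]
      simp only [hermSq, Nat.factorial_succ]
      push_cast
      ring
    simp only [Nat.add_sub_cancel]
    rw [h1, Real.sqrt_mul (by positivity), Real.sqrt_sq (by positivity)]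
    congr 1
    have h2 := (Real.sqrt_pos.2 (hermSq_pos (a, b))).ne'
    have h3 : Real.sqrt (a + 1 : ℕ) ≠ 0 := (Real.sqrt_pos.2 (by positivity)).ne'
    have h4 : Real.sqrt (a + 1 : ℕ) * Real.sqrt (a + 1 : ℕ) = (a + 1 : ℕ) :=
      Real.mul_self_sqrt (Nat.cast_nonneg _)
    norm_cast
    field_simp
    rw [pow_two, h4]

lemma dcE_eq (i : ℕ × ℕ) :
    dcE i = ((Real.sqrt (hermSq i))⁻¹ * i.2 : ℂ) • hermX (i.1, i.2 - 1) := by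
  obtain ⟨a, b⟩ := i
  rw [dcE, hermE, smul_smul, ← Complex.ofReal_mul]
  rcases b with _ | b
  · simp
  · have h1 : hermSq (a, b + 1) = (2 * Real.sqrt (b + 1 : ℕ)) ^ 2 * hermSq (a, b) := by
      rw [mul_pow, Real.sq_sqrt (Nat.cast_nonneg _)]
      simp only [hermSq, Nat.factorial_succ]
      push_cast
      ring
    simp only [Nat.add_sub_cancel]
    rw [h1, Real.sqrt_mul (by positivity), Real.sqrt_sq (by positivity)]
    congr 1
    have h2 := (Real.sqrt_pos.2 (hermSq_pos (a, b))).ne'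
    have h3 : Real.sqrt (b + 1 : ℕ) ≠ 0 := (Real.sqrt_pos.2 (by positivity)).ne'
    have h4 : Real.sqrt (b + 1 : ℕ) * Real.sqrt (b + 1 : ℕ) = (b + 1 : ℕ) :=
      Real.mul_self_sqrt (Nat.cast_nonneg _)
    norm_cast
    field_simp
    rw [pow_two, h4]

/-- The transport part `v^G·∇ e_{a,b}`, written without loss of decay through `v^G·∇G = 0`. -/
noncomputable def transE (i : ℕ × ℕ) : X := Mz (dE i) - Mzc (dcE i)

/-- The element `Λ e_{a,b}`. -/
noncomputable def lamE (i : ℕ × ℕ) : X := transE i + St (hermE i)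

lemma coeFn_hermE (i : ℕ × ℕ) : (hermE i : Plane → ℂ) =ᵐ[volume]
    fun x => ((Real.sqrt (hermSq i))⁻¹ : ℂ) * (herm i.1 i.2 x * G x) := by
  filter_upwards [smul_ae (((Real.sqrt (hermSq i))⁻¹ : ℝ) : ℂ) (hermX i),
    coeFn_mulG (herm i.1 i.2) (expGrowth_herm _ _) (continuous_herm _ _)] with x h1 h2
  rw [hermE, h1, hermX, h2]
  push_cast
  rfl

lemma coeFn_transE (i : ℕ × ℕ) : (transE i : Plane → ℂ) =ᵐ[volume] fun x =>
    ((Real.sqrt (hermSq i))⁻¹ : ℂ) *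
      (phiR ‖x‖ * (Complex.I * (i.1 - i.2) * herm i.1 i.2 x) * G x) := by
  have hs := volume_ac.ae_eq (Lp.coeFn_sub (Mz (dE i)) (Mzc (dcE i)))
  have h1 := coeFn_mulOp (fun x => Complex.I * (phiR ‖x‖ * zz x))
    (by have := zz.continuous.measurable; fun_prop) (fun x => by
      rw [norm_mul, Complex.norm_I, one_mul, norm_mul, Complex.norm_real,
        Real.norm_of_nonneg (phiR_nonneg _), norm_zz]
      exact phiR_mul_le_one (norm_nonneg x)) (dE i)
  have h2 := coeFn_mulOp (fun x => Complex.I * (phiR ‖x‖ * zc x))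
    (by have := zc.continuous.measurable; fun_prop) (fun x => by
      rw [norm_mul, Complex.norm_I, one_mul, norm_mul, Complex.norm_real,
        Real.norm_of_nonneg (phiR_nonneg _), norm_zc]
      exact phiR_mul_le_one (norm_nonneg x)) (dcE i)
  filter_upwards [hs, h1, h2,
    smul_ae ((Real.sqrt (hermSq i))⁻¹ * i.1 : ℂ) (hermX (i.1 - 1, i.2)),
    smul_ae ((Real.sqrt (hermSq i))⁻¹ * i.2 : ℂ) (hermX (i.1, i.2 - 1)),
    coeFn_mulG (herm (i.1 - 1) i.2) (expGrowth_herm _ _) (continuous_herm _ _),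
    coeFn_mulG (herm i.1 (i.2 - 1)) (expGrowth_herm _ _) (continuous_herm _ _)]
    with x h0 h1 h2 h3 h4 h5 h6
  rw [transE, h0, Pi.sub_apply, Mz, Mzc, h1, h2, dE_eq, dcE_eq, h3, h4, hermX, hermX, h5, h6]
  push_cast
  linear_combination ((Real.sqrt (hermSq i))⁻¹ : ℂ) * phiR ‖x‖ * Complex.I * G x *
    zz_herm_sub_zc_herm i.1 i.2 x

lemma integrable_phiR_mul {f : Plane → ℂ} (hf : Integrable f) :
    Integrable fun x => (phiR ‖x‖ : ℂ) * f x :=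
  hf.bdd_mul (c := 1) (by fun_prop : Measurable fun x : Plane =>
    (phiR ‖x‖ : ℂ)).aestronglyMeasurable (Eventually.of_forall fun x => by
      rw [Complex.norm_real, Real.norm_of_nonneg (phiR_nonneg _)]; exact phiR_le_one _)

/-- Integration by parts along the circles: `v^G·∇` is `Φ` times the angular derivative, and the
radial weight `Φ G` commutes with it. -/
lemma transE_test (i : ℕ × ℕ) {φ : Plane → ℝ} (h1 : ContDiff ℝ ∞ φ) (h2 : HasCompactSupport φ) :
    ∫ x, φ x • (transE i : Plane → ℂ) x =
      -∫ x, fderiv ℝ φ x (vG x) • (hermE i : Plane → ℂ) x := by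
  set p := herm i.1 i.2 with hp
  set c := ((Real.sqrt (hermSq i))⁻¹ : ℂ)
  have cp : ContDiff ℝ ∞ p := contDiff_herm _ _
  have h1' : ContDiff ℝ ∞ fun x => (φ x : ℂ) := Complex.ofRealCLM.contDiff.comp h1
  have h2' : HasCompactSupport fun x => (φ x : ℂ) :=
    h2.comp_left (g := fun t : ℝ => (t : ℂ)) Complex.ofReal_zero
  have cF : ContDiff ℝ ∞ fun x => (φ x : ℂ) * p x := h1'.mul cp
  have sF : HasCompactSupport fun x => (φ x : ℂ) * p x := h2'.mul_right
  have cD : Continuous fun x => fderiv ℝ (fun x => (φ x : ℂ) * p x) x (perp x) :=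
    (cF.continuous_fderiv (by simp)).clm_apply continuous_perp
  have sD : HasCompactSupport fun x => fderiv ℝ (fun x => (φ x : ℂ) * p x) x (perp x) := by
    refine (sF.fderiv (𝕜 := ℝ)).mono fun x hx => ?_
    contrapose! hx
    simp at hx
    simp [hx]
  have hG : Continuous fun x => (G x : ℂ) := Complex.continuous_ofReal.comp continuous_G
  have hi : Integrable fun x => ((phiR ‖x‖ * gR ‖x‖ : ℝ) : ℂ) *
      fderiv ℝ (fun x => (φ x : ℂ) * p x) x (perp x) := by
    refine (integrable_phiR_mul ((hG.mul cD).integrable_of_hasCompactSupport sD.mul_left)).congr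
      (Eventually.of_forall fun x => ?_)
    simp only [G_eq, Pi.mul_apply]
    push_cast
    ring
  have key := integral_radial_mul_fderiv_perp (cF.of_le (by norm_cast))
    (fun r => ((phiR r * gR r : ℝ) : ℂ)) hi
  have hfd : ∀ x, fderiv ℝ (fun x => (φ x : ℂ) * p x) x (perp x) =
      φ x * (Complex.I * (i.1 - i.2) * p x) + fderiv ℝ φ x (perp x) * p x := by
    intro x
    have := dirD_mul (perp x) h1' cp x
    unfold dirD at this
    rw [this, hp, fderiv_herm_perp]
    congr 2
    have := (Complex.ofRealCLM.hasFDerivAt.comp x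
      ((h1.differentiable (by simp) x).hasFDerivAt)).fderiv
    change fderiv ℝ (Complex.ofRealCLM ∘ φ) x (perp x) = _
    rw [this]; rfl
  have e1 : ∫ x, φ x • (transE i : Plane → ℂ) x =
      ∫ x, c * (phiR ‖x‖ * (G x * (φ x * (Complex.I * (i.1 - i.2) * p x)))) := by
    refine integral_congr_ae ?_
    filter_upwards [coeFn_transE i] with x hx
    rw [hx, Complex.real_smul]
    ring
  have e2 : ∫ x, fderiv ℝ φ x (vG x) • (hermE i : Plane → ℂ) x =
      ∫ x, c * (phiR ‖x‖ * (G x * (fderiv ℝ φ x (perp x) * p x))) := by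
    refine integral_congr_ae ?_
    filter_upwards [coeFn_hermE i] with x hx
    rw [hx, Complex.real_smul, vG_eq, map_smul, smul_eq_mul]
    push_cast
    ring
  have cDφ : Continuous fun x => (fderiv ℝ φ x (perp x) : ℂ) :=
    Complex.continuous_ofReal.comp ((h1.continuous_fderiv (by simp)).clm_apply continuous_perp)
  have sDφ : HasCompactSupport fun x => (fderiv ℝ φ x (perp x) : ℂ) :=
    (hasCompactSupport_fderiv_apply h2 perp).comp_left (g := fun t : ℝ => (t : ℂ))
      Complex.ofReal_zero
  have i1 : Integrable fun x => c * (phiR ‖x‖ * (G x * (φ x * (Complex.I * (i.1 - i.2) * p x)))) :=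
    (integrable_phiR_mul ((hG.mul (h1'.continuous.mul
      (continuous_const.mul cp.continuous))).integrable_of_hasCompactSupport
      h2'.mul_right.mul_left)).const_mul c
  have i2 : Integrable fun x => c * (phiR ‖x‖ * (G x * (fderiv ℝ φ x (perp x) * p x))) :=
    (integrable_phiR_mul ((hG.mul (cDφ.mul cp.continuous)).integrable_of_hasCompactSupport
      sDφ.mul_right.mul_left)).const_mul c
  rw [eq_neg_iff_add_eq_zero, e1, e2, ← integral_add i1 i2, ← mul_zero c, ← key,
    ← integral_const_mul]
  congr 1; ext x
  rw [hfd, G_eq]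
  push_cast
  ring

lemma hermE_mem_graphΛ (i : ℕ × ℕ) : (hermE i, lamE i) ∈ graphΛ := by
  intro φ h1 h2
  simp only
  rw [integral_stretch_eq, lamE, integral_smul_add _ _ _ (integrable_smul _ h1.continuous h2)
    (integrable_smul _ h1.continuous h2), transE_test i h1 h2]

lemma isClosed_graphΛ : IsClosed (graphΛ : Set (X × X)) := by
  refine isClosed_graph_of_tests graphΛ (fun φ p => (∫ x, φ x • p.2 x) -
    (-(∫ x, fderiv ℝ φ x (vG x) • p.1 x) + ∫ x, φ x • (St p.1 : Plane → ℂ) x))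
    (fun φ h1 h2 => ?_) (fun p => ?_)
  · have hc : Continuous (fderiv ℝ φ) := h1.continuous_fderiv (by simp)
    have hb : Continuous fun x => ‖fderiv ℝ φ x‖ * ‖x‖ := by fun_prop
    have hs : HasCompactSupport fun x => ‖fderiv ℝ φ x‖ * ‖x‖ :=
      ((h2.fderiv (𝕜 := ℝ)).norm).mul_right
    obtain ⟨C', hC'⟩ := hs.exists_bound_of_continuous hb
    have hm : Measurable fun x => fderiv ℝ φ x (vG x) :=
      (isBoundedBilinearMap_apply (𝕜 := ℝ) (E := Plane) (F := ℝ)).continuous.measurable.comp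
        (hc.measurable.prodMk measurable_vG)
    obtain ⟨C, hC⟩ := h2.exists_bound_of_continuous h1.continuous
    have c1 := continuous_integral_bdd_smul h1.continuous.aestronglyMeasurable C hC
    have c2 := continuous_integral_bdd_smul hm.aestronglyMeasurable C' fun x =>
      (((fderiv ℝ φ x).le_opNorm _).trans (mul_le_mul_of_nonneg_left (norm_vG_le x)
        (norm_nonneg _))).trans ((le_abs_self _).trans (hC' x))
    exact (c1.comp continuous_snd).sub (((c2.comp continuous_fst).neg).add
      (c1.comp (St.continuous.comp continuous_fst)))
  · simp only [sub_eq_zero, ← integral_stretch_eq]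
    exact Iff.rfl

lemma inner_hermE_transE (i j : ℕ × ℕ) :
    ⟪hermE i, transE j⟫_ℂ = -⟪transE i, hermE j⟫_ℂ := by
  set c : ℂ := ((Real.sqrt (hermSq i))⁻¹ : ℂ) * ((Real.sqrt (hermSq j))⁻¹ : ℂ) with hc
  have hG : ∀ x, (G x : ℂ) ≠ 0 := fun x => by exact_mod_cast (G_pos x).ne'
  have e1 : ⟪hermE i, transE j⟫_ℂ = ∫ x, c * (Complex.I * (j.1 - j.2)) *
      (phiR ‖x‖ * (herm i.2 i.1 x * herm j.1 j.2 x * G x)) := by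
    rw [inner_eq_integral]
    refine integral_congr_ae ?_
    filter_upwards [coeFn_hermE i, coeFn_transE j] with x h1 h2
    have := hG x
    rw [h1, h2]
    simp only [Complex.real_smul, map_mul, Complex.conj_ofReal, conj_herm, map_inv₀, hc]
    push_cast
    field_simp
  have e2 : ⟪transE i, hermE j⟫_ℂ = ∫ x, c * (Complex.I * (i.2 - i.1)) *
      (phiR ‖x‖ * (herm i.2 i.1 x * herm j.1 j.2 x * G x)) := by
    rw [inner_eq_integral]
    refine integral_congr_ae ?_
    filter_upwards [coeFn_transE i, coeFn_hermE j] with x h1 h2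
    have := hG x
    rw [h1, h2]
    simp only [Complex.real_smul, map_mul, Complex.conj_ofReal, conj_herm, map_inv₀, map_sub,
      map_natCast, Complex.conj_I, hc]
    push_cast
    field_simp
    ring
  have hF : ContDiff ℝ ∞ fun x => herm i.2 i.1 x * herm j.1 j.2 x :=
    (contDiff_herm _ _).mul (contDiff_herm _ _)
  have hfd : ∀ x, fderiv ℝ (fun x => herm i.2 i.1 x * herm j.1 j.2 x) x (perp x) =
      Complex.I * ((i.2 - i.1) + (j.1 - j.2)) * (herm i.2 i.1 x * herm j.1 j.2 x) := by
    intro x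
    have := dirD_mul (perp x) (contDiff_herm i.2 i.1) (contDiff_herm j.1 j.2) x
    unfold dirD at this
    rw [this, fderiv_herm_perp, fderiv_herm_perp]
    ring
  have hint := integrable_phiR_mul (integrable_herm_mul i.2 i.1 j.1 j.2)
  have key := integral_radial_mul_fderiv_perp (hF.of_le (by norm_cast))
    (fun r => ((phiR r * gR r : ℝ) : ℂ)) (by
      refine (hint.const_mul (Complex.I * ((i.2 - i.1) + (j.1 - j.2)))).congr
        (Eventually.of_forall fun x => ?_)
      simp only [hfd, G_eq]
      push_cast
      ring)
  rw [eq_neg_iff_add_eq_zero, e1, e2, ← integral_add (hint.const_mul _) (hint.const_mul _),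
    ← mul_zero c, ← key, ← integral_const_mul]
  congr 1; ext x
  rw [hfd, G_eq]
  push_cast
  ring

/-- `Λ` is skew-symmetric on the span of the Hermite functions. -/
lemma inner_hermE_lamE (i j : ℕ × ℕ) : ⟪hermE i, lamE j⟫_ℂ = -⟪lamE i, hermE j⟫_ℂ := by
  have hS : ⟪hermE i, St (hermE j)⟫_ℂ = -⟪St (hermE i), hermE j⟫_ℂ := by
    simp only [hermE, map_smul, inner_smul_left, inner_smul_right, hermX]
    rw [inner_mulG_St_mulG]
    ring
  rw [lamE, lamE, inner_add_left, inner_add_right, inner_hermE_transE, hS]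
  ring

/-! ### Form bound for `Λ` -/

lemma norm_sq_sum_of_orthogonal {ι : Type*} (s : Finset ι) (v : ι → X)
    (h : ∀ i j, i ≠ j → ⟪v i, v j⟫_ℂ = 0) (c : ι → ℂ) :
    ‖∑ i ∈ s, c i • v i‖ ^ 2 = ∑ i ∈ s, ‖c i‖ ^ 2 * ‖v i‖ ^ 2 := by
  classical
  induction s using Finset.induction_on with
  | empty => simp
  | insert a s ha ih =>
    rw [Finset.sum_insert ha, Finset.sum_insert ha, ← ih, pow_two,
      norm_add_sq_eq_norm_sq_add_norm_sq_of_inner_eq_zero (𝕜 := ℂ), norm_smul]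
    · ring
    · rw [inner_sum]
      refine Finset.sum_eq_zero fun j hj => ?_
      rw [inner_smul_left, inner_smul_right, h a j (by rintro rfl; exact ha hj)]
      simp

lemma norm_hermE (i : ℕ × ℕ) : ‖hermE i‖ = 1 := orthonormal_hermE.1 i

lemma inner_hermE_of_ne {i j : ℕ × ℕ} (h : i ≠ j) : ⟪hermE i, hermE j⟫_ℂ = 0 :=
  orthonormal_hermE.2 h

lemma norm_sq_dE (i : ℕ × ℕ) : ‖dE i‖ ^ 2 = i.1 / 4 := by
  rw [dE, norm_smul, norm_hermE, mul_one, Complex.norm_real, Real.norm_of_nonneg (by positivity),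
    div_pow, Real.sq_sqrt (Nat.cast_nonneg _)]
  norm_num

lemma norm_sq_dcE (i : ℕ × ℕ) : ‖dcE i‖ ^ 2 = i.2 / 4 := by
  rw [dcE, norm_smul, norm_hermE, mul_one, Complex.norm_real, Real.norm_of_nonneg (by positivity),
    div_pow, Real.sq_sqrt (Nat.cast_nonneg _)]
  norm_num

lemma inner_dE_of_ne {i j : ℕ × ℕ} (h : i ≠ j) : ⟪dE i, dE j⟫_ℂ = 0 := by
  obtain ⟨a, b⟩ := i
  obtain ⟨c, d⟩ := j
  rw [dE, dE, inner_smul_left, inner_smul_right]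
  rcases a with _ | a
  · simp
  rcases c with _ | c
  · simp
  rw [inner_hermE_of_ne]
  · simp
  · simp only [ne_eq, Prod.mk.injEq] at h ⊢
    omega

lemma inner_dcE_of_ne {i j : ℕ × ℕ} (h : i ≠ j) : ⟪dcE i, dcE j⟫_ℂ = 0 := by
  obtain ⟨a, b⟩ := i
  obtain ⟨c, d⟩ := j
  rw [dcE, dcE, inner_smul_left, inner_smul_right]
  rcases b with _ | b
  · simp
  rcases d with _ | d
  · simp
  rw [inner_hermE_of_ne]
  · simp
  · simp only [ne_eq, Prod.mk.injEq] at h ⊢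
    omega

/-- The constant in the bound of `Λ` by the quadratic form of `1 - L`. -/
noncomputable def lamC : ℝ := 3 * (1 + ‖St‖ ^ 2)

lemma lev_nonneg (i : ℕ × ℕ) : 0 ≤ lev i := by unfold lev; positivity

/-- `Λ` is bounded by the form of `1 - L`, because `v^G·∇(G p) = G v^G·∇p`. -/
lemma norm_sq_sum_lamE_le (s : Finset (ℕ × ℕ)) (c : ℕ × ℕ → ℂ) :
    ‖∑ i ∈ s, c i • lamE i‖ ^ 2 ≤ lamC * ∑ i ∈ s, (1 + lev i) * ‖c i‖ ^ 2 := by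
  have e : ∑ i ∈ s, c i • lamE i = Mz (∑ i ∈ s, c i • dE i) - Mzc (∑ i ∈ s, c i • dcE i) +
      St (∑ i ∈ s, c i • hermE i) := by
    simp only [map_sum, map_smul, lamE, transE, smul_add, smul_sub, Finset.sum_add_distrib,
      Finset.sum_sub_distrib]
  have n1 := norm_mulOp_le _ _ _ (∑ i ∈ s, c i • dE i) |>.trans_eq' (show ‖Mz _‖ = _ from rfl)
  have n2 := norm_mulOp_le _ _ _ (∑ i ∈ s, c i • dcE i) |>.trans_eq' (show ‖Mzc _‖ = _ from rfl)
  have n3 := St.le_opNorm (∑ i ∈ s, c i • hermE i)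
  have q1 := norm_sq_sum_of_orthogonal s dE (fun i j => inner_dE_of_ne) c
  have q2 := norm_sq_sum_of_orthogonal s dcE (fun i j => inner_dcE_of_ne) c
  have q3 := norm_sq_sum_of_orthogonal s hermE (fun i j => inner_hermE_of_ne) c
  simp only [norm_sq_dE, norm_sq_dcE, norm_hermE] at q1 q2 q3
  have hn : ‖∑ i ∈ s, c i • lamE i‖ ≤ ‖∑ i ∈ s, c i • dE i‖ + ‖∑ i ∈ s, c i • dcE i‖ +
      ‖St‖ * ‖∑ i ∈ s, c i • hermE i‖ := by
    rw [e]
    refine (norm_add_le _ _).trans (add_le_add ((norm_sub_le _ _).trans (add_le_add n1 n2)) n3)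
  have h0 : 0 ≤ ∑ i ∈ s, lev i * ‖c i‖ ^ 2 :=
    Finset.sum_nonneg fun i _ => mul_nonneg (lev_nonneg i) (by positivity)
  have h1 : 0 ≤ ∑ i ∈ s, ‖c i‖ ^ 2 := Finset.sum_nonneg fun i _ => by positivity
  have q12 : ‖∑ i ∈ s, c i • dE i‖ ^ 2 + ‖∑ i ∈ s, c i • dcE i‖ ^ 2 =
      (∑ i ∈ s, lev i * ‖c i‖ ^ 2) / 2 := by
    rw [q1, q2, ← Finset.sum_add_distrib, Finset.sum_div]
    refine Finset.sum_congr rfl fun i _ => ?_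
    unfold lev; ring
  have q3' : ‖∑ i ∈ s, c i • hermE i‖ ^ 2 = ∑ i ∈ s, ‖c i‖ ^ 2 := by simpa using q3
  have hsum : ∑ i ∈ s, (1 + lev i) * ‖c i‖ ^ 2 =
      (∑ i ∈ s, ‖c i‖ ^ 2) + ∑ i ∈ s, lev i * ‖c i‖ ^ 2 := by
    rw [← Finset.sum_add_distrib]
    exact Finset.sum_congr rfl fun i _ => by ring
  rw [hsum, lamC]
  set A := ‖∑ i ∈ s, c i • dE i‖
  set B := ‖∑ i ∈ s, c i • dcE i‖
  set D := ‖∑ i ∈ s, c i • hermE i‖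
  have hsq := pow_le_pow_left₀ (norm_nonneg _) hn 2
  have hD : (‖St‖ * D) ^ 2 = ‖St‖ ^ 2 * ∑ i ∈ s, ‖c i‖ ^ 2 := by rw [mul_pow, q3']
  have hcs : (A + B + ‖St‖ * D) ^ 2 ≤ 3 * (A ^ 2 + B ^ 2 + (‖St‖ * D) ^ 2) := by
    nlinarith [sq_nonneg (A - B), sq_nonneg (A - ‖St‖ * D), sq_nonneg (B - ‖St‖ * D)]
  have hS : 0 ≤ ‖St‖ ^ 2 := by positivity
  have := mul_nonneg hS h0
  nlinarith

/-! ### Action of the kernel on angular modes -/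

lemma zz_injective : Function.Injective zz :=
  Complex.orthonormalBasisOneI.repr.symm.injective

lemma pt_norm_arg (x : Plane) : pt (‖x‖, (zz x).arg) = x := by
  apply zz_injective
  rw [zz_pt, ← norm_zz]
  exact Complex.norm_mul_exp_arg_mul_I (zz x)

/-- In polar coordinates `H_{a,b}` is a radial factor times `e^{i(a-b)θ}`. -/
lemma herm_pt (a b : ℕ) (r θ : ℝ) :
    herm a b (pt (r, θ)) = herm a b (pt (r, 0)) * Complex.exp ((a - b) * θ * Complex.I) := by
  induction a generalizing b with
  | zero =>
    simp only [herm_zero, zc_apply, zz_pt, map_mul, Complex.conj_ofReal, ← Complex.exp_conj]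
    rw [mul_pow, mul_pow, ← Complex.exp_nat_mul]
    simp
    left
    congr 1
    ring
  | succ a ih =>
    rw [herm_succ, herm_succ, ih, ih (b - 1)]
    rcases b with _ | b
    · simp only [zz_pt, Nat.cast_zero, mul_zero, zero_mul, sub_zero]
      push_cast
      rw [show ((a : ℂ) + 1) * θ * Complex.I = a * θ * Complex.I + θ * Complex.I by ring,
        Complex.exp_add]
      simp
      ring
    · simp only [zz_pt, Nat.add_sub_cancel]
      push_cast
      rw [show ((a : ℂ) + 1 - (b + 1)) * θ * Complex.I = (a - b) * θ * Complex.I by ring,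
        show ((a : ℂ) - (b + 1)) * θ * Complex.I = (a - b) * θ * Complex.I - θ * Complex.I by ring,
        Complex.exp_sub]
      have := Complex.exp_ne_zero (θ * Complex.I)
      simp
      field_simp

/-- For bounded integrable `u`, the kernel integral converges absolutely at every point. -/
lemma integrable_kap_of_bdd {u : Plane → ℂ} (hu : Integrable u) {M : ℝ} (hM : ∀ x, ‖u x‖ ≤ M)
    (x : Plane) : Integrable fun y => (kap x y : ℂ) * u y := by
  have hk : Measurable fun y => (kap x y : ℂ) :=
    Complex.measurable_ofReal.comp (measurable_kap.comp (measurable_const.prodMk measurable_id))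
  refine ⟨hk.aestronglyMeasurable.mul hu.1, ?_⟩
  unfold HasFiniteIntegral
  calc ∫⁻ y, ‖(kap x y : ℂ) * u y‖ₑ
      ≤ ∫⁻ y, ENNReal.ofReal ‖x‖ * (invN (x - y) * ‖u y‖ₑ) := by
        refine lintegral_mono fun y => ?_
        simp only
        rw [enorm_mul, ← mul_assoc]
        refine mul_le_mul_left ?_ _
        rw [invN, ← ENNReal.ofReal_mul (norm_nonneg _), ← ofReal_norm, Complex.norm_real,
          Real.norm_eq_abs]
        exact ENNReal.ofReal_le_ofReal (abs_kap_le x y)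
    _ = ENNReal.ofReal ‖x‖ * ∫⁻ y, invN (x - y) * ‖u y‖ₑ :=
        lintegral_const_mul' _ _ ENNReal.ofReal_ne_top
    _ ≤ ENNReal.ofReal ‖x‖ * (invC * (ENNReal.ofReal M + ∫⁻ y, ‖u y‖ₑ)) := by
        refine mul_le_mul_right (lintegral_invN_mul_le (Eventually.of_forall fun y => ?_)
          (le_add_left le_rfl) x) _
        refine le_add_right ?_
        rw [← ofReal_norm]
        exact ENNReal.ofReal_le_ofReal (hM y)
    _ < ⊤ := ENNReal.mul_lt_top ENNReal.ofReal_lt_top (ENNReal.mul_lt_top invC_lt_top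
        (ENNReal.add_lt_top.2 ⟨ENNReal.ofReal_lt_top, hu.hasFiniteIntegral⟩))

/-- The action of `kapInt` on a function with a single angular mode. -/
lemma kapInt_mode {u : Plane → ℂ} (hu : Integrable u) {M : ℝ} (hM : ∀ x, ‖u x‖ ≤ M)
    {f : ℝ → ℂ} {k : ℕ}
    (hf : ∀ r θ, 0 < r → u (pt (r, θ)) = f r * Complex.exp (k * θ * Complex.I))
    {s : ℝ} (hs : 0 < s) (t : ℝ) :
    kapInt u (pt (s, t)) = if k = 0 then 0 else
      Complex.I / 2 * Complex.exp (k * t * Complex.I) * ∫ r, f r * (rat s r : ℂ) ^ k ∂radM := by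
  rw [kapInt, integral_polar (integrable_kap_of_bdd hu hM _)]
  have key : ∀ᵐ r ∂radM, ∫ θ, (kap (pt (s, t)) (pt (r, θ)) : ℂ) * u (pt (r, θ)) ∂angM =
      if k = 0 then 0 else
        Complex.I / 2 * Complex.exp (k * t * Complex.I) * (f r * (rat s r : ℂ) ^ k) := by
    filter_upwards [ae_radM_pos, ae_radM_ne s] with r hr hrs
    have e : (fun θ => (kap (pt (s, t)) (pt (r, θ)) : ℂ) * u (pt (r, θ))) = fun θ =>
        f r * ((kap (pt (s, t)) (pt (r, θ)) : ℂ) * Complex.exp (k * θ * Complex.I)) := by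
      ext θ; rw [hf r θ hr]; ring
    rw [e, integral_const_mul, integral_kap_mode hs hr hrs]
    split_ifs
    · simp
    · ring
  rw [integral_congr_ae key]
  split_ifs
  · simp
  · rw [integral_const_mul]

/-! ### Explicit elements of the kernel of `Λ` -/

lemma integral_radM (f : ℝ → ℝ) : ∫ r, f r ∂radM = ∫ r in Set.Ioi 0, r * f r := by
  unfold radM
  rw [integral_withDensity_eq_integral_toReal_smul (by fun_prop) (by simp)]
  refine setIntegral_congr_fun measurableSet_Ioi fun r hr => ?_
  rw [ENNReal.toReal_ofReal (le_of_lt hr), smul_eq_mul]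

lemma gR_pos (r : ℝ) : 0 < gR r := by unfold gR; positivity

@[fun_prop]
lemma continuous_gR : Continuous gR := by unfold gR; fun_prop

lemma hasDerivAt_gR (r : ℝ) : HasDerivAt gR (-(r / 2) * gR r) r := by
  have h : HasDerivAt (fun r : ℝ => -r ^ 2 / 4) (-(r / 2)) r := by
    have := ((hasDerivAt_pow 2 r).neg).div_const 4
    convert! this using 1
    simp; ring
  have := (h.exp).const_mul (4 * Real.pi)⁻¹
  convert! this using 1
  unfold gR; ring

/-- The radial function `r gR(r)`, the profile of `∂G` up to a constant. -/
noncomputable def pR (r : ℝ) : ℝ := r * gR r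

lemma hasDerivAt_primitive_one (r : ℝ) : HasDerivAt (fun r => -2 * gR r) (r * gR r) r := by
  have := (hasDerivAt_gR r).const_mul (-2)
  convert! this using 1
  ring

lemma hasDerivAt_primitive_three (r : ℝ) :
    HasDerivAt (fun r => -(2 * r ^ 2 + 8) * gR r) (r ^ 3 * gR r) r := by
  have h : HasDerivAt (fun r : ℝ => -(2 * r ^ 2 + 8)) (-(2 * (2 * r))) r := by
    have := (((hasDerivAt_pow 2 r).const_mul 2).add_const 8).neg
    convert! this using 1
    simp
  have := h.mul (hasDerivAt_gR r)
  convert! this using 1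
  ring

lemma tendsto_gR : Tendsto gR atTop (𝓝 0) := by
  have h : Tendsto (fun r : ℝ => -r ^ 2 / 4) atTop atBot := by
    have h2 : Tendsto (fun r : ℝ => r ^ 2 / 4) atTop atTop :=
      (tendsto_pow_atTop (by norm_num)).atTop_div_const (by norm_num)
    refine (tendsto_neg_atTop_atBot.comp h2).congr fun r => ?_
    simp; ring
  have := (Real.tendsto_exp_atBot.comp h).const_mul (4 * Real.pi)⁻¹
  have e : gR = fun r => (4 * Real.pi)⁻¹ * Real.exp (-r ^ 2 / 4) := rfl
  rw [e]
  simpa [Function.comp_def] using this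

lemma integrable_radial {f : ℝ → ℝ} (hf : Integrable (fun x : Plane => (f ‖x‖ : ℂ))) :
    Integrable f radM := by
  have h := (integrable_comp_pt hf).integral_prod_left
  have e : (fun r => ∫ θ, ((f ‖pt (r, θ)‖ : ℝ) : ℂ) ∂angM) =ᵐ[radM] fun r =>
      ((2 * Real.pi * f r : ℝ) : ℂ) := by
    filter_upwards [ae_radM_pos] with r hr
    simp only [norm_pt, abs_of_pos hr]
    rw [integral_const]
    simp [angM, Measure.real]
    left
    rw [ENNReal.toReal_ofReal (by linarith [Real.pi_pos])]
    push_cast; ring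
  have h2 : Integrable (fun r => 2 * Real.pi * f r) radM := by
    simpa using (h.congr e).re
  have h3 := h2.const_mul (2 * Real.pi)⁻¹
  refine h3.congr (Eventually.of_forall fun r => ?_)
  have := Real.pi_ne_zero
  simp only
  field_simp

lemma integrable_pR : Integrable pR radM := by
  refine integrable_radial ?_
  have h : ExpGrowth fun x : Plane => (‖x‖ : ℂ) :=
    (expGrowth_clm zz).mono 1 zero_le_one (by simp [norm_zz])
  refine (h.integrable_mul_G (by fun_prop)).congr (Eventually.of_forall fun x => ?_)
  simp [pR, G_eq]

lemma integrable_pR_mul_rat {s : ℝ} (hs : 0 < s) :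
    Integrable (fun r => pR r * rat s r) radM := by
  refine integrable_pR.mul_bdd (c := 1)
    (measurable_rat.comp (measurable_const.prodMk measurable_id)).aestronglyMeasurable ?_
  filter_upwards [ae_radM_pos] with r hr
  rw [Real.norm_of_nonneg (rat_pos hs hr).le]
  exact rat_le_one hs

/-- The explicit velocity field generated by `∂G`: this identity expresses both that `∂_i G` lies
in the kernel of `Λ` and that `r gR(r)` is the positive eigenfunction of the radial problem. -/
lemma integral_pR_mul_rat {s : ℝ} (hs : 0 < s) :
    ∫ r, pR r * rat s r ∂radM = 4 * (s * phiR s) := by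
  have hi := integrable_pR_mul_rat hs
  have hi2 : IntegrableOn (fun r => r * (pR r * rat s r)) (Set.Ioi 0) := by
    unfold radM at hi
    rw [integrable_withDensity_iff_integrable_smul' (by fun_prop) (by simp)] at hi
    refine IntegrableOn.congr_fun hi (fun r hr => ?_) measurableSet_Ioi
    rw [ENNReal.toReal_ofReal (le_of_lt hr), smul_eq_mul]
  rw [integral_radM, ← Set.Ioc_union_Ioi_eq_Ioi hs.le,
    setIntegral_union (Set.Ioc_disjoint_Ioi le_rfl) measurableSet_Ioi
      (hi2.mono_set Set.Ioc_subset_Ioi_self) (hi2.mono_set (Set.Ioi_subset_Ioi hs.le))]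
  -- `rat s r` is `r / s` on `(0, s]` and `s / r` beyond
  have e1 : ∫ r in Set.Ioc 0 s, r * (pR r * rat s r) = s⁻¹ * ∫ r in Set.Ioc 0 s, r ^ 3 * gR r := by
    rw [← integral_const_mul]
    refine setIntegral_congr_fun measurableSet_Ioc fun r hr => ?_
    simp only [pR, rat, max_eq_left hr.2, min_eq_right hr.2]
    field_simp
  have e2 : ∫ r in Set.Ioi s, r * (pR r * rat s r) = s * ∫ r in Set.Ioi s, r * gR r := by
    rw [← integral_const_mul]
    refine setIntegral_congr_fun measurableSet_Ioi fun r hr => ?_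
    have hr0 : 0 < r := hs.trans hr
    simp only [pR, rat, max_eq_right (le_of_lt hr : s ≤ r), min_eq_left (le_of_lt hr : s ≤ r)]
    field_simp
  have e3 : ∫ r in Set.Ioc 0 s, r ^ 3 * gR r = -(2 * s ^ 2 + 8) * gR s + 8 * gR 0 := by
    rw [← intervalIntegral.integral_of_le hs.le,
      intervalIntegral.integral_eq_sub_of_hasDerivAt (fun r _ => hasDerivAt_primitive_three r)
        ((by fun_prop : Continuous fun r => r ^ 3 * gR r).intervalIntegrable _ _)]
    ring
  have e4 : ∫ r in Set.Ioi s, r * gR r = 2 * gR s := by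
    have hlim : Tendsto (fun r => -2 * gR r) atTop (𝓝 0) := by simpa using tendsto_gR.const_mul (-2)
    rw [integral_Ioi_of_hasDerivAt_of_nonneg' (fun r _ => hasDerivAt_primitive_one r)
      (fun r hr => mul_nonneg (hs.trans hr).le (gR_pos r).le) hlim]
    ring
  rw [e1, e2, e3, e4]
  unfold phiR gR
  have := Real.pi_ne_zero
  field_simp
  simp
  ring

lemma kapInt_congr {u v : Plane → ℂ} (h : u =ᵐ[volume] v) : kapInt u = kapInt v := by
  ext x
  refine integral_congr_ae ?_
  filter_upwards [h] with y hy
  rw [hy]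

lemma kapInt_const_mul (c : ℂ) (u : Plane → ℂ) (x : Plane) :
    kapInt (fun x => c * u x) x = c * kapInt u x := by
  rw [kapInt, kapInt, ← integral_const_mul]
  congr 1; ext y; ring

lemma kapInt_conj (u : Plane → ℂ) (x : Plane) :
    kapInt (fun x => conj (u x)) x = conj (kapInt u x) := by
  rw [kapInt, kapInt, ← integral_conj]
  congr 1; ext y; simp

lemma ae_ne_zero : ∀ᵐ x : Plane, x ≠ 0 := by simp [ae_iff]

lemma coeFn_lamE (i : ℕ × ℕ) : (lamE i : Plane → ℂ) =ᵐ[volume] fun x =>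
    ((Real.sqrt (hermSq i))⁻¹ : ℂ) * G x *
      (phiR ‖x‖ * (Complex.I * (i.1 - i.2) * herm i.1 i.2 x) -
        kapInt (fun x => herm i.1 i.2 x * G x) x / 2) := by
  filter_upwards [add_ae (transE i) (St (hermE i)), coeFn_transE i, coeFn_St' (hermE i)]
    with x h1 h2 h3
  rw [lamE, h1, h2, h3, kapInt_congr (coeFn_hermE i), kapInt_const_mul]
  push_cast
  ring

/-- `Λ e_{a,b} = 0` when the nonlocal term cancels the transport term pointwise. -/
lemma lamE_eq_zero_of {i : ℕ × ℕ} (h : ∀ s t, 0 < s →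
    kapInt (fun x => herm i.1 i.2 x * G x) (pt (s, t)) =
      2 * (phiR s * (Complex.I * (i.1 - i.2) * herm i.1 i.2 (pt (s, t))))) : lamE i = 0 := by
  refine (Lp.eq_zero_iff_ae_eq_zero).2 (weight_ac.ae_le ?_)
  filter_upwards [coeFn_lamE i, ae_ne_zero] with x hx h0
  have hs : 0 < ‖x‖ := norm_pos_iff.2 h0
  have := h ‖x‖ (zz x).arg hs
  rw [pt_norm_arg] at this
  rw [hx, this]
  simp

/-- Radial functions are in the kernel of `Λ`. -/
lemma lamE_diag (a : ℕ) : lamE (a, a) = 0 := by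
  refine lamE_eq_zero_of fun s t hs => ?_
  obtain ⟨M, hM⟩ := (expGrowth_herm a a).bdd_mul_G
  have := kapInt_mode ((expGrowth_herm a a).integrable_mul_G
    (continuous_herm a a).aestronglyMeasurable) hM (k := 0)
    (f := fun r => herm a a (pt (r, 0)) * G (pt (r, 0))) (fun r θ hr => by
      rw [herm_pt, G_eq, G_eq, norm_pt, norm_pt]; simp) hs t
  simp [this]

lemma kapInt_zz_G {s : ℝ} (hs : 0 < s) (t : ℝ) :
    kapInt (fun x => herm 1 0 x * G x) (pt (s, t)) =
      2 * (phiR s * (Complex.I * zz (pt (s, t)))) := by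
  obtain ⟨M, hM⟩ := (expGrowth_herm 1 0).bdd_mul_G
  have := kapInt_mode ((expGrowth_herm 1 0).integrable_mul_G
    (continuous_herm 1 0).aestronglyMeasurable) hM (k := 1)
    (f := fun r => (pR r : ℂ)) (fun r θ hr => by
      rw [herm_succ, herm_zero, G_eq, norm_pt, zz_pt, abs_of_pos hr, pR]
      simp
      ring) hs t
  have e : ∫ r, (pR r : ℂ) * (rat s r : ℂ) ^ 1 ∂radM = ((4 * (s * phiR s) : ℝ) : ℂ) := by
    rw [← integral_pR_mul_rat hs, ← integral_complex_ofReal]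
    congr 1; ext r; simp
  rw [this, if_neg one_ne_zero, e, zz_pt]
  push_cast
  simp only [one_mul]
  ring

lemma lamE_one_zero : lamE (1, 0) = 0 := by
  refine lamE_eq_zero_of fun s t hs => ?_
  rw [kapInt_zz_G hs]
  simp [herm_succ, herm_zero]

lemma lamE_zero_one : lamE (0, 1) = 0 := by
  refine lamE_eq_zero_of fun s t hs => ?_
  have e : (fun x => herm (0, 1).1 (0, 1).2 x * (G x : ℂ)) =
      fun x => conj (herm 1 0 x * G x) := by
    ext x; simp [conj_herm]
  rw [e, kapInt_conj, kapInt_zz_G hs]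
  have h4 : conj (2 : ℂ) = 2 := Complex.conj_ofNat 2
  simp [herm_zero, zc_apply, h4]

/-! ### Radial equations for elements of the kernel of `Λ` -/

/-- The integral of `u` against `e^{ikθ}` over the circle of radius `r`. Since the exponential is
not conjugated, for `k > 0` this sees the component of `u` of angular mode `-k`. -/
noncomputable def modeInt (u : Plane → ℂ) (k : ℕ) (r : ℝ) : ℂ :=
  ∫ θ, Complex.exp (k * θ * Complex.I) * u (pt (r, θ)) ∂angM

lemma norm_exp_mode (k : ℕ) (θ : ℝ) : ‖Complex.exp (k * θ * Complex.I)‖ = 1 := by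
  rw [← Complex.norm_exp_ofReal_mul_I (k * θ)]
  push_cast
  rfl

lemma integrable_modeInt {u : Plane → ℂ} (hu : Integrable u) (k : ℕ) :
    Integrable (modeInt u k) radM := by
  have h : Integrable (fun p : ℝ × ℝ => Complex.exp (k * p.2 * Complex.I) * u (pt p))
      (radM.prod angM) :=
    (integrable_comp_pt hu).bdd_mul (c := 1)
      (by fun_prop : Continuous fun p : ℝ × ℝ =>
        Complex.exp (k * p.2 * Complex.I)).aestronglyMeasurable
      (Eventually.of_forall fun p => (norm_exp_mode k p.2).le)
  exact h.integral_prod_left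

lemma integral_mul_mode {u φ : Plane → ℂ} (h : Integrable fun x => φ x * u x) {k : ℕ} {f : ℝ → ℂ}
    (hφ : ∀ r θ, 0 < r → φ (pt (r, θ)) = f r * Complex.exp (k * θ * Complex.I)) :
    ∫ x, φ x * u x = ∫ r, f r * modeInt u k r ∂radM := by
  rw [integral_polar h]
  refine integral_congr_ae ?_
  filter_upwards [ae_radM_pos] with r hr
  rw [modeInt, ← integral_const_mul]
  congr 1; ext θ
  rw [hφ r θ hr]; ring

/-- The equation `Λ u = 0` in the sense of distributions, with complex test functions. -/
def KerEq (u : Plane → ℂ) : Prop :=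
  ∀ φ : Plane → ℂ, ContDiff ℝ ∞ φ → HasCompactSupport φ →
    ∫ x, fderiv ℝ φ x (vG x) * u x = -∫ x, φ x * (G x / 2) * kapInt u x

lemma KerEq.conj {u : Plane → ℂ} (h : KerEq u) : KerEq fun x => conj (u x) := by
  intro φ h1 h2
  have h1' : ContDiff ℝ ∞ fun x => conj (φ x) := Complex.conjCLE.contDiff.comp h1
  have h2' : HasCompactSupport fun x => conj (φ x) :=
    h2.comp_left (g := fun z : ℂ => conj z) (map_zero _)
  have hd : ∀ x v, fderiv ℝ (fun x => conj (φ x)) x v = conj (fderiv ℝ φ x v) := by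
    intro x v
    have := ((Complex.conjCLE : ℂ →L[ℝ] ℂ).hasFDerivAt.comp x
      ((h1.differentiable (by simp) x).hasFDerivAt)).fderiv
    change fderiv ℝ ((Complex.conjCLE : ℂ →L[ℝ] ℂ) ∘ φ) x v = _
    rw [this]; rfl
  have key := congrArg conj (h _ h1' h2')
  rw [map_neg, ← integral_conj, ← integral_conj] at key
  have h4 : conj (2 : ℂ) = 2 := Complex.conj_ofNat 2
  simpa [hd, kapInt_conj, h4] using key

lemma kerEq_of_mem_graphΛ {u : X} (h : (u, (0 : X)) ∈ graphΛ) : KerEq u := by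
  intro φ h1 h2
  have hl : ∀ (l : ℂ →L[ℝ] ℝ) , ContDiff ℝ ∞ (fun x => l (φ x)) ∧
      HasCompactSupport (fun x => l (φ x)) ∧
      ∀ x v, fderiv ℝ (fun x => l (φ x)) x v = l (fderiv ℝ φ x v) := by
    intro l
    refine ⟨l.contDiff.comp h1, h2.comp_left (g := l) (map_zero l), fun x v => ?_⟩
    have := (l.hasFDerivAt.comp x ((h1.differentiable (by simp) x).hasFDerivAt)).fderiv
    change fderiv ℝ (l ∘ φ) x v = _
    rw [this]; rfl
  have real : ∀ ψ : Plane → ℝ, ContDiff ℝ ∞ ψ → HasCompactSupport ψ →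
      ∫ x, fderiv ℝ ψ x (vG x) • u x = ∫ x, ψ x • stretch u x := by
    intro ψ h1 h2
    have := h ψ h1 h2
    simp only [integral_smul_zero] at this
    linear_combination this
  obtain ⟨r1, r2, r3⟩ := hl Complex.reCLM
  obtain ⟨i1, i2, i3⟩ := hl Complex.imCLM
  have hr := real _ r1 r2
  have hi := real _ i1 i2
  have e1 : ∫ x, fderiv ℝ φ x (vG x) * u x = (∫ x, fderiv ℝ (fun x => Complex.reCLM (φ x)) x
      (vG x) • u x) + Complex.I * ∫ x, fderiv ℝ (fun x => Complex.imCLM (φ x)) x (vG x) • u x := by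
    rw [← integral_const_mul, ← integral_add (integrable_fderiv_vG u r1 r2)
      ((integrable_fderiv_vG u i1 i2).const_mul _)]
    congr 1; ext x
    rw [r3, i3]
    conv_lhs => rw [← Complex.re_add_im (fderiv ℝ φ x (vG x))]
    simp only [Complex.real_smul, Complex.reCLM_apply, Complex.imCLM_apply]
    ring
  rw [e1, hr, hi, ← integral_const_mul, ← integral_add (integrable_smul_stretch u r1.continuous r2)
      ((integrable_smul_stretch u i1.continuous i2).const_mul _), ← integral_neg]
  refine integral_congr_ae ?_
  filter_upwards [stretch_ae u] with x hx
  rw [hx]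
  conv_rhs => rw [← Complex.re_add_im (φ x)]
  simp only [Complex.real_smul, Complex.reCLM_apply, Complex.imCLM_apply]
  push_cast
  ring

section RadialTest

variable {F : ℝ → ℝ}

lemma contDiff_comp_norm (h1 : ContDiff ℝ ∞ F) (h3 : tsupport F ⊆ Set.Ioi 0) :
    ContDiff ℝ ∞ fun x : Plane => F ‖x‖ := by
  rw [contDiff_iff_contDiffAt]
  intro x
  by_cases hx : x = 0
  · have h0 : F =ᶠ[𝓝 0] 0 := notMem_tsupport_iff_eventuallyEq.1 fun h => by simpa using h3 h
    have ht : Tendsto (fun x : Plane => ‖x‖) (𝓝 x) (𝓝 0) := by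
      have := (continuous_norm (E := Plane)).tendsto x
      rwa [hx, norm_zero, ← hx] at this
    refine (contDiffAt_const (c := (0 : ℝ))).congr_of_eventuallyEq ?_
    exact ht.eventually h0
  · exact h1.contDiffAt.comp x (contDiffAt_norm ℝ hx)

lemma hasCompactSupport_comp_norm (h2 : HasCompactSupport F) :
    HasCompactSupport fun x : Plane => F ‖x‖ := by
  obtain ⟨R, hR⟩ := h2.isCompact.isBounded.subset_closedBall 0
  refine HasCompactSupport.intro (isCompact_closedBall (0 : Plane) R) fun x hx => ?_
  refine image_eq_zero_of_notMem_tsupport fun h => hx ?_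
  simpa using hR h

end RadialTest

lemma rat_pow_le_one {s r : ℝ} (hs : 0 < s) (hr : 0 < r) (k : ℕ) : rat s r ^ k ≤ 1 :=
  pow_le_one₀ (rat_pos hs hr).le (rat_le_one hs)

lemma ae_prod_radM_pos : ∀ᵐ p ∂(radM.prod radM), 0 < p.1 ∧ 0 < p.2 := by
  have h1 := Measure.quasiMeasurePreserving_fst (μ := radM) (ν := radM) |>.ae ae_radM_pos
  have h2 := Measure.quasiMeasurePreserving_snd (μ := radM) (ν := radM) |>.ae ae_radM_pos
  filter_upwards [h1, h2] with p a b using ⟨a, b⟩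

/-- Double integrals against powers of `rat` converge absolutely. -/
lemma integrable_rat_mul {f m : ℝ → ℂ} (hf : Integrable f radM) (hm : Integrable m radM) (k : ℕ) :
    Integrable (fun p : ℝ × ℝ => (rat p.1 p.2 : ℂ) ^ k * (f p.1 * m p.2)) (radM.prod radM) := by
  refine (hf.mul_prod hm).bdd_mul (c := 1)
    ((Complex.measurable_ofReal.comp measurable_rat).pow_const k).aestronglyMeasurable ?_
  filter_upwards [ae_prod_radM_pos] with p hp
  rw [norm_pow, Complex.norm_real, Real.norm_of_nonneg (rat_pos hp.1 hp.2).le]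
  exact rat_pow_le_one hp.1 hp.2 k

lemma integrable_gR : Integrable gR radM :=
  integrable_radial (integrable_G.congr (Eventually.of_forall fun x => by simp [G_eq]))

/-- Testing in radial variables. -/
lemma radM_ae_eq_zero {h : ℝ → ℂ} (hh : Integrable h radM) (k : ℕ)
    (ht : ∀ F : ℝ → ℝ, ContDiff ℝ ∞ F → HasCompactSupport F → tsupport F ⊆ Set.Ioi 0 →
      ∫ r, (F r * r ^ k : ℂ) * h r ∂radM = 0) : ∀ᵐ r ∂radM, h r = 0 := by
  have hi : IntegrableOn (fun r : ℝ => r • h r) (Set.Ioi 0) := by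
    unfold radM at hh
    rw [integrable_withDensity_iff_integrable_smul' (by fun_prop) (by simp)] at hh
    refine IntegrableOn.congr_fun hh (fun r hr => ?_) measurableSet_Ioi
    rw [ENNReal.toReal_ofReal (le_of_lt hr)]
  have hl : LocallyIntegrableOn (fun r : ℝ => ((r : ℂ) ^ k) * (r • h r)) (Set.Ioi 0) :=
    LocallyIntegrableOn.continuousOn_mul hi.locallyIntegrableOn
      (by fun_prop : Continuous fun r : ℝ => (r : ℂ) ^ k).continuousOn isOpen_Ioi.isLocallyClosed
  have key := isOpen_Ioi.ae_eq_zero_of_integral_contDiff_smul_eq_zero hl fun F h1 h2 h3 => by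
    have := ht F h1 h2 h3
    unfold radM at this
    rw [integral_withDensity_eq_integral_toReal_smul (by fun_prop) (by simp)] at this
    rw [← this, ← setIntegral_eq_integral_of_forall_compl_eq_zero (s := Set.Ioi 0)]
    · refine setIntegral_congr_fun measurableSet_Ioi fun r hr => ?_
      rw [ENNReal.toReal_ofReal (le_of_lt hr)]
      simp only [Complex.real_smul]
      ring
    · intro r hr
      rw [image_eq_zero_of_notMem_tsupport fun h => hr (h3 h), zero_smul]
  have h0 : ∀ᵐ r ∂(volume.restrict (Set.Ioi (0 : ℝ))), h r = 0 := by
    rw [ae_restrict_iff' measurableSet_Ioi]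
    filter_upwards [key] with r hr hr0
    have h0 : (r : ℂ) ≠ 0 := by exact_mod_cast (ne_of_gt hr0)
    have := hr hr0
    simpa [h0] using this
  exact (withDensity_absolutelyContinuous _ _).ae_le h0

/-- The radial form of `Λ u = 0` on the `k`-th angular mode. -/
lemma KerEq.mode {u : Plane → ℂ} (h : KerEq u) (hu : Integrable u) {k : ℕ} (hk : k ≠ 0) :
    ∀ᵐ r ∂radM, k * phiR r * modeInt u k r =
      1 / 4 * gR r * ∫ s, (rat r s : ℂ) ^ k * modeInt u k s ∂radM := by
  set m := modeInt u k with hm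
  have mi : Integrable m radM := integrable_modeInt hu k
  have gi : Integrable (fun r => (gR r : ℂ)) radM := integrable_gR.ofReal
  have i1 : Integrable (fun r => (k * phiR r : ℂ) * m r) radM := by
    refine mi.bdd_mul (c := k) (by fun_prop : Measurable fun r =>
      (k * phiR r : ℂ)).aestronglyMeasurable (Eventually.of_forall fun r => ?_)
    rw [norm_mul, Complex.norm_natCast, Complex.norm_real, Real.norm_of_nonneg (phiR_nonneg r)]
    exact mul_le_of_le_one_right (Nat.cast_nonneg k) (phiR_le_one r)
  have i2 : Integrable (fun r => 1 / 4 * gR r * ∫ s, (rat r s : ℂ) ^ k * m s ∂radM) radM := by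
    refine ((integrable_rat_mul gi mi k).integral_prod_left.const_mul (1 / 4)).congr
      (Eventually.of_forall fun r => ?_)
    simp only
    rw [mul_assoc, ← integral_const_mul (gR r : ℂ)]
    congr 2; ext s; ring
  suffices hz : ∀ᵐ r ∂radM, (k * phiR r : ℂ) * m r -
      1 / 4 * gR r * ∫ s, (rat r s : ℂ) ^ k * m s ∂radM = 0 by
    filter_upwards [hz] with r hr
    exact sub_eq_zero.1 hr
  refine radM_ae_eq_zero (i1.sub i2) k fun F h1 h2 h3 => ?_
  -- the test function `F(|x|) z^k`
  set φ : Plane → ℂ := fun x => (F ‖x‖ : ℂ) * zz x ^ k with hφ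
  have cφ : ContDiff ℝ ∞ φ :=
    (Complex.ofRealCLM.contDiff.comp (contDiff_comp_norm h1 h3)).mul (zz.contDiff.pow k)
  have sF : HasCompactSupport fun x : Plane => (F ‖x‖ : ℂ) :=
    (hasCompactSupport_comp_norm h2).comp_left (g := fun t : ℝ => (t : ℂ)) Complex.ofReal_zero
  have sφ : HasCompactSupport φ := sF.mul_right
  have φpt : ∀ r θ, φ (pt (r, θ)) = (F |r| * r ^ k) * Complex.exp (k * θ * Complex.I) := by
    intro r θ
    simp only [hφ, norm_pt, zz_pt]
    rw [mul_pow, ← Complex.exp_nat_mul]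
    ring_nf
  have dφ : ∀ x, fderiv ℝ φ x (perp x) = k * Complex.I * φ x := by
    intro x
    have a1 := ((cφ.differentiable (by simp) _).hasFDerivAt).comp_hasDerivAt (zz x).arg
      (hasDerivAt_pt ‖x‖ (zz x).arg)
    rw [pt_norm_arg] at a1
    have a2 : HasDerivAt (fun θ : ℝ => φ (pt (‖x‖, θ)))
        (k * Complex.I * φ (pt (‖x‖, (zz x).arg))) (zz x).arg := by
      simp only [φpt]
      have b1 : HasDerivAt (fun θ : ℝ => (k * θ * Complex.I : ℂ)) (k * Complex.I) (zz x).arg := by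
        have := ((Complex.ofRealCLM.hasDerivAt (x := (zz x).arg)).const_mul (k : ℂ)).mul_const
          Complex.I
        simpa using this
      have := (b1.cexp).const_mul ((F |‖x‖| : ℂ) * (‖x‖ : ℂ) ^ k)
      convert! this using 1
      ring
    rw [pt_norm_arg] at a2
    exact a1.unique a2
  obtain ⟨C, hC⟩ := sφ.exists_bound_of_continuous cφ.continuous
  have φu : Integrable fun x => φ x * u x :=
    hu.bdd_mul cφ.continuous.aestronglyMeasurable (Eventually.of_forall hC)
  have lhs : ∫ x, fderiv ℝ φ x (vG x) * u x =
      Complex.I * ∫ r, (F r * r ^ k : ℂ) * ((k * phiR r : ℂ) * m r) ∂radM := by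
    have e : (fun x => fderiv ℝ φ x (vG x) * u x) = fun x =>
        ((k * Complex.I) * (phiR ‖x‖ * φ x)) * u x := by
      ext x
      rw [vG_eq, map_smul, dφ, Complex.real_smul]
      ring
    have hi : Integrable fun x => ((k * Complex.I) * (phiR ‖x‖ * φ x)) * u x := by
      refine ((integrable_phiR_mul φu).const_mul (k * Complex.I)).congr
        (Eventually.of_forall fun x => ?_)
      simp only
      ring
    rw [e, integral_mul_mode hi (k := k) (f := fun r => (k * Complex.I) * (phiR r * (F r * r ^ k)))
      (fun r θ hr => by rw [φpt, norm_pt, abs_of_pos hr]; ring), ← integral_const_mul]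
    congr 1; ext r; ring
  -- the nonlocal term is moved to the test function by antisymmetry
  set ψ : Plane → ℂ := fun x => φ x * (G x / 2) with hψ
  have cψ : Continuous ψ := cφ.continuous.mul
    ((Complex.continuous_ofReal.comp continuous_G).div_const 2)
  have sψ : HasCompactSupport ψ := sφ.mul_right
  have iψ : Integrable ψ := cψ.integrable_of_hasCompactSupport sψ
  obtain ⟨C', hC'⟩ := sψ.exists_bound_of_continuous cψ
  have cψ2 : Continuous fun x => ‖ψ x‖ * ‖x‖ := by fun_prop
  have sψ2 : HasCompactSupport fun x => ‖ψ x‖ * ‖x‖ := sψ.norm.mul_right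
  obtain ⟨C2, hC2⟩ := sψ2.exists_bound_of_continuous cψ2
  have hC2' : ∀ x, ‖ψ x‖ * ‖x‖ ≤ C2 := fun x => (le_abs_self _).trans (hC2 x)
  have iψ2 := cψ2.integrable_of_hasCompactSupport (μ := volume) sψ2
  set f : ℝ → ℝ := fun r => F r * r ^ k * (gR r / 2) with hf
  have fi : Integrable (fun r => (f r : ℂ)) radM := by
    refine (integrable_radial ?_).ofReal
    have c : Continuous fun x : Plane => (f ‖x‖ : ℂ) := by
      have := h1.continuous
      fun_prop
    refine c.integrable_of_hasCompactSupport ?_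
    refine sF.mono fun x hx => ?_
    contrapose! hx
    simp at hx
    simp [hf, hx]
  have kψ : ∀ s t, 0 < s → kapInt ψ (pt (s, t)) =
      (Complex.I / 2 * ∫ r, (f r : ℂ) * (rat s r : ℂ) ^ k ∂radM) *
        Complex.exp (k * t * Complex.I) := by
    intro s t hs
    rw [kapInt_mode iψ hC' (k := k) (f := fun r => (f r : ℂ)) (fun r θ hr => by
      simp only [hψ, hf]
      rw [φpt, G_eq, norm_pt, abs_of_pos hr]
      push_cast
      ring) hs t, if_neg hk]
    ring
  have iu : Integrable fun y => kapInt ψ y * u y := by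
    have := (integrable_kap_mul cψ.aestronglyMeasurable hC2' iψ2 hu).integral_prod_right
    refine this.neg.congr (Eventually.of_forall fun y => ?_)
    simp only [Pi.neg_apply]
    rw [kapInt, ← integral_mul_const, ← integral_neg]
    congr 1; ext x
    rw [kap_antisymm x y]
    push_cast
    ring
  have rhs : -∫ x, φ x * (G x / 2) * kapInt u x =
      Complex.I * ∫ r, (F r * r ^ k : ℂ) * (1 / 4 * gR r * ∫ s, (rat r s : ℂ) ^ k * m s ∂radM)
        ∂radM := by
    have b1 : -∫ x, φ x * (G x / 2) * kapInt u x = ∫ y, kapInt ψ y * u y := by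
      have := integral_mul_kapInt cψ.aestronglyMeasurable hC2' iψ2 hu
      rw [this, neg_neg]
      congr 1; ext y; ring
    have b2 : ∫ y, kapInt ψ y * u y =
        ∫ s, ∫ r, (Complex.I / 2) * ((rat r s : ℂ) ^ k * ((f r : ℂ) * m s)) ∂radM ∂radM := by
      rw [integral_mul_mode iu kψ]
      congr 1; ext s
      rw [integral_const_mul, mul_assoc, ← integral_mul_const]
      congr 2; ext r
      rw [rat_comm]; ring
    have swap := integral_integral_swap
      (f := fun r s => (Complex.I / 2) * ((rat r s : ℂ) ^ k * ((f r : ℂ) * m s)))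
      ((integrable_rat_mul fi mi k).const_mul (Complex.I / 2))
    rw [b1, b2, ← swap, ← integral_const_mul]
    congr 1; ext r
    rw [integral_const_mul]
    rw [show (fun s => (rat r s : ℂ) ^ k * ((f r : ℂ) * m s)) =
      fun s => (f r : ℂ) * ((rat r s : ℂ) ^ k * m s) by ext s; ring, integral_const_mul]
    simp only [hf]
    push_cast
    ring
  have main := h φ cφ sφ
  rw [lhs, rhs] at main
  have main' := mul_left_cancel₀ Complex.I_ne_zero main
  have bF : ∀ {g : ℝ → ℂ}, Integrable g radM →
      Integrable (fun r => (F r * r ^ k : ℂ) * g r) radM := by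
    intro g hg
    have c : Continuous fun r => (F r * r ^ k : ℂ) := by
      have := h1.continuous
      fun_prop
    have s : HasCompactSupport fun r => (F r * r ^ k : ℂ) :=
      (h2.comp_left (g := fun t : ℝ => (t : ℂ)) Complex.ofReal_zero).mul_right
    obtain ⟨C, hC⟩ := s.exists_bound_of_continuous c
    exact hg.bdd_mul c.aestronglyMeasurable (Eventually.of_forall hC)
  simp only [mul_sub]
  rw [integral_sub (bF i1) (bF i2), main', sub_self]

/-! ### Solutions of the radial equations -/

lemma integrable_rat_mul_right {m : ℝ → ℂ} (hm : Integrable m radM) (k : ℕ) {s : ℝ} (hs : 0 < s) :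
    Integrable (fun r => (rat s r : ℂ) ^ k * m r) radM := by
  have h1 : Measurable fun r => rat s r :=
    measurable_rat.comp (measurable_const.prodMk measurable_id)
  refine hm.bdd_mul (c := 1) (by fun_prop) ?_
  filter_upwards [ae_radM_pos] with r hr
  rw [norm_pow, Complex.norm_real, Real.norm_of_nonneg (rat_pos hs hr).le]
  exact rat_pow_le_one hs hr k

lemma integrable_rat_mul_real {m : ℝ → ℝ} (hm : Integrable m radM) {s : ℝ} (hs : 0 < s) :
    Integrable (fun r => rat s r * m r) radM := by
  have := (integrable_rat_mul_right hm.ofReal 1 hs).re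
  refine this.congr (Eventually.of_forall fun r => ?_)
  simp [← Complex.ofReal_mul]

lemma integrable_phiR_radial {a : ℝ → ℝ} (ha : Integrable a radM) :
    Integrable (fun r => r * phiR r * a r) radM := by
  refine ha.bdd_mul (c := 1) (by fun_prop) ?_
  filter_upwards [ae_radM_pos] with r hr
  rw [Real.norm_of_nonneg (mul_nonneg hr.le (phiR_nonneg r)), mul_comm]
  exact phiR_mul_le_one hr.le

lemma integrable_pR_mul_integral {a : ℝ → ℝ} (ha : Integrable a radM) :
    Integrable (fun s => pR s * ∫ r, rat s r * a r ∂radM) radM := by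
  have := (integrable_rat_mul integrable_pR.ofReal ha.ofReal 1).integral_prod_left.re
  refine this.congr (Eventually.of_forall fun s => ?_)
  simp only
  rw [← integral_const_mul]
  have e : ∀ r : ℝ, (rat s r : ℂ) ^ 1 * ((pR s : ℂ) * (a r : ℂ)) =
      ((pR s * (rat s r * a r) : ℝ) : ℂ) := by
    intro r; push_cast; ring
  simp only [Complex.coe_algebraMap] at *
  simp only [e]
  rw [integral_complex_ofReal]
  exact Complex.ofReal_re _

/-- The integral operator with symmetric kernel `rat`, tested against its positive solution `pR`. -/
lemma integral_pR_mul_integral {a : ℝ → ℝ} (ha : Integrable a radM) :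
    ∫ s, pR s * ∫ r, rat s r * a r ∂radM ∂radM = 4 * ∫ r, r * phiR r * a r ∂radM := by
  have hi : Integrable (fun p : ℝ × ℝ => pR p.1 * (rat p.1 p.2 * a p.2)) (radM.prod radM) := by
    refine (integrable_rat_mul integrable_pR.ofReal ha.ofReal 1).re.congr
      (Eventually.of_forall fun p => ?_)
    have e : (rat p.1 p.2 : ℂ) ^ 1 * ((pR p.1 : ℂ) * (a p.2 : ℂ)) =
        ((pR p.1 * (rat p.1 p.2 * a p.2) : ℝ) : ℂ) := by push_cast; ring
    exact (congrArg Complex.re e).trans (Complex.ofReal_re _)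
  have e1 : ∫ s, pR s * ∫ r, rat s r * a r ∂radM ∂radM =
      ∫ s, ∫ r, pR s * (rat s r * a r) ∂radM ∂radM := by
    congr 1; ext s; rw [integral_const_mul]
  rw [e1, integral_integral_swap hi, ← integral_const_mul]
  refine integral_congr_ae ?_
  filter_upwards [ae_radM_pos] with r hr
  have e2 : (fun s => pR s * (rat s r * a r)) = fun s => pR s * rat r s * a r := by
    ext s; rw [rat_comm]; ring
  rw [e2, integral_mul_const, integral_pR_mul_rat hr]
  ring

lemma norm_integral_rat_le {m : ℝ → ℂ} (hm : Integrable m radM) {k : ℕ} (hk : k ≠ 0) {s : ℝ}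
    (hs : 0 < s) :
    ‖∫ r, (rat s r : ℂ) ^ k * m r ∂radM‖ ≤ ∫ r, rat s r * ‖m r‖ ∂radM := by
  refine (norm_integral_le_integral_norm _).trans
    (integral_mono_ae (integrable_rat_mul_right hm k hs).norm
      (integrable_rat_mul_real hm.norm hs) ?_)
  filter_upwards [ae_radM_pos] with r hr
  rw [norm_mul, norm_pow, Complex.norm_real, Real.norm_of_nonneg (rat_pos hs hr).le]
  exact mul_le_mul_of_nonneg_right
    (pow_le_of_le_one (rat_pos hs hr).le (rat_le_one hs) hk) (norm_nonneg _)

/-- The triangle inequality in the radial equation, with `rat ^ k ≤ rat`. -/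
lemma mode_norm_le {m : ℝ → ℂ} (hm : Integrable m radM) {k : ℕ} (hk : k ≠ 0)
    (h : ∀ᵐ r ∂radM, k * phiR r * m r = 1 / 4 * gR r * ∫ s, (rat r s : ℂ) ^ k * m s ∂radM) :
    ∀ᵐ r ∂radM, k * (r * phiR r * ‖m r‖) ≤ 1 / 4 * (pR r * ∫ s, rat r s * ‖m s‖ ∂radM) := by
  filter_upwards [h, ae_radM_pos] with r hr h0
  have := congrArg norm hr
  rw [norm_mul, norm_mul, norm_mul, norm_mul, Complex.norm_natCast, Complex.norm_real,
    Complex.norm_real, Real.norm_of_nonneg (phiR_nonneg r),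
    Real.norm_of_nonneg (gR_pos r).le] at this
  have h4 : ‖(1 / 4 : ℂ)‖ = 1 / 4 := by norm_num
  rw [h4] at this
  have hle := norm_integral_rat_le hm hk h0
  calc k * (r * phiR r * ‖m r‖) = r * (k * phiR r * ‖m r‖) := by ring
    _ = r * (1 / 4 * gR r * ‖∫ s, (rat r s : ℂ) ^ k * m s ∂radM‖) := by rw [this]
    _ ≤ r * (1 / 4 * gR r * ∫ s, rat r s * ‖m s‖ ∂radM) := by
        have := (gR_pos r).le
        gcongr
    _ = _ := by rw [pR]; ring

/-- For `k ≥ 2` the radial equation has no nonzero solution: compare with the positive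
eigenfunction of the mode `k = 1`. -/
lemma mode_eq_zero {m : ℝ → ℂ} (hm : Integrable m radM) {k : ℕ} (hk : 2 ≤ k)
    (h : ∀ᵐ r ∂radM, k * phiR r * m r = 1 / 4 * gR r * ∫ s, (rat r s : ℂ) ^ k * m s ∂radM) :
    ∀ᵐ r ∂radM, m r = 0 := by
  have i1 := integrable_phiR_radial hm.norm
  have hle := integral_mono_ae (i1.const_mul (k : ℝ))
    ((integrable_pR_mul_integral hm.norm).const_mul (1 / 4)) (mode_norm_le hm (by omega) h)
  rw [integral_const_mul, integral_const_mul, integral_pR_mul_integral hm.norm] at hle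
  have hnn : 0 ≤ᵐ[radM] fun r => r * phiR r * ‖m r‖ := by
    filter_upwards [ae_radM_pos] with r hr
    exact mul_nonneg (mul_nonneg hr.le (phiR_nonneg r)) (norm_nonneg _)
  have hge := integral_nonneg_of_ae hnn
  have hk' : (2 : ℝ) ≤ k := by exact_mod_cast hk
  have hz : ∫ r, r * phiR r * ‖m r‖ ∂radM = 0 := by nlinarith
  rw [integral_eq_zero_iff_of_nonneg_ae hnn i1] at hz
  filter_upwards [hz, ae_radM_pos] with r hr h0
  have := (mul_pos h0 (phiR_pos h0)).ne'
  simpa [this] using hr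

lemma ae_eq_zero_of_integral_radM_eq_zero {f : ℝ → ℝ} (hf : Integrable f radM)
    (h0 : ∀ᵐ r ∂radM, 0 ≤ f r) (hz : ∫ r, f r ∂radM = 0) : ∀ᵐ r ∂radM, f r = 0 :=
  (integral_eq_zero_iff_of_nonneg_ae h0 hf).1 hz

/-- For `k = 1`, real solutions `m` of the radial equation have a constant sign: testing the
pointwise bound for `|m|` against the positive solution gives an equality, and equality in the
triangle inequality at a single radius fixes the sign, because the kernel is positive. -/
lemma mode_one_sign {m : ℝ → ℝ} (hm : Integrable m radM)
    (h : ∀ᵐ r ∂radM, phiR r * m r = 1 / 4 * gR r * ∫ s, rat r s * m s ∂radM) :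
    (∀ᵐ r ∂radM, 0 ≤ m r) ∨ ∀ᵐ r ∂radM, m r ≤ 0 := by
  -- disposing of this vacuous case provides radii at which almost everywhere statements hold
  by_cases hne : radM = 0
  · left; rw [hne]; simp
  have : NeBot (ae radM) := ae_neBot.2 hne
  have hle : ∀ᵐ r ∂radM, r * phiR r * ‖m r‖ ≤ 1 / 4 * (pR r * ∫ s, rat r s * ‖m s‖ ∂radM) := by
    have hc := mode_norm_le (m := fun r => (m r : ℂ)) hm.ofReal (k := 1) one_ne_zero (by
      filter_upwards [h] with r hr
      have e : ∫ s, (rat r s : ℂ) ^ 1 * (m s : ℂ) ∂radM = ((∫ s, rat r s * m s ∂radM : ℝ) : ℂ) := by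
        rw [← integral_complex_ofReal]; congr 1; ext s; push_cast; ring
      rw [e]
      have := congrArg (fun t : ℝ => (t : ℂ)) hr
      push_cast at this ⊢
      linear_combination this)
    simpa using hc
  have i1 := integrable_phiR_radial hm.norm
  have i2 := (integrable_pR_mul_integral hm.norm).const_mul (1 / 4)
  -- both sides of `hle` have the same integral
  have hz : ∫ r, (1 / 4 * (pR r * ∫ s, rat r s * ‖m s‖ ∂radM) - r * phiR r * ‖m r‖) ∂radM = 0 := by
    rw [integral_sub i2 i1, integral_const_mul, integral_pR_mul_integral hm.norm]
    ring
  replace hz := ae_eq_zero_of_integral_radM_eq_zero (i2.sub i1) (by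
    filter_upwards [hle] with r hr; exact sub_nonneg.2 hr) hz
  obtain ⟨s, hs1, hs2, hs0⟩ := (h.and (hz.and ae_radM_pos)).exists
  have g0 := gR_pos s
  -- at the point `s` the triangle inequality is an equality
  have eq1 : |∫ r, rat s r * m r ∂radM| = ∫ r, rat s r * |m r| ∂radM := by
    have a1 : phiR s * |m s| = 1 / 4 * gR s * |∫ r, rat s r * m r ∂radM| := by
      have := congrArg abs hs1
      rwa [abs_mul, abs_mul, abs_of_nonneg (phiR_nonneg s),
        abs_of_nonneg (by positivity : 0 ≤ 1 / 4 * gR s)] at this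
    have a2 : s * (phiR s * |m s|) = s * (1 / 4 * gR s * ∫ r, rat s r * |m r| ∂radM) := by
      simp only [Pi.sub_apply, Real.norm_eq_abs, pR] at hs2
      linarith
    have a3 := mul_left_cancel₀ hs0.ne' a2
    rw [a1] at a3
    exact mul_left_cancel₀ (by positivity) a3
  have j1 := integrable_rat_mul_real hm hs0
  have j2 := integrable_rat_mul_real hm.norm hs0
  simp only [Real.norm_eq_abs] at j2
  rcases le_total 0 (∫ r, rat s r * m r ∂radM) with hp | hp
  · left
    rw [abs_of_nonneg hp] at eq1
    have z : ∫ r, (rat s r * |m r| - rat s r * m r) ∂radM = 0 := by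
      rw [integral_sub j2 j1, eq1, sub_self]
    replace z := ae_eq_zero_of_integral_radM_eq_zero (j2.sub j1) (by
      filter_upwards [ae_radM_pos] with r hr
      rw [Pi.sub_apply, ← mul_sub]
      exact mul_nonneg (rat_pos hs0 hr).le (by linarith [le_abs_self (m r)])) z
    filter_upwards [z, ae_radM_pos] with r hr h0
    rw [Pi.sub_apply, ← mul_sub] at hr
    have := (mul_eq_zero.1 hr).resolve_left (rat_pos hs0 h0).ne'
    linarith [abs_nonneg (m r)]
  · right
    rw [abs_of_nonpos hp] at eq1
    have z : ∫ r, (rat s r * |m r| + rat s r * m r) ∂radM = 0 := by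
      rw [integral_add j2 j1, ← eq1, neg_add_cancel]
    replace z := ae_eq_zero_of_integral_radM_eq_zero (j2.add j1) (by
      filter_upwards [ae_radM_pos] with r hr
      rw [Pi.add_apply, ← mul_add]
      exact mul_nonneg (rat_pos hs0 hr).le (by linarith [neg_abs_le (m r)])) z
    filter_upwards [z, ae_radM_pos] with r hr h0
    rw [Pi.add_apply, ← mul_add] at hr
    have := (mul_eq_zero.1 hr).resolve_left (rat_pos hs0 h0).ne'
    linarith [abs_nonneg (m r)]

/-- For `k = 1` the radial equation has a one-dimensional space of solutions
(Perron-Frobenius/Jentzsch). -/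
lemma mode_one_real {m : ℝ → ℝ} (hm : Integrable m radM)
    (h : ∀ᵐ r ∂radM, phiR r * m r = 1 / 4 * gR r * ∫ s, rat r s * m s ∂radM) :
    ∃ c : ℝ, ∀ᵐ r ∂radM, m r = c * pR r := by
  -- disposing of this vacuous case provides radii at which almost everywhere statements hold
  by_cases hne : radM = 0
  · exact ⟨0, by rw [hne]; simp⟩
  have : NeBot (ae radM) := ae_neBot.2 hne
  set I0 := ∫ r, pR r ∂radM with hI0
  have hpos : ∀ᵐ r ∂radM, 0 < pR r := by
    filter_upwards [ae_radM_pos] with r hr using mul_pos hr (gR_pos r)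
  have I0pos : 0 < I0 := by
    refine lt_of_le_of_ne (integral_nonneg_of_ae (hpos.mono fun r hr => hr.le)) fun h0 => ?_
    have := ae_eq_zero_of_integral_radM_eq_zero integrable_pR
      (hpos.mono fun r hr => hr.le) h0.symm
    obtain ⟨r, h1, h2⟩ := (hpos.and this).exists
    exact h1.ne' h2
  set c := (∫ r, m r ∂radM) / I0 with hc
  refine ⟨c, ?_⟩
  -- the solution `m - c pR` has zero integral and constant sign
  have hi : Integrable (fun r => m r - c * pR r) radM := hm.sub (integrable_pR.const_mul c)
  have h0 : ∫ r, (m r - c * pR r) ∂radM = 0 := by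
    rw [integral_sub hm (integrable_pR.const_mul c), integral_const_mul, hc]
    field_simp
    simp [hI0]
  have heq : ∀ᵐ r ∂radM, phiR r * (m r - c * pR r) =
      1 / 4 * gR r * ∫ s, rat r s * (m s - c * pR s) ∂radM := by
    filter_upwards [h, ae_radM_pos] with r hr hr0
    have e : (fun s => rat r s * (m s - c * pR s)) =
        fun s => rat r s * m s - c * (pR s * rat r s) := by
      ext s; ring
    rw [e, integral_sub (integrable_rat_mul_real hm hr0) ((integrable_pR_mul_rat hr0).const_mul c),
      integral_const_mul, integral_pR_mul_rat hr0, mul_sub, hr, pR]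
    ring
  rcases mode_one_sign hi heq with hs | hs
  · have := (integral_eq_zero_iff_of_nonneg_ae hs hi).1 h0
    filter_upwards [this] with r hr
    exact sub_eq_zero.1 hr
  · have h0' : ∫ r, -(m r - c * pR r) ∂radM = 0 := by rw [integral_neg, h0, neg_zero]
    have := (integral_eq_zero_iff_of_nonneg_ae (by
      filter_upwards [hs] with r hr; exact neg_nonneg.2 hr) hi.neg).1 h0'
    filter_upwards [this] with r hr
    have : -(m r - c * pR r) = 0 := hr
    linarith

lemma mode_one {m : ℝ → ℂ} (hm : Integrable m radM)
    (h : ∀ᵐ r ∂radM, phiR r * m r = 1 / 4 * gR r * ∫ s, (rat r s : ℂ) * m s ∂radM) :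
    ∃ c : ℂ, ∀ᵐ r ∂radM, m r = c * pR r := by
  have hR : ∀ᵐ r ∂radM, phiR r * (m r).re = 1 / 4 * gR r * ∫ s, rat r s * (m s).re ∂radM := by
    filter_upwards [h, ae_radM_pos] with r hr h0
    have hi := integrable_rat_mul_right hm 1 h0
    simp only [pow_one] at hi
    have e : (∫ s, (rat r s : ℂ) * m s ∂radM).re = ∫ s, rat r s * (m s).re ∂radM := by
      have := (integral_re (𝕜 := ℂ) hi).symm
      simpa using this
    have := congrArg Complex.re hr
    rw [show (1 / 4 * (gR r : ℂ)) = ((1 / 4 * gR r : ℝ) : ℂ) by push_cast; ring,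
      Complex.re_ofReal_mul, Complex.re_ofReal_mul, e] at this
    exact this
  have hI : ∀ᵐ r ∂radM, phiR r * (m r).im = 1 / 4 * gR r * ∫ s, rat r s * (m s).im ∂radM := by
    filter_upwards [h, ae_radM_pos] with r hr h0
    have hi := integrable_rat_mul_right hm 1 h0
    simp only [pow_one] at hi
    have e : (∫ s, (rat r s : ℂ) * m s ∂radM).im = ∫ s, rat r s * (m s).im ∂radM := by
      have := (integral_im (𝕜 := ℂ) hi).symm
      simpa using this
    have := congrArg Complex.im hr
    rw [show (1 / 4 * (gR r : ℂ)) = ((1 / 4 * gR r : ℝ) : ℂ) by push_cast; ring,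
      Complex.im_ofReal_mul, Complex.im_ofReal_mul, e] at this
    exact this
  obtain ⟨c1, h1⟩ := mode_one_real hm.re hR
  obtain ⟨c2, h2⟩ := mode_one_real hm.im hI
  refine ⟨c1 + c2 * Complex.I, ?_⟩
  filter_upwards [h1, h2] with r a b
  have a' : (m r).re = c1 * pR r := a
  have b' : (m r).im = c2 * pR r := b
  rw [← Complex.re_add_im (m r), a', b']
  push_cast
  ring

/-- Moments of elements of the kernel of `Λ` with positive angular mode vanish, apart from the
one carried by `∂G`. -/
lemma KerEq.integral_herm_mul {u : Plane → ℂ} (h : KerEq u) (hu : Integrable u) {a b : ℕ}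
    (hi : Integrable fun x => herm b a x * u x) (hab : a < b) (h01 : ¬ (a = 0 ∧ b = 1)) :
    ∫ x, herm b a x * u x = 0 := by
  obtain ⟨k, rfl⟩ := Nat.exists_eq_add_of_lt hab
  have hmode : ∀ r θ, 0 < r → herm (a + k + 1) a (pt (r, θ)) =
      herm (a + k + 1) a (pt (r, 0)) * Complex.exp ((k + 1 : ℕ) * θ * Complex.I) := by
    intro r θ _
    rw [herm_pt]
    congr 2
    push_cast
    ring
  rw [integral_mul_mode hi hmode]
  have eq := h.mode hu (k := k + 1) (by omega)
  have mi := integrable_modeInt hu (k + 1)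
  rcases Nat.eq_zero_or_pos k with rfl | hk
  · obtain ⟨c, hc⟩ := mode_one mi (by
      filter_upwards [eq] with r hr
      simpa using hr)
    -- the mode is proportional to that of `G z̄`, whose integral with `H_{a+1,a}` is `0` as `a ≠ 0`
    have orth : ∫ x, herm (a + 0 + 1) a x * (herm 0 1 x * G x) = 0 := by
      have := integral_herm_mul_herm (a + 0 + 1) a 0 1
      rw [if_neg (by omega)] at this
      rw [← this]
      congr 1; ext x; ring
    have hi2 : Integrable fun x => herm (a + 0 + 1) a x * (herm 0 1 x * G x) := by
      refine (integrable_herm_mul (a + 0 + 1) a 0 1).congr (Eventually.of_forall fun x => ?_)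
      simp only
      ring
    rw [integral_mul_mode hi2 hmode] at orth
    have e2 : ∀ᵐ r ∂radM, modeInt (fun x => herm 0 1 x * G x) (0 + 1) r =
        2 * Real.pi * pR r := by
      filter_upwards [ae_radM_pos] with r hr
      have e : ∀ θ : ℝ, Complex.exp ((0 + 1 : ℕ) * θ * Complex.I) *
          (herm 0 1 (pt (r, θ)) * G (pt (r, θ))) = pR r := by
        intro θ
        rw [herm_zero, zc_apply, zz_pt, G_eq, norm_pt, abs_of_pos hr, pow_one, map_mul,
          ← Complex.exp_conj]
        simp only [map_mul, Complex.conj_ofReal, Complex.conj_I]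
        have : Complex.exp (θ * Complex.I) * Complex.exp (θ * -Complex.I) = 1 := by
          rw [← Complex.exp_add]; simp
        rw [pR]
        push_cast
        simp only [one_mul]
        linear_combination (r * gR r : ℂ) * this
      have := integral_angM_exp 0
      simp at this
      rw [modeInt]
      simp only [e]
      rw [integral_const, ← this]
      simp [mul_comm]
    have e3 : ∫ r, herm (a + 0 + 1) a (pt (r, 0)) * modeInt u (0 + 1) r ∂radM =
        c / (2 * Real.pi) * ∫ r, herm (a + 0 + 1) a (pt (r, 0)) *
          modeInt (fun x => herm 0 1 x * G x) (0 + 1) r ∂radM := by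
      rw [← integral_const_mul]
      refine integral_congr_ae ?_
      filter_upwards [hc, e2] with r h1 h2
      have : (Real.pi : ℂ) ≠ 0 := by exact_mod_cast Real.pi_ne_zero
      rw [h1, h2]
      field_simp
    rw [e3, orth, mul_zero]
  · have hz := mode_eq_zero mi (by omega) eq
    refine integral_eq_zero_of_ae ?_
    filter_upwards [hz] with r hr
    rw [hr, mul_zero]
    rfl

/-- Elements of the kernel of `Λ` have no component outside the radial functions and `∂₁G, ∂₂G`. -/
lemma inner_hermE_of_mem_ker {u : X} (h : (u, (0 : X)) ∈ graphΛ) {i : ℕ × ℕ} (h1 : i.1 ≠ i.2)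
    (h2 : i.1 + i.2 ≠ 1) : ⟪hermE i, u⟫_ℂ = 0 := by
  obtain ⟨a, b⟩ := i
  simp only at h1 h2
  rw [hermE, inner_smul_left, inner_hermX]
  simp only
  have hk := kerEq_of_mem_graphΛ h
  have hu := integrable_coe u
  have hi : ∀ a b, Integrable fun x => herm b a x * u x := fun a b =>
    (expGrowth_herm b a).integrable_mul_coe (continuous_herm b a).aestronglyMeasurable u
  have : ∫ x, herm b a x * u x = 0 := by
    rcases lt_or_gt_of_ne h1 with hab | hab
    · exact hk.integral_herm_mul hu (hi a b) hab (by omega)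
    -- negative angular modes are handled by complex conjugation
    · have hu' : Integrable fun x => conj (u x) :=
        (Complex.conjCLE : ℂ →L[ℝ] ℂ).integrable_comp hu
      have hi' : Integrable fun x => herm a b x * conj (u x) := by
        refine ((Complex.conjCLE : ℂ →L[ℝ] ℂ).integrable_comp (hi a b)).congr
          (Eventually.of_forall fun x => ?_)
        simp [conj_herm]
      have := hk.conj.integral_herm_mul hu' hi' hab (by omega)
      have h3 := congrArg conj this
      rw [← integral_conj] at h3
      simpa [conj_herm] using h3
  rw [this, mul_zero]

/-! ### Resolvents of accretive operators -/

section Resolvent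

variable {E : Type*} [NormedAddCommGroup E]

/-- Neumann series: the resolvent set contains the disc of radius `‖R‖⁻¹` around `z`. -/
lemma IsResolvent.exists_of_near [NormedSpace ℂ E] [CompleteSpace E] {T : E →ₗ.[ℂ] E} {z z' : ℂ}
    {R : E →L[ℂ] E} (hR : IsResolvent T z R) (h : ‖z' - z‖ * ‖R‖ < 1) :
    ∃ R' : E →L[ℂ] E, IsResolvent T z' R' := by
  have ht : ‖(z' - z) • R‖ < 1 := by rwa [norm_smul]
  set u := Units.oneSub ((z' - z) • R) ht with hu
  have hval : ∀ g : E, (u : E →L[ℂ] E) g = g - (z' - z) • R g := fun g => by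
    rw [hu, Units.val_oneSub]; rfl
  have huv : ∀ f : E, (u : E →L[ℂ] E) ((↑u⁻¹ : E →L[ℂ] E) f) = f := fun f =>
    congrArg (fun A : E →L[ℂ] E => A f) u.mul_inv
  have hvu : ∀ f : E, (↑u⁻¹ : E →L[ℂ] E) ((u : E →L[ℂ] E) f) = f := fun f =>
    congrArg (fun A : E →L[ℂ] E => A f) u.inv_mul
  refine ⟨R * (↑u⁻¹ : E →L[ℂ] E), fun f => ?_, fun w => ?_⟩
  · obtain ⟨hd, he⟩ := hR.1 ((↑u⁻¹ : E →L[ℂ] E) f)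
    refine ⟨hd, ?_⟩
    have h1 := huv f
    rw [hval] at h1
    change T ⟨R ((↑u⁻¹ : E →L[ℂ] E) f), hd⟩ - z' • R ((↑u⁻¹ : E →L[ℂ] E) f) = f
    rw [sub_eq_iff_eq_add.1 he]
    conv_rhs => rw [← h1]
    module
  · have h2 := hR.2 w
    have h3 : T w - z' • (w : E) = (u : E →L[ℂ] E) (T w - z • (w : E)) := by
      rw [hval, h2]; module
    change R ((↑u⁻¹ : E →L[ℂ] E) (T w - z' • (w : E))) = w
    rw [h3, hvu]
    exact h2

lemma IsResolvent.of_neg [NormedSpace ℂ E] {T : E →ₗ.[ℂ] E} {z : ℂ} {R : E →L[ℂ] E}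
    (hR : IsResolvent T (-z) R) : IsResolvent (-T) z (-R) := by
  refine ⟨fun f => ?_, fun w => ?_⟩
  · obtain ⟨hd, he⟩ := hR.1 f
    have hd' : (-R) f ∈ T.domain := T.domain.neg_mem hd
    refine ⟨hd', ?_⟩
    have e : (⟨(-R) f, hd'⟩ : T.domain) = -⟨R f, hd⟩ := rfl
    change -(T ⟨(-R) f, hd'⟩) - z • (-(R f)) = f
    rw [e, LinearPMap.map_neg, neg_neg]
    conv_rhs => rw [← he]
    module
  · change -(R (-(T w) - z • (w : E))) = w
    rw [← map_neg]
    convert hR.2 w using 2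
    module

variable [InnerProductSpace ℂ E] {T : E →ₗ.[ℂ] E}

/-- The lower bound for `T - z` when `-1 - T` is accretive. -/
lemma norm_le_of_accretive (hT : ∀ w : T.domain, (⟪(w : E), T w⟫_ℂ).re ≤ -‖(w : E)‖ ^ 2)
    (z : ℂ) (w : T.domain) : (1 + z.re) * ‖(w : E)‖ ≤ ‖T w - z • (w : E)‖ := by
  rcases (norm_nonneg (w : E)).eq_or_lt with h0 | h0
  · rw [← h0, mul_zero]; exact norm_nonneg _
  have h1 : (⟪(w : E), T w - z • (w : E)⟫_ℂ).re ≤ -((1 + z.re) * ‖(w : E)‖) * ‖(w : E)‖ := by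
    have h2 : (⟪(w : E), T w - z • (w : E)⟫_ℂ).re =
        (⟪(w : E), T w⟫_ℂ).re - z.re * ‖(w : E)‖ ^ 2 := by
      rw [inner_sub_right, inner_smul_right, inner_self_eq_norm_sq_to_K, Complex.sub_re,
        ← Complex.re_mul_ofReal]
      push_cast
      rfl
    rw [h2]
    linarith [hT w]
  have h3 := (abs_le.1 ((Complex.abs_re_le_norm _).trans (norm_inner_le_norm (𝕜 := ℂ) (w : E)
    (T w - z • (w : E))))).1
  exact le_of_mul_le_mul_right (by linarith) h0

lemma exists_isResolvent_of_surjective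
    (hT : ∀ w : T.domain, (⟪(w : E), T w⟫_ℂ).re ≤ -‖(w : E)‖ ^ 2)
    {z : ℂ} (hz : -1 < z.re) (hs : ∀ f : E, ∃ w : T.domain, T w - z • (w : E) = f) :
    ∃ R : E →L[ℂ] E, IsResolvent T z R := by
  have hp : 0 < 1 + z.re := by linarith
  let S : T.domain →ₗ[ℂ] E := T.toFun - z • T.domain.subtype
  have hS : ∀ w : T.domain, S w = T w - z • (w : E) := fun w => rfl
  have hinj : Function.Injective S := by
    rw [← LinearMap.ker_eq_bot, LinearMap.ker_eq_bot']
    intro w hw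
    have := norm_le_of_accretive hT z w
    rw [← hS, hw, norm_zero] at this
    exact Subtype.ext (norm_le_zero_iff.1 (nonpos_of_mul_nonpos_right this hp))
  let e := LinearEquiv.ofBijective S ⟨hinj, hs⟩
  have he : ∀ f, S (e.symm f) = f := fun f => e.apply_symm_apply f
  refine ⟨(T.domain.subtype ∘ₗ e.symm.toLinearMap).mkContinuous (1 + z.re)⁻¹ fun f => ?_,
    fun f => ⟨(e.symm f).2, he f⟩, fun w => ?_⟩
  · have := norm_le_of_accretive hT z (e.symm f)
    rw [← hS, he] at this
    rw [inv_mul_eq_div, le_div_iff₀ hp, mul_comm]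
    exact this
  · change ((e.symm (S w) : T.domain) : E) = w
    rw [show e.symm (S w) = w from e.symm_apply_apply w]

lemma IsResolvent.norm_le (hT : ∀ w : T.domain, (⟪(w : E), T w⟫_ℂ).re ≤ -‖(w : E)‖ ^ 2)
    {z : ℂ} (hz : -1 < z.re) {R : E →L[ℂ] E} (hR : IsResolvent T z R) :
    ‖R‖ ≤ (1 + z.re)⁻¹ := by
  have hp : 0 < 1 + z.re := by linarith
  refine R.opNorm_le_bound (by positivity) fun f => ?_
  obtain ⟨hd, he⟩ := hR.1 f
  have := norm_le_of_accretive hT z ⟨R f, hd⟩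
  rw [he] at this
  rw [inv_mul_eq_div, le_div_iff₀ hp, mul_comm]
  exact this

/-- If `-1 - T` is accretive and `T - x` is onto for all large real `x`, the half-plane
`Re z > -1` belongs to the resolvent set of `T`. -/
lemma exists_isResolvent [CompleteSpace E]
    (hT : ∀ w : T.domain, (⟪(w : E), T w⟫_ℂ).re ≤ -‖(w : E)‖ ^ 2)
    {x₀ : ℝ} (hs : ∀ x : ℝ, x₀ ≤ x → ∀ f : E, ∃ w : T.domain, T w - (x : ℂ) • (w : E) = f)
    {z : ℂ} (hz : -1 < z.re) : ∃ R : E →L[ℂ] E, IsResolvent T z R := by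
  have hp : 0 < 1 + z.re := by linarith
  -- the discs `|z - x| < 1 + x` exhaust the half-plane as `x → ∞`
  obtain ⟨x, h1, h2, h3⟩ : ∃ x : ℝ, x₀ ≤ x ∧ 0 ≤ x ∧
      z.re ^ 2 + z.im ^ 2 < 2 * (1 + z.re) * x := by
    refine ⟨max x₀ ((z.re ^ 2 + z.im ^ 2 + 1) / (2 * (1 + z.re))), le_max_left _ _,
      le_trans (by positivity) (le_max_right _ _), ?_⟩
    calc z.re ^ 2 + z.im ^ 2 < 2 * (1 + z.re) *
          ((z.re ^ 2 + z.im ^ 2 + 1) / (2 * (1 + z.re))) := by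
          rw [mul_div_cancel₀ _ (by positivity)]; linarith
      _ ≤ _ := by gcongr; exact le_max_right _ _
  have hx : -1 < (x : ℂ).re := by rw [Complex.ofReal_re]; linarith
  obtain ⟨R, hR⟩ := exists_isResolvent_of_surjective hT hx (hs x h1)
  refine hR.exists_of_near ?_
  have hn := hR.norm_le hT hx
  rw [Complex.ofReal_re] at hn
  have hlt : ‖z - x‖ < 1 + x := by
    refine lt_of_pow_lt_pow_left₀ 2 (by positivity) ?_
    rw [← Complex.normSq_eq_norm_sq, Complex.normSq_apply]
    simp only [Complex.sub_re, Complex.sub_im, Complex.ofReal_re, Complex.ofReal_im]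
    nlinarith
  calc ‖z - x‖ * ‖R‖ ≤ ‖z - x‖ * (1 + x)⁻¹ := by gcongr
    _ < (1 + x) * (1 + x)⁻¹ := by gcongr
    _ = 1 := mul_inv_cancel₀ (by positivity)

lemma resolventNorm_imaginary_le [CompleteSpace E]
    (hT : ∀ w : T.domain, (⟪(w : E), T w⟫_ℂ).re ≤ -‖(w : E)‖ ^ 2)
    {x₀ : ℝ} (hs : ∀ x : ℝ, x₀ ≤ x → ∀ f : E, ∃ w : T.domain, T w - (x : ℂ) • (w : E) = f)
    (l : ℝ) : resolventNorm T (Complex.I * l) ≤ 1 := by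
  have hz : (Complex.I * l).re = 0 := by simp
  obtain ⟨R, hR⟩ := exists_isResolvent hT hs (z := Complex.I * l) (by rw [hz]; norm_num)
  refine (iInf₂_le R hR).trans ?_
  have := hR.norm_le hT (by rw [hz]; norm_num)
  rw [hz, add_zero, inv_one] at this
  rw [← enorm_one (G := ℂ), enorm_le_iff_norm_le]
  simpa using this

/-- If `z ∈ spec (-T)`, then `-z` is a spectral point of `T` at distance `Re z` from the imaginary
axis, and the resolvent of `T` at the nearest point of the axis has norm at least `1 / Re z`. -/
lemma inv_iSup_resolventNorm_le [CompleteSpace E]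
    (hT : ∀ w : T.domain, (⟪(w : E), T w⟫_ℂ).re ≤ -‖(w : E)‖ ^ 2)
    {x₀ : ℝ} (hs : ∀ x : ℝ, x₀ ≤ x → ∀ f : E, ∃ w : T.domain, T w - (x : ℂ) • (w : E) = f)
    {z : ℂ} (hz : z ∈ spec (-T)) :
    (((⨆ l : ℝ, resolventNorm T (Complex.I * l))⁻¹ : ℝ≥0∞) : EReal) ≤ z.re := by
  have hz' : ¬ ∃ R : E →L[ℂ] E, IsResolvent T (-z) R := fun ⟨R, hR⟩ => hz ⟨-R, hR.of_neg⟩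
  have hd : 1 ≤ z.re := by
    by_contra! h
    exact hz' (exists_isResolvent hT hs (by simpa using h))
  have hle : (ENNReal.ofReal z.re)⁻¹ ≤ resolventNorm T (Complex.I * (-z.im : ℝ)) := by
    refine le_iInf₂ fun R hR => ?_
    have hn : 1 ≤ z.re * ‖R‖ := by
      by_contra! h
      refine hz' (hR.exists_of_near ?_)
      have e : -z - Complex.I * (-z.im : ℝ) = ((-z.re : ℝ) : ℂ) := by
        apply Complex.ext <;> simp
      rw [e, Complex.norm_real, norm_neg, Real.norm_of_nonneg (by linarith)]
      exact h
    rw [← ofReal_norm, ← ENNReal.ofReal_inv_of_pos (by linarith)]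
    refine ENNReal.ofReal_le_ofReal ?_
    rw [inv_le_iff_one_le_mul₀ (by linarith), mul_comm]
    exact hn
  have h1 : (⨆ l : ℝ, resolventNorm T (Complex.I * l))⁻¹ ≤ ENNReal.ofReal z.re := by
    rw [ENNReal.inv_le_iff_inv_le]
    exact hle.trans (le_iSup (fun l : ℝ => resolventNorm T (Complex.I * l)) (-z.im))
  refine (EReal.coe_ennreal_le_coe_ennreal_iff.2 h1).trans (le_of_eq ?_)
  rw [EReal.coe_ennreal_ofReal, max_eq_left (by linarith)]

end Resolvent

/-! ### The operators in the Hermite basis -/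

lemma hasSum_hermE (w : X) : HasSum (fun i => ⟪hermE i, w⟫_ℂ • hermE i) w := by
  simpa only [hermBasis.repr_apply_apply, hermBasis_apply] using hermBasis.hasSum_repr w

lemma hasSum_norm_sq_inner (w : X) : HasSum (fun i => ‖⟪hermE i, w⟫_ℂ‖ ^ 2) (‖w‖ ^ 2) := by
  have h := (hermBasis.hasSum_inner_mul_inner w w).mapL Complex.reCLM
  rw [Complex.reCLM_apply, inner_self_eq_norm_sq_to_K] at h
  convert! h using 1
  · ext i
    rw [Complex.reCLM_apply, hermBasis_apply, ← inner_conj_symm w,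
      ← Complex.normSq_eq_conj_mul_self,
      Complex.ofReal_re, Complex.normSq_eq_norm_sq]
  · norm_cast

lemma eq_of_inner_hermE {v w : X} (h : ∀ i, ⟪hermE i, v⟫_ℂ = ⟪hermE i, w⟫_ℂ) : v = w := by
  have h1 := hasSum_hermE v
  simp only [h] at h1
  exact h1.unique (hasSum_hermE w)

/-- The form bound on `Λ` makes the series `∑ cᵢ Λeᵢ` converge on the form domain of `L`. -/
lemma hasSum_lamE {c : ℕ × ℕ → ℂ} {S : ℝ} (hc : HasSum (fun i => (1 + lev i) * ‖c i‖ ^ 2) S) :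
    ∃ g : X, HasSum (fun i => c i • lamE i) g ∧ ‖g‖ ^ 2 ≤ lamC * S := by
  have hC : 0 < lamC := by unfold lamC; positivity
  have hs : Summable fun i => c i • lamE i := by
    rw [summable_iff_vanishing_norm]
    intro ε hε
    obtain ⟨s, hs⟩ := summable_iff_vanishing_norm.1 hc.summable (ε ^ 2 / lamC) (by positivity)
    refine ⟨s, fun t ht => lt_of_pow_lt_pow_left₀ 2 hε.le ?_⟩
    refine (norm_sq_sum_lamE_le t c).trans_lt ?_
    have := (le_abs_self _).trans_lt (hs t ht)
    rwa [lt_div_iff₀' hC] at this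
  refine ⟨_, hs.hasSum, ?_⟩
  refine le_of_tendsto ((hs.hasSum.norm).pow 2) (Eventually.of_forall fun s => ?_)
  refine (norm_sq_sum_lamE_le s c).trans ?_
  gcongr
  exact sum_le_hasSum s (fun i _ => by have := lev_nonneg i; positivity) hc

/-- Elements of the form domain of `L` belong to the domain of `Λ`. -/
lemma exists_mem_graphΛ {w : X} {S : ℝ}
    (hw : HasSum (fun i => (1 + lev i) * ‖⟪hermE i, w⟫_ℂ‖ ^ 2) S) :
    ∃ g : X, (w, g) ∈ graphΛ ∧ HasSum (fun i => ⟪hermE i, w⟫_ℂ • lamE i) g ∧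
      ‖g‖ ^ 2 ≤ lamC * S := by
  obtain ⟨g, hg, hn⟩ := hasSum_lamE hw
  refine ⟨g, isClosed_graphΛ.mem_of_tendsto ((hasSum_hermE w).prodMk_nhds hg)
    (Eventually.of_forall fun s => ?_), hg, hn⟩
  have := graphΛ.sum_mem (t := s) fun i _ =>
    graphΛ.smul_mem ⟪hermE i, w⟫_ℂ (hermE_mem_graphΛ i)
  convert! this using 1
  simp [Prod.ext_iff, Prod.fst_sum, Prod.snd_sum]

lemma summable_form {w f : X} (h : (w, f) ∈ graphL) :
    Summable fun i => (1 + lev i) * ‖⟪hermE i, w⟫_ℂ‖ ^ 2 := by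
  have h1 := (hasSum_norm_sq_inner w).summable
  have h2 := (hasSum_norm_sq_inner f).summable
  refine Summable.of_nonneg_of_le (fun i => by have := lev_nonneg i; positivity) (fun i => ?_)
    ((h1.mul_left 2).add h2)
  have h3 := mem_graphL_iff.1 h i
  rw [hermBasis_apply] at h3
  rw [h3, norm_mul, norm_neg, Complex.norm_real, Real.norm_of_nonneg (lev_nonneg i), mul_pow,
    ← add_mul]
  exact mul_le_mul_of_nonneg_right (by nlinarith [sq_nonneg (lev i - 1)]) (by positivity)

/-- Skew-symmetry of `Λ` against a Hermite function, on the form domain of `L`. -/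
lemma inner_hermE_of_mem_graphΛ {w g : X} {S : ℝ}
    (hw : HasSum (fun i => (1 + lev i) * ‖⟪hermE i, w⟫_ℂ‖ ^ 2) S) (hg : (w, g) ∈ graphΛ)
    (j : ℕ × ℕ) : ⟪hermE j, g⟫_ℂ = -⟪lamE j, w⟫_ℂ := by
  obtain ⟨g', h1, h2, -⟩ := exists_mem_graphΛ hw
  have e : g = g' := sub_eq_zero.1 (graphΛ_functional _ (graphΛ.sub_mem hg h1) (sub_self w))
  rw [e]
  have h3 := h2.mapL (innerSL ℂ (hermE j))
  have h4 := ((hasSum_hermE w).mapL (innerSL ℂ (lamE j))).neg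
  refine h3.unique ?_
  convert! h4 using 1
  ext i
  simp only [innerSL_apply_apply, inner_smul_right, inner_hermE_lamE, mul_neg]

lemma re_inner_of_mem_graphΛ {w g : X} {S : ℝ}
    (hw : HasSum (fun i => (1 + lev i) * ‖⟪hermE i, w⟫_ℂ‖ ^ 2) S) (hg : (w, g) ∈ graphΛ) :
    (⟪w, g⟫_ℂ).re = 0 := by
  obtain ⟨g', h1, h2, -⟩ := exists_mem_graphΛ hw
  have e : g = g' := sub_eq_zero.1 (graphΛ_functional _ (graphΛ.sub_mem hg h1) (sub_self w))
  rw [← e] at h2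
  have h3 := hermBasis.hasSum_inner_mul_inner g w
  have h4 := (h2.mapL (innerSL ℂ w))
  have h5 : ⟪w, g⟫_ℂ = -⟪g, w⟫_ℂ := by
    refine h4.unique ?_
    convert! h3.neg using 1
    ext i
    rw [innerSL_apply_apply, inner_smul_right, hermBasis_apply, ← inner_conj_symm g,
      inner_hermE_of_mem_graphΛ hw hg, map_neg, inner_conj_symm]
    ring
  have h6 := congrArg Complex.re h5
  rw [Complex.neg_re, ← inner_conj_symm g w, Complex.conj_re] at h6
  linarith

/-! ### The kernel of `Λ` -/

lemma mem_kerΛ_iff {u : X} : u ∈ kerΛ ↔ (u, (0 : X)) ∈ graphΛ := by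
  rw [← Λ_graph, LinearPMap.mem_graph_iff, kerΛ]
  constructor
  · rintro ⟨v, hv, rfl⟩
    exact ⟨v, rfl, hv⟩
  · rintro ⟨v, h1, h2⟩
    exact ⟨v, h2, h1⟩

lemma lamE_eq_zero {i : ℕ × ℕ} (h : i.1 = i.2 ∨ i.1 + i.2 = 1) : lamE i = 0 := by
  obtain ⟨a, b⟩ := i
  simp only at h
  rcases h with rfl | h
  · exact lamE_diag a
  · obtain ⟨rfl, rfl⟩ | ⟨rfl, rfl⟩ : (a = 1 ∧ b = 0) ∨ (a = 0 ∧ b = 1) := by omega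
    · exact lamE_one_zero
    · exact lamE_zero_one

/-- The closed subspace `ker Λ` is spanned by the `e_{a,b}` with `a = b` or `a + b = 1`. -/
lemma mem_kerΛ_orthogonal_iff {w : X} :
    w ∈ kerΛᗮ ↔ ∀ i : ℕ × ℕ, i.1 = i.2 ∨ i.1 + i.2 = 1 → ⟪hermE i, w⟫_ℂ = 0 := by
  rw [Submodule.mem_orthogonal]
  refine ⟨fun h i hi => h _ ?_, fun h u hu => ?_⟩
  · rw [mem_kerΛ_iff]
    have := hermE_mem_graphΛ i
    rwa [lamE_eq_zero hi] at this
  · refine (hermBasis.hasSum_inner_mul_inner u w).unique ?_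
    convert! hasSum_zero using 1
    ext i
    rw [hermBasis_apply]
    by_cases hi : i.1 = i.2 ∨ i.1 + i.2 = 1
    · rw [h i hi, mul_zero]
    · rw [not_or] at hi
      rw [← inner_conj_symm, inner_hermE_of_mem_ker (mem_kerΛ_iff.1 hu) hi.1 hi.2, map_zero,
        zero_mul]

lemma mem_perpOp_graph_iff {α : ℝ} {w f : kerΛᗮ} :
    (w, f) ∈ (perpOp α).graph ↔ ∃ l g : X, ((w : X), l) ∈ graphL ∧ ((w : X), g) ∈ graphΛ ∧
      l - (α : ℂ) • g = f := by
  rw [perpOp, part_graph, Submodule.mem_comap]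
  change ((w : X), (f : X)) ∈ (L - (α : ℂ) • Λ).graph ↔ _
  rw [LinearPMap.mem_graph_iff, ← L_graph, ← Λ_graph]
  constructor
  · rintro ⟨⟨v, h1, h2⟩, h3, h4⟩
    simp only at h3
    subst h3
    exact ⟨L ⟨w, h1⟩, Λ ⟨w, h2⟩, L.mem_graph ⟨w, h1⟩, Λ.mem_graph ⟨w, h2⟩, h4⟩
  · rintro ⟨l, g, h1, h2, h3⟩
    obtain ⟨⟨v, hv⟩, h4, h5⟩ := LinearPMap.mem_graph_iff _ |>.1 h1
    obtain ⟨⟨v', hv'⟩, h6, h7⟩ := LinearPMap.mem_graph_iff _ |>.1 h2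
    simp only at h4 h5 h6 h7
    subst h4 h6 h5 h7
    exact ⟨⟨_, hv, hv'⟩, rfl, h3⟩

/-- Outside the kernel of `Λ` one has `a + b ≥ 2`, so the eigenvalues of `-L` are at least `1`. -/
lemma one_le_lev {i : ℕ × ℕ} (h : ¬ (i.1 = i.2 ∨ i.1 + i.2 = 1)) : 1 ≤ lev i := by
  have : 2 ≤ i.1 + i.2 := by omega
  have h2 : (2 : ℝ) ≤ i.1 + i.2 := by exact_mod_cast this
  unfold lev
  linarith

lemma re_inner_perpOp_le (α : ℝ) (w : (perpOp α).domain) :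
    (⟪(w : kerΛᗮ), perpOp α w⟫_ℂ).re ≤ -‖(w : kerΛᗮ)‖ ^ 2 := by
  obtain ⟨l, g, h1, h2, h3⟩ := mem_perpOp_graph_iff.1 ((perpOp α).mem_graph w)
  rw [Submodule.coe_inner, Submodule.coe_norm, ← h3, inner_sub_right, inner_smul_right,
    Complex.sub_re, Complex.re_ofReal_mul, re_inner_of_mem_graphΛ (summable_form h1).hasSum h2,
    mul_zero, sub_zero]
  have ha := (hermBasis.hasSum_inner_mul_inner ((w : kerΛᗮ) : X) l).mapL Complex.reCLM
  refine hasSum_le (fun i => ?_) ha (hasSum_norm_sq_inner ((w : kerΛᗮ) : X)).neg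
  rw [Complex.reCLM_apply, mem_graphL_iff.1 h1 i, hermBasis_apply, ← inner_conj_symm]
  have e : ∀ c : ℂ, (conj c * (-(lev i : ℂ) * c)).re = -(lev i * ‖c‖ ^ 2) := fun c => by
    have : conj c * (-(lev i : ℂ) * c) = ((-(lev i * Complex.normSq c) : ℝ) : ℂ) := by
      push_cast
      rw [Complex.normSq_eq_conj_mul_self]
      ring
    rw [this, Complex.ofReal_re, Complex.normSq_eq_norm_sq]
  rw [e, neg_le_neg_iff]
  by_cases hi : i.1 = i.2 ∨ i.1 + i.2 = 1
  · simp [mem_kerΛ_orthogonal_iff.1 (w : kerΛᗮ).2 i hi]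
  · exact le_mul_of_one_le_left (by positivity) (one_le_lev hi)

/-! ### Surjectivity for large real spectral parameter -/

lemma inner_hermE_of_resolvent {x : ℝ} (hx : 0 < x) {w f : X}
    (h : (w, f + (x : ℂ) • w) ∈ graphL) (i : ℕ × ℕ) :
    ⟪hermE i, w⟫_ℂ = -⟪hermE i, f⟫_ℂ / ((lev i + x : ℝ) : ℂ) := by
  have h1 := mem_graphL_iff.1 h i
  rw [hermBasis_apply, inner_add_right, inner_smul_right] at h1
  have h2 : ((lev i + x : ℝ) : ℂ) ≠ 0 := by
    have := lev_nonneg i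
    exact_mod_cast (by positivity : lev i + x ≠ 0)
  rw [eq_div_iff h2]
  push_cast
  linear_combination h1

/-- `L - x` is onto and `Λ(L - x)⁻¹` is bounded, with a norm that tends to `0` as `x → ∞`. -/
lemma exists_resolvent {x : ℝ} (hx : 1 ≤ x) (f : X) :
    ∃ w g : X, (w, f + (x : ℂ) • w) ∈ graphL ∧ (w, g) ∈ graphΛ ∧
      ‖g‖ ^ 2 ≤ lamC / x * ‖f‖ ^ 2 := by
  have hx0 : 0 < x := by linarith
  have hlx : ∀ i, 0 < lev i + x := fun i => by have := lev_nonneg i; positivity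
  let d : ℕ × ℕ → ℂ := fun i => -⟪hermE i, f⟫_ℂ / ((lev i + x : ℝ) : ℂ)
  have hd : ∀ i, ‖d i‖ ^ 2 = ‖⟪hermE i, f⟫_ℂ‖ ^ 2 / (lev i + x) ^ 2 := fun i => by
    rw [norm_div, norm_neg, Complex.norm_real, Real.norm_of_nonneg (hlx i).le, div_pow]
  have hform : ∀ i, (1 + lev i) * ‖d i‖ ^ 2 ≤ x⁻¹ * ‖⟪hermE i, f⟫_ℂ‖ ^ 2 := fun i => by
    have h0 := lev_nonneg i
    have : (1 + lev i) / (lev i + x) ^ 2 ≤ x⁻¹ := by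
      rw [div_le_iff₀ (by positivity), inv_mul_eq_div, le_div_iff₀ hx0]
      nlinarith
    rw [hd, mul_div_assoc', mul_div_right_comm]
    gcongr
  have hf := (hasSum_norm_sq_inner f).mul_left x⁻¹
  have hsum : Summable fun i => (1 + lev i) * ‖d i‖ ^ 2 :=
    Summable.of_nonneg_of_le (fun i => by have := lev_nonneg i; positivity) hform hf.summable
  have hmem : Memℓp d 2 := by
    refine memℓp_gen ?_
    refine Summable.of_nonneg_of_le (fun i => by positivity) (fun i => ?_) hsum
    have := lev_nonneg i
    simp only [ENNReal.toReal_ofNat, Real.rpow_two]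
    nlinarith [sq_nonneg ‖d i‖]
  let w : X := hermBasis.repr.symm ⟨d, hmem⟩
  have hw : ∀ i, ⟪hermE i, w⟫_ℂ = d i := fun i => by
    rw [← hermBasis_apply, ← hermBasis.repr_apply_apply, LinearIsometryEquiv.apply_symm_apply]
  have hS : HasSum (fun i => (1 + lev i) * ‖⟪hermE i, w⟫_ℂ‖ ^ 2)
      (∑' i, (1 + lev i) * ‖d i‖ ^ 2) := by
    simp only [hw]
    exact hsum.hasSum
  obtain ⟨g, hg, -, hn⟩ := exists_mem_graphΛ hS
  refine ⟨w, g, mem_graphL_iff.2 fun i => ?_, hg, hn.trans ?_⟩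
  · have : ((lev i + x : ℝ) : ℂ) ≠ 0 := by exact_mod_cast (hlx i).ne'
    rw [hermBasis_apply, inner_add_right, inner_smul_right, hw]
    simp only [d]
    field_simp
    push_cast
    ring
  · have hC : 0 < lamC := by unfold lamC; positivity
    rw [div_eq_mul_inv, mul_assoc]
    gcongr
    exact hasSum_le hform hsum.hasSum hf

lemma eq_of_resolvent {x : ℝ} (hx : 0 < x) {f w w' : X} (h : (w, f + (x : ℂ) • w) ∈ graphL)
    (h' : (w', f + (x : ℂ) • w') ∈ graphL) : w = w' :=
  eq_of_inner_hermE fun i => by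
    rw [inner_hermE_of_resolvent hx h, inner_hermE_of_resolvent hx h']

/-- The operator `Λ(L - x)⁻¹` as a bounded operator on `X`. -/
lemma exists_lam_resolvent {x : ℝ} (hx : 1 ≤ x) :
    ∃ B : X →L[ℂ] X, ‖B‖ ≤ Real.sqrt (lamC / x) ∧
      ∀ f, ∃ w, (w, f + (x : ℂ) • w) ∈ graphL ∧ (w, B f) ∈ graphΛ := by
  have hx0 : 0 < x := by linarith
  choose R B hR hB hn using exists_resolvent hx
  have hC : 0 < lamC := by unfold lamC; positivity
  have huniq : ∀ {f w g}, (w, f + (x : ℂ) • w) ∈ graphL → (w, g) ∈ graphΛ → B f = g := by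
    intro f w g h1 h2
    obtain rfl := eq_of_resolvent hx0 (hR f) h1
    exact sub_eq_zero.1 (graphΛ_functional _ (graphΛ.sub_mem (hB f) h2) (sub_self _))
  let B' : X →ₗ[ℂ] X :=
    { toFun := B
      map_add' := fun f f' => huniq (w := R f + R f') (by
        convert! graphL.add_mem (hR f) (hR f') using 1
        refine Prod.ext rfl ?_
        simp only [Prod.snd_add]
        module) (graphΛ.add_mem (hB f) (hB f'))
      map_smul' := fun c f => huniq (w := c • R f) (by
        convert! graphL.smul_mem c (hR f) using 1
        refine Prod.ext rfl ?_
        simp only [Prod.smul_snd]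
        module) (graphΛ.smul_mem c (hB f)) }
  have hb : ∀ f, ‖B' f‖ ≤ Real.sqrt (lamC / x) * ‖f‖ := fun f => by
    refine le_of_sq_le_sq ?_ (by positivity)
    rw [mul_pow, Real.sq_sqrt (by positivity)]
    exact hn f
  exact ⟨B'.mkContinuous _ hb, B'.mkContinuous_norm_le (by positivity) hb,
    fun f => ⟨R f, hR f, hB f⟩⟩

/-- `L_⊥ - αΛ_⊥ - x` is onto for large `x`: with `g = (L - x)w` the equation reads
`g - αΛ(L - x)⁻¹g = f`, and is solved by a Neumann series. -/
lemma perpOp_surjective (α : ℝ) {x : ℝ} (hx : max 1 (α ^ 2 * lamC + 1) ≤ x) (f : kerΛᗮ) :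
    ∃ w : (perpOp α).domain, perpOp α w - (x : ℂ) • (w : kerΛᗮ) = f := by
  have hx1 : 1 ≤ x := (le_max_left _ _).trans hx
  have hx2 : α ^ 2 * lamC + 1 ≤ x := (le_max_right _ _).trans hx
  have hx0 : 0 < x := by linarith
  have hC : 0 < lamC := by unfold lamC; positivity
  obtain ⟨B, hB, hBs⟩ := exists_lam_resolvent hx1
  have ht : ‖(α : ℂ) • B‖ < 1 := by
    rw [norm_smul, Complex.norm_real, Real.norm_eq_abs]
    refine lt_of_pow_lt_pow_left₀ 2 zero_le_one ?_
    calc (|α| * ‖B‖) ^ 2 ≤ (|α| * Real.sqrt (lamC / x)) ^ 2 := by gcongr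
      _ = α ^ 2 * lamC / x := by
        rw [mul_pow, sq_abs, Real.sq_sqrt (by positivity), mul_div_assoc]
      _ < 1 ^ 2 := by rw [div_lt_iff₀ hx0]; linarith
  set u := Units.oneSub ((α : ℂ) • B) ht with hu
  set g : X := (↑u⁻¹ : X →L[ℂ] X) f with hg
  have hgf : g - (α : ℂ) • B g = f := by
    have h1 : (u : X →L[ℂ] X) g = f := congrArg (fun A : X →L[ℂ] X => A f) u.mul_inv
    rw [← h1, hu, Units.val_oneSub]
    rfl
  obtain ⟨w, hw1, hw2⟩ := hBs g
  have hwY : w ∈ kerΛᗮ := by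
    refine mem_kerΛ_orthogonal_iff.2 fun i hi => ?_
    have h1 := inner_hermE_of_mem_graphΛ (summable_form hw1).hasSum hw2 i
    rw [lamE_eq_zero hi, inner_zero_left, neg_zero] at h1
    have h2 := mem_kerΛ_orthogonal_iff.1 f.2 i hi
    rw [← hgf, inner_sub_right, inner_smul_right, h1, mul_zero, sub_zero] at h2
    rw [inner_hermE_of_resolvent hx0 hw1, h2, neg_zero, zero_div]
  have hgr : ((⟨w, hwY⟩ : kerΛᗮ), f + (x : ℂ) • (⟨w, hwY⟩ : kerΛᗮ)) ∈ (perpOp α).graph := by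
    refine mem_perpOp_graph_iff.2 ⟨_, _, hw1, hw2, ?_⟩
    rw [Submodule.coe_add, Submodule.coe_smul, ← hgf]
    module
  obtain ⟨v, h1, h2⟩ := (LinearPMap.mem_graph_iff _).1 hgr
  refine ⟨v, ?_⟩
  simp only at h1 h2
  rw [h2, h1, add_sub_cancel_right]

end LambOseen

theorem lemma2p5 (α : ℝ) :
    (LambOseen.pseudospectralBound α : EReal) ≤ LambOseen.spectralBound α ∧
      1 ≤ LambOseen.pseudospectralBound α := by
  have hT := LambOseen.re_inner_perpOp_le α
  have hs := fun x hx f => LambOseen.perpOp_surjective α (x := x) hx f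
  refine ⟨le_iInf₂ fun z hz => LambOseen.inv_iSup_resolventNorm_le hT hs hz, ?_⟩
  rw [LambOseen.pseudospectralBound, ENNReal.one_le_inv]
  exact iSup_le fun l => LambOseen.resolventNorm_imaginary_le hT hs l
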